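/- **Setting.** All functions are formal power series over $\mathbb C$; repeated indices are summed. Let $M$ be the germ at a point $p$ of a Frobenius manifold $(M,\nabla^z=\nabla+z\mathcal A,e,E,r,\eta)$, in flat coordinates $u^a$ centred at $p$ (finitely many) with $e=\partial/\partial u^e$. Thus: $\partial_a\circ\partial_b=\mathcal A_{ab}^c\partial_c$ is a commutative, associative product with unit $e$; $\partial_a\mathcal A_{bc}^f=\partial_b\mathcal A_{ac}^f$; $\eta=(\eta_{ab})$ is a constant nondegenerate symmetric form with $\eta(X\circ Y,Z)=\eta(X,Y\circ Z)$; $E=(A_b^au^b+B^a)\partial_a$ satisfies $[E,X\circ Y]=[E,X]\circ Y+X\circ[E,Y]+X\circ Y$ and $\mathcal L_E\eta=(2-r)\eta$, with $r\in\mathbb R$. Endomorphisms $T$ of $T^*M$ act by $(T\omega)_b=T_b^c\omega_c$, and $T^*$ denotes their adjoint (on $TM$, or with respect to $\eta$ on $T^*M$). Let $\mathcal U=\mathcal A_E$, $\mu_b^a=(1-\tfrac r2)\delta_b^a-A_b^a$ and $\delta_z=\partial_z+z^{-1}(\mu+\tfrac12)+\mathcal U$. **Jet space.** Let $\widehat{\mathcal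 O}$ be the algebra of formal power series in $u^a_\ell-\delta_{\ell,1}\delta^a_e$ ($\ell\ge0$), i.e. of functions on the jet space of $M$ near the jet $p+te$, where $u^a_0=u^a$. Infinite sums of elements of $\widehat{\mathcal O}$ are taken coefficientwise. Put $\partial=\sum_\ell u^a_{\ell+1}\partial/\partial u^a_\ell$, $\mathcal Q=\sum_\ell\ell u^a_\ell\,\partial/\partial u^a_\ell$, $\mathcal X=u_1^b\mathcal A_b$, and define the vector fields $\sigma_{k,a}$ by $$\sigma_a(z)=\sum_{k\ge0}z^k\sigma_{k,a}=\sum_{\ell\ge0}\big((\partial+z\mathcal X)^\ell\mathcal X\big)_a^b\,\frac{\partial}{\partial u^b_\ell}.$$ **Large phase space.** Let $\Theta(z)=I+\sum_{n\ge0}z^{n+1}\Theta_n$ be a symmetric fundamental solution on $M$: $\nabla\circ\Theta(z)=\Theta(z)\circ\nabla^z$; $\Theta^*(-z)\Theta(z)=I$; and, writing $\tilde\delta_z=\Theta(z)\circ\delta_z\circ\Theta(z)^{-1}=\partial_z+z^{-1}\sum_{n\ge0}z^nR_n$, one has $[\mu_s,R_n]=-nR_n$ for $n>0$, where $\mu_s$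 is the semisimple part of $\mu$. Let $\partial_{k,a}$ be the vector fields with $\sum_kz^k\partial_{k,a}=\Theta_a^b(z)\sigma_b(z)$. Let $\mathbf t(z)=\sum_{k\in\mathbb Z}z^{-k-1}\mathbf t_k$ be the unique vector-valued series over $\widehat{\mathcal O}$ with $\mathcal Q\mathbf t(z)=-\mathbf t(z)$ and $$\sum_{j\ge0}y^j\partial_{j,a}\mathbf t^b(z)=\sum_{m\ge0}y^mz^{-m-1}\big(\Theta(y)\Theta(z)^{-1}\big)_a^b .$$ Let $\mathcal F_0\in\widehat{\mathcal O}$ be the unique function with $\partial_{k,a}\mathcal F_0=(-1)^k\eta_{ab}\mathbf t^b_{-k-1}$ for all $k\ge 0$ and $\mathcal Q\mathcal F_0=-2\mathcal F_0$. Let $$\Phi_a(z)=\hbar\sum_{k\ge0}z^k\partial_{k,a}+\sum_{k\ge0}(-z)^{-k-1}\eta_{ab}\mathbf t_k^b ,$$ $$L_k=\tfrac1{2\hbar}\operatorname{Res}_{z=0}{:}\eta\big(\Phi(-z),z\tilde\delta_z^{k+1}\Phi(z)\big){:}-\tfrac14\delta_{k,0}\operatorname{Tr}(\mu^2-\tfrac14)\qquad(k\ge-1),$$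 where the normal ordering puts multiplications to the left of derivations. For any sequence $\mathcal F_g\in\widehat{\mathcal O}$, $g\ge1$, define $z_{k,g}\in\widehat{\mathcal O}$ by $$\sum_{g\ge0}\hbar^{g-1}z_{k,g}=\Big(\exp\big(-\textstyle\sum_{g\ge0}\hbar^{g-1}\mathcal F_g\big)\circ L_k\circ\exp\big(\sum_{g\ge0}\hbar^{g-1}\mathcal F_g\big)\Big)1 ,$$ conjugation by $\exp(S)$ meaning that each $\partial_{k,a}$ is replaced by $\partial_{k,a}+(\partial_{k,a}S)$. **Operators on the jet space.** Let $\mathbf s(z)=\Theta^*(z)\mathbf t(z)=\sum_{k\in\mathbb Z} z^{-k-1}\mathbf s_k$ and $$\mathcal L_k=\operatorname{Res}_{z=0}\langle\mathbf s(z),z\delta_z^{k+1}\sigma(z)\rangle ,\qquad \Delta_k=\tfrac12\operatorname{Res}_{z=0}\eta\big(\sigma(-z),z\delta_z^{k+1}\sigma(z)\big),$$ where in $\Delta_kf$ the outer field $\sigma_c(-z)$ differentiates the $T^*M$-valued series $z\delta_z^{k+1}\sigma(z)f$ covariantly with respect to the pullback of $\nabla^z$, i.e. acts as $\sigma_c(-z)+z\mathcal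 X_c^b\mathcal A_b$. **Theorem.** Let $k\ge-1$. (0) $\mathcal L_k$ and $\Delta_k$ are intrinsic, i.e. independent of $\Theta$: indeed $\mathbf s_j=0$ for $j\le0$ and $\mathbf s_{n+1}=-\big((\mathcal X^*)^{-1}\partial\big)^{n}(\mathcal X^*)^{-1}e$ for $n\ge0$. (1) For $g>1$, the Virasoro constraint $z_{k,g}=0$ is equivalent to $$\mathcal L_k\mathcal F_g+\Delta_k\mathcal F_{g-1}+\tfrac12\sum_{i=1}^{g-1}\operatorname{Res}_{z=0}\eta\big(\sigma(-z)\mathcal F_i,z\delta_z^{k+1}\sigma(z)\mathcal F_{g-i}\big)=0 .$$ (2) The Virasoro constraint $z_{k,1}=0$ is equivalent to $$\mathcal L_k\mathcal F_1=\tfrac14\sum_{\ell=0}^k\operatorname{Tr}\big((\mu-\tfrac12)\mathcal U^\ell(\mu+\tfrac12)\mathcal U^{k-\ell}\big).$$ -/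

import Mathlib

open scoped Matrix

namespace JetVirasoro

noncomputable section

/-! ### Formal Frobenius manifolds in flat coordinates -/

/-- Formal functions on the base manifold near the basepoint `p`, in flat coordinates `u^a`
centred at `p`. -/
abbrev Base (A : Type*) := MvPowerSeries A ℂ

/-- The germ at a basepoint `p` of a Frobenius manifold `(M, ∇ + z𝒜, e, E, r, η)`, written in
flat coordinates `(u^a)` centred at `p` for which the (flat) identity field is `∂/∂u^e`.
In such coordinates `∇` is the componentwise derivative, and the Levi-Civita condition says that
the components of `η` are constants. -/
structure FrobeniusGerm (A : Type*) [Fintype A] [DecidableEq A] where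
  /-- the index of the identity vector field -/
  e : A
  /-- the conformal dimension -/
  r : ℝ
  /-- the components `η_{ab}` of the metric on the tangent bundle -/
  η : Matrix A A ℂ
  /-- `mul a b c = 𝒜_{ab}^c`, where `∂_a ∘ ∂_b = 𝒜_{ab}^c ∂_c`; the matrix `mul a` is the
  endomorphism `𝒜_{∂_a}` of the cotangent bundle, `(𝒜_{∂_a} ω)_b = 𝒜_{ab}^c ω_c` -/
  mul : A → Matrix A A (Base A)
  /-- `Elin b a = A_b^a = ∂_b E^a`, the linear part of the Euler field
  `E = (A_b^a u^b + B^a) ∂_a` -/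
  Elin : Matrix A A ℂ
  /-- `Econst a = B^a`, the value of the Euler field at the basepoint -/
  Econst : A → ℂ
  η_symm : ∀ a b, η a b = η b a
  η_nondeg : IsUnit η.det
  mul_comm : ∀ a b c, mul a b c = mul b a c
  mul_assoc : ∀ a b c f, ∑ d, mul a b d * mul d c f = ∑ d, mul b c d * mul a d f
  one_mul : mul e = 1
  /-- `[∇_X, 𝒜_Y] - [∇_Y, 𝒜_X] = 𝒜_{[X,Y]}` on the coordinate fields -/
  mul_flat : ∀ a b c f,
    MvPowerSeries.pderiv (R := ℂ) a (mul b c f) = MvPowerSeries.pderiv (R := ℂ) b (mul a c f)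
  /-- `η(X ∘ Y, Z) = η(X, Y ∘ Z)` -/
  mul_metric : ∀ a b c,
    ∑ d, mul a b d * MvPowerSeries.C (η d c) = ∑ d, mul b c d * MvPowerSeries.C (η a d)
  /-- `[E, X ∘ Y] = [E, X] ∘ Y + X ∘ [E, Y] + X ∘ Y` on the coordinate fields -/
  euler : ∀ a b f,
    ∑ d, (∑ c, MvPowerSeries.C (Elin c d) * MvPowerSeries.X c + MvPowerSeries.C (Econst d)) *
          MvPowerSeries.pderiv (R := ℂ) d (mul a b f)
        - ∑ d, mul a b d * MvPowerSeries.C (Elin d f)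
      = - ∑ d, MvPowerSeries.C (Elin a d) * mul d b f
        - ∑ d, MvPowerSeries.C (Elin b d) * mul a d f + mul a b f
  /-- `ℒ_E η = (2 - r) η` -/
  euler_metric : ∀ a b,
    ∑ c, Elin a c * η c b + ∑ c, Elin b c * η a c = (2 - (r : ℂ)) * η a b

variable {A : Type*} [Fintype A] [DecidableEq A]

namespace FrobeniusGerm

/-- The components of the Euler vector field `E`. -/
def eul (F : FrobeniusGerm A) (a : A) : Base A :=
  ∑ b, MvPowerSeries.C (F.Elin b a) * MvPowerSeries.X b + MvPowerSeries.C (F.Econst a)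

/-- `𝒰 = 𝒜_E`, an endomorphism of the cotangent bundle. -/
def 𝒰 (F : FrobeniusGerm A) : Matrix A A (Base A) :=
  ∑ c, F.eul c • F.mul c

/-- `μ = 1 - r/2 + ∇_E - ℒ_E` on the cotangent bundle: `μ_b^a = (1 - r/2) δ_b^a - ∂_b E^a`. -/
def μ (F : FrobeniusGerm A) : Matrix A A ℂ :=
  (1 - (F.r : ℂ) / 2) • (1 : Matrix A A ℂ) - F.Elin

end FrobeniusGerm

/-- Constant matrices as matrices of formal functions. -/
def constMat {τ : Type*} (T : Matrix A A ℂ) : Matrix A A (MvPowerSeries τ ℂ) :=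
  T.map (fun x => MvPowerSeries.C x)

/-! ### Fundamental solutions

A power series `Θ(z) = ∑ z^n Θ⁽ⁿ⁾` of endomorphisms of the cotangent bundle is given by its
coefficients `θ n = Θ⁽ⁿ⁾`; in the notation `Θ(z) = I + ∑ z^{n+1} Θ_n` this is `Θ_n = θ (n + 1)`. -/

/-- `Θ(0) = I` and `∇ ∘ Θ(z) = Θ(z) ∘ (∇ + z𝒜)`. -/
def IsFundamental (F : FrobeniusGerm A) (θ : ℕ → Matrix A A (Base A)) : Prop :=
  θ 0 = 1 ∧ ∀ n a, (θ (n + 1)).map (MvPowerSeries.pderiv (R := ℂ) a) = θ n * F.mul a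

/-- The coefficients of `Θ(z)⁻¹`. -/
def thetaInv (θ : ℕ → Matrix A A (Base A)) (n : ℕ) : Matrix A A (Base A) :=
  PowerSeries.coeff n (PowerSeries.invOfUnit (PowerSeries.mk θ) 1)

/-- The coefficients `R_n` of `R(z)`, where
`Θ(z) (∂_z + z⁻¹(μ + 1/2) + 𝒰) Θ(z)⁻¹ = ∂_z + z⁻¹ R(z)`, that is,
`R(z) = Θ(z) (μ + 1/2 + z𝒰) Θ(z)⁻¹ - z Θ'(z) Θ(z)⁻¹`. -/
def Rcoef (F : FrobeniusGerm A) (θ : ℕ → Matrix A A (Base A)) (n : ℕ) : Matrix A A (Base A) :=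
  PowerSeries.coeff n
    ((PowerSeries.mk θ *
          (PowerSeries.C (constMat (F.μ + (1 / 2 : ℂ) • (1 : Matrix A A ℂ)))
            + PowerSeries.X * PowerSeries.C F.𝒰)
        - PowerSeries.mk (fun m => m • θ m)) *
      PowerSeries.invOfUnit (PowerSeries.mk θ) 1)

/-- Conformality: if `μ = μ_s + μ_n` is the Jordan decomposition into commuting semisimple and
nilpotent parts, then `[μ_s, R_n] = -n R_n` for all `n > 0`. -/
def IsConformal (F : FrobeniusGerm A) (θ : ℕ → Matrix A A (Base A)) : Prop :=
  ∃ S N : Matrix A A ℂ, F.μ = S + N ∧ Commute S N ∧ IsNilpotent N ∧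
    Module.End.IsSemisimple (Matrix.toLin' S) ∧
    ∀ n : ℕ, 0 < n →
      constMat S * Rcoef F θ n - Rcoef F θ n * constMat S = -((n : ℂ) • Rcoef F θ n)

/-- A symmetric fundamental solution: fundamental, conformal, and `Θ*(-z) Θ(z) = I`, where
`T* = η Tᵀ η⁻¹` is the adjoint of an endomorphism of the cotangent bundle. -/
def IsSymmetricFundamental (F : FrobeniusGerm A) (θ : ℕ → Matrix A A (Base A)) : Prop :=
  IsFundamental F θ ∧ IsConformal F θ ∧
    ∀ n : ℕ, ∑ p ∈ Finset.HasAntidiagonal.antidiagonal n,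
      (-1 : ℂ) ^ p.1 • (constMat F.η * (θ p.1)ᵀ * constMat F.η⁻¹ * θ p.2) = if n = 0 then 1 else 0

/-! ### The jet space near its basepoint -/

/-- Formal functions on the jet space `J^∞ M` near the jet `t ↦ p + t e`, equivalently formal
functions on the large phase space. The variable `(ℓ, a)` is `u^a_ℓ - δ_{ℓ,1} δ^a_e`. -/
abbrev Jet (A : Type*) := MvPowerSeries (ℕ × A) ℂ

/-- The sum of a family of power series, coefficient by coefficient (every monomial is to occur
in finitely many members only). -/
def csum {τ ι : Type*} (f : ι → MvPowerSeries τ ℂ) : MvPowerSeries τ ℂ :=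
  fun m => ∑ᶠ i, MvPowerSeries.coeff m (f i)

/-- The vector field `∂/∂u^a_ℓ`. -/
def jetPartial (ℓ : ℕ) (a : A) : Jet A → Jet A :=
  MvPowerSeries.pderiv (R := ℂ) (ℓ, a)

/-- The inclusion `a ↦ (0, a)` of the variables `u^a = u^a_0`. -/
def zeroIndex : A ↪ ℕ × A := Function.Embedding.sectR 0 A

/-- Pullback of functions from `M` to the jet space: `u^a ↦ u^a_0`. -/
def pull : Base A →ₐ[ℂ] Jet A := MvPowerSeries.rename (zeroIndex (A := A))

/-- Pullback of endomorphisms of the cotangent bundle. -/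
def pullMat (T : Matrix A A (Base A)) : Matrix A A (Jet A) := T.map pull

namespace FrobeniusGerm

variable (F : FrobeniusGerm A)

/-- The jet coordinate `u^a_ℓ`. -/
def jetCoord (ℓ : ℕ) (a : A) : Jet A :=
  MvPowerSeries.X (ℓ, a) + if ℓ = 1 ∧ a = F.e then 1 else 0

/-- The vector field `∂ = ∑ u^a_{ℓ+1} ∂/∂u^a_ℓ`. -/
def total (f : Jet A) : Jet A :=
  csum fun p : ℕ × A => F.jetCoord (p.1 + 1) p.2 * jetPartial p.1 p.2 f

/-- The dilaton vector field `𝒬 = ∑ ℓ u^a_ℓ ∂/∂u^a_ℓ`. -/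
def dilaton (f : Jet A) : Jet A :=
  csum fun p : ℕ × A => (p.1 : ℂ) • (F.jetCoord p.1 p.2 * jetPartial p.1 p.2 f)

/-- `𝒳 = 𝒜_∂ = u^b_1 𝒜_b`. -/
def 𝒳 : Matrix A A (Jet A) := ∑ b, F.jetCoord 1 b • pullMat (F.mul b)

/-- `faa n j` is the coefficient of `z^j` in the noncommutative Faà di Bruno polynomial
`𝒫_{n+1}(z) = (∂ + z𝒳)^n 𝒳`. -/
def faa : ℕ → ℕ → Matrix A A (Jet A)
  | 0, 0 => F.𝒳
  | 0, _ + 1 => 0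
  | n + 1, 0 => (faa n 0).map F.total
  | n + 1, j + 1 => (faa n (j + 1)).map F.total + F.𝒳 * faa n j

/-- The vector field `σ_{k,a}`, where `σ(z) = ∑_k z^k σ_k = ∑_ℓ 𝒫_{ℓ+1}(z) ∂_ℓ`. -/
def sigma (k : ℕ) (a : A) (f : Jet A) : Jet A :=
  csum fun p : ℕ × A => F.faa p.1 k a p.2 * jetPartial p.1 p.2 f

/-! Laurent series in `z` with values in the pulled back cotangent bundle are families
`g : ℤ → A → Jet A`; `g m a` is the component with index `a` of the coefficient of `z^m`. -/

/-- The coefficients of `σ(z) f`. -/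
def sigmaSeries (f : Jet A) (m : ℤ) (a : A) : Jet A :=
  if 0 ≤ m then F.sigma m.toNat a f else 0

/-- The operator `δ_z = ∂_z + z⁻¹(μ + 1/2) + 𝒰`. -/
def delta (g : ℤ → A → Jet A) (m : ℤ) (a : A) : Jet A :=
  ((m : ℂ) + 1) • g (m + 1) a
    + ∑ b, (F.μ + (1 / 2 : ℂ) • (1 : Matrix A A ℂ)) a b • g (m + 1) b
    + ∑ b, pullMat F.𝒰 a b * g m b

/-- `Res_{z=0} η(f(-z), z g(z))`, for `η` the metric on the cotangent bundle. -/
def resPair (f g : ℤ → A → Jet A) : Jet A :=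
  csum fun i : ℤ => ∑ c, ∑ d, ((-1 : ℂ) ^ i * F.η⁻¹ c d) • (f i c * g (-2 - i) d)

/-- `𝒜_{σ_{0,c}} = 𝒳_c^b 𝒜_b`, which is also `𝒜_{σ_c(z)}`. -/
def 𝒲 (c : A) : Matrix A A (Jet A) := ∑ b, F.𝒳 c b • pullMat (F.mul b)

/-- The coefficient of `z^m` in `∇^z_{σ_c(-z)} g(z)`, where `∇^z = ∇ + z𝒜` is the Dubrovin
connection on the pulled back cotangent bundle; component with index `d`. -/
def covSigma (c : A) (g : ℤ → A → Jet A) (m : ℤ) (d : A) : Jet A :=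
  csum (fun i : ℕ => (-1 : ℂ) ^ i • F.sigma i c (g (m - i) d)) + ∑ f, F.𝒲 c d f * g (m - 1) f

/-- The second-order operator `Δ_k = ½ Res_{z=0} η(σ(-z), z δ_z^{k+1} σ(z))`, where the outer
vector field `σ(-z)` differentiates the section `z δ_z^{k+1} σ(z) f` of the pulled back cotangent
bundle by means of the connection `∇^z`. -/
def Delta (k : ℤ) (f : Jet A) : Jet A :=
  (1 / 2 : ℂ) • ∑ c, ∑ d, F.η⁻¹ c d •
    F.covSigma c (fun m => F.delta^[(k + 1).toNat] (F.sigmaSeries f) (m - 1)) (-1) d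

end FrobeniusGerm

/-! ### The large phase space: flat frame, `𝐭(z)`, genus zero potential -/

section LargePhaseSpace

variable (F : FrobeniusGerm A) (θ : ℕ → Matrix A A (Base A))

/-- The vector field `∂_{k,a}`, where `∂(z) = ∑ z^k ∂_k = Θ(z) σ(z)`. -/
def flatField (k : ℕ) (a : A) (f : Jet A) : Jet A :=
  ∑ p ∈ Finset.HasAntidiagonal.antidiagonal k, ∑ b, pullMat (θ p.1) a b * F.sigma p.2 b f

/-- The defining property of the generating function `𝐭(z) = ∑_{k ∈ ℤ} z^{-k-1} 𝐭_k`: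
`𝒬 𝐭(z) = -𝐭(z)` and `∂(y) 𝐭(z) = ∑_{m ≥ 0} y^m z^{-m-1} Θ(y) Θ(z)⁻¹`. -/
def IsFlatGenerating (t : ℤ → A → Jet A) : Prop :=
  (∀ k b, F.dilaton (t k b) = -t k b) ∧
  ∀ (j : ℕ) (a : A) (k : ℤ) (b : A), flatField F θ j a (t k b) =
    ∑ m ∈ Finset.range (j + 1), if k ≤ (m : ℤ) then
      pull ((θ (j - m) * thetaInv θ ((m : ℤ) - k).toNat) a b) else 0

/-- The generating function `𝐭(z)`, the unique family with the property `IsFlatGenerating`. For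
`k ≥ 0`, `𝐭_k^a` are the flat coordinates of the large phase space, with the dilaton shift. -/
def flatGen : ℤ → A → Jet A := Classical.epsilon (IsFlatGenerating F θ)

/-- The genus zero potential: the unique function with
`∂_{k,a} ℱ_0 = (-1)^k η_{ab} 𝐭_{-k-1}^b` and `𝒬 ℱ_0 = -2 ℱ_0`. -/
def genusZero : Jet A := Classical.epsilon fun f : Jet A =>
  (∀ (k : ℕ) (a : A), flatField F θ k a f =
    (-1 : ℂ) ^ k • ∑ b, F.η a b • flatGen F θ (-(k : ℤ) - 1) b) ∧
  F.dilaton f = (-2 : ℂ) • f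

/-- `𝐬(z) = Θ*(z) 𝐭(z) = ∑ z^{-k-1} 𝐬_k`, that is, `𝐬_k = ∑_n (Θ⁽ⁿ⁾)* 𝐭_{k+n}`. -/
def sVec (k : ℤ) (b : A) : Jet A :=
  csum fun n : ℕ => ∑ a, flatGen F θ (k + n) a * pullMat (θ n) a b

/-- The intrinsic form of `𝐬(z)`, with no reference to a fundamental solution:
`intrinsicSucc n` is `-((𝒳*)⁻¹ ∂)^n (𝒳*)⁻¹ e`, where `𝒳*` is the adjoint of `𝒳` on the tangent
bundle. -/
def intrinsicSucc : ℕ → A → Jet A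
  | 0 => -(F.𝒳⁻¹ F.e)
  | n + 1 => Matrix.vecMul (fun a => F.total (intrinsicSucc n a)) F.𝒳⁻¹

/-- The vector field `ℒ_k = Res_{z=0} ⟨𝐬(z), z δ_z^{k+1} σ(z)⟩` on the jet space. -/
def virField (k : ℤ) (f : Jet A) : Jet A :=
  csum fun j : ℤ => ∑ a, sVec F θ j a * F.delta^[(k + 1).toNat] (F.sigmaSeries f) (j - 1) a

/-! ### The Virasoro operators and constraints on the large phase space -/

/-- Formal Laurent series in `ħ` with coefficients functions on the large phase space. -/
abbrev Hbar (A : Type*) := LaurentSeries (Jet A)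

/-- The variable `ħ`. -/
def hbar : Hbar A := HahnSeries.single 1 1

/-- Coefficients of `z^i`, `i < 0`, in the free field
`Φ_a(z) = ħ ∑_{k ≥ 0} z^k ∂_{k,a} + ∑_{k ≥ 0} (-z)^{-k-1} η_{ab} 𝐭_k^b`;
`freeMul k a` is the coefficient of `z^{-k-1}`. -/
def freeMul (k : ℕ) (a : A) : Hbar A :=
  HahnSeries.C ((-1 : ℂ) ^ (k + 1) • ∑ b, F.η a b • flatGen F θ k b)

/-- The normally ordered product of the coefficient of `z^i` in `Φ_a(z)` and the coefficient of
`z^p` in `Φ_c(z)`, where the derivations `∂_{k,a}` act by given operators `D k a`. -/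
def normalProd (D : ℕ → A → Hbar A → Hbar A) : ℤ → A → ℤ → A → Hbar A → Hbar A
  | .ofNat i, a, .ofNat p, c, f => hbar ^ 2 * D i a (D p c f)
  | .negSucc i, a, .ofNat p, c, f => hbar * freeMul F θ i a * D p c f
  | .ofNat i, a, .negSucc p, c, f => hbar * freeMul F θ p c * D i a f
  | .negSucc i, a, .negSucc p, c, f => freeMul F θ i a * freeMul F θ p c * f

/-- The operator `δ̃_z = ∂_z + z⁻¹ R(z)` acting on Laurent series in `z` with matrix
coefficients. -/
def deltaTilde (g : ℤ → Matrix A A (Jet A)) (m : ℤ) : Matrix A A (Jet A) :=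
  ((m : ℂ) + 1) • g (m + 1) + ∑ᶠ j : ℕ, pullMat (Rcoef F θ j) * g (m + 1 - j)

/-- `kernelMat n p m` is the coefficient of `z^m` in `z δ̃_z^n (z^p I)`. -/
def kernelMat (n : ℕ) (p m : ℤ) : Matrix A A (Jet A) :=
  (deltaTilde F θ)^[n] (fun i => if i = p then 1 else 0) (m - 1)

/-- The Virasoro operator
`L_k = (1/2ħ) Res_{z=0} :η(Φ(-z), z δ̃_z^{k+1} Φ(z)): - ¼ δ_{k,0} Tr(μ² - ¼)`,
where the derivations `∂_{k,a}` act by `D k a`; `virOp F θ D k f N` is the coefficient of `ħ^N`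
in `L_k f`. -/
def virOp (D : ℕ → A → Hbar A → Hbar A) (k : ℤ) (f : Hbar A) (N : ℤ) : Jet A :=
  (csum fun q : ℤ × ℤ => ∑ a, ∑ b, ∑ c,
      ((1 / 2 : ℂ) * (-1 : ℂ) ^ q.1 * F.η⁻¹ a b) •
        (kernelMat F θ (k + 1).toNat q.2 (-1 - q.1) b c *
          (normalProd F θ D q.1 a q.2 c f).coeff (N + 1)))
    - if k = 0 then
        ((1 / 4 : ℂ) * (F.μ * F.μ - (1 / 4 : ℂ) • (1 : Matrix A A ℂ)).trace) • f.coeff N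
      else 0

theorem flatField_zero (k : ℕ) (a : A) : flatField F θ k a 0 = 0 := by
  have h : ∀ j b, F.sigma j b (0 : Jet A) = 0 := by
    intro j b
    have h0 : F.sigma j b (0 : Jet A) = csum fun _ : ℕ × A => (0 : Jet A) := by
      simp only [FrobeniusGerm.sigma, jetPartial, map_zero, mul_zero]
    rw [h0]
    ext m
    change (∑ᶠ _ : ℕ × A, MvPowerSeries.coeff m (0 : Jet A)) = _
    simp
  simp [flatField, h]

/-- The coefficientwise action of `∂_{k,a}` on Laurent series in `ħ`. -/
def flatFieldHbar (k : ℕ) (a : A) (f : Hbar A) : Hbar A :=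
  HahnSeries.map f (⟨flatField F θ k a, flatField_zero F θ k a⟩ : ZeroHom (Jet A) (Jet A))

/-- `exp(-S) ∘ ∂_{k,a} ∘ exp(S) = ∂_{k,a} + (∂_{k,a} S)`. -/
def conjField (S : Hbar A) (k : ℕ) (a : A) (f : Hbar A) : Hbar A :=
  flatFieldHbar F θ k a f + flatFieldHbar F θ k a S * f

/-- The total potential `∑_{g ≥ 0} ħ^{g-1} ℱ_g`, where `ℱ_0` is the genus zero potential of the
Frobenius manifold. -/
def totalPotential (Fg : ℕ → Jet A) : Hbar A :=
  HahnSeries.single (-1) 1 *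
    HahnSeries.ofPowerSeries ℤ (Jet A)
      (PowerSeries.mk fun g => if g = 0 then genusZero F θ else Fg g)

/-- The function `z_{k,g}`: with `S = ∑_{g ≥ 0} ħ^{g-1} ℱ_g`,
`∑_g ħ^{g-1} z_{k,g} = (exp(-S) ∘ L_k ∘ exp(S)) 1`. The conjugate of `L_k` by `exp(S)` is obtained
from `L_k` by replacing each `∂_{k,a}` by its conjugate `∂_{k,a} + (∂_{k,a} S)`. -/
def constraint (Fg : ℕ → Jet A) (k : ℤ) (g : ℕ) : Jet A :=
  virOp F θ (conjField F θ (totalPotential F θ Fg)) k 1 ((g : ℤ) - 1)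

end LargePhaseSpace

end

end JetVirasoro

open JetVirasoro

/-! Conjugating L_k by exp(S) and applying it to 1 gives a quadratic expression in the expectation
of the free field, plus second derivatives of S, plus a constant. In positive genus
(`constraint_succ`) the quadratic part pairs the genus zero expectation with dF_g, twice, and dF_i
with dF_{g-i}; the second derivatives fall on F_{g-1}; the constant enters in genus one only. The
pairing is symmetric because δ̃_z is (`kernelForm_transpose`), so the two genus zero terms agree and
absorb the factor 1/2.

All of this is written in the flat frame, and the point is that Θ can be gauged away. Three facts
suffice: ∂(z) = Θ(z)σ(z); δ̃_z Θ = Θ δ_z; and Θ*(-z) = Θ(z)⁻¹. In the pairing of two differentials Θ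
cancels against its adjoint (`pairing_flatSeries`). In the first-order term Θ moves onto 𝐭(z) and
turns it into 𝐬(z) (`pairing_genusZeroSeries`). In the second-order term the outer field also
differentiates Θ, and since ∇ ∘ Θ = Θ ∘ ∇^z this is the Dubrovin connection in Δ_k
(`secondOrder_eq`).

That 𝐬(z) is intrinsic is proved backwards. The explicit sections satisfy σ_c(y)𝐬(z) = z 𝐬(z)𝒲_c +
∑_q y^q z^{-q-1} e_c, with e_c the c-th row of the identity matrix (`sigma_sInt`). Hence 𝐬(z)Θ(z)⁻¹
has the two properties defining 𝐭(z) (`isFlatGenerating_tSol`). Those properties determine 𝐭(z),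
because a function killed by all flat fields is constant (`pderiv_eq_zero_of_sigma`) and a constant
is not a -1 eigenvector of 𝒬 unless it vanishes.

In genus one the second derivatives of F_0 remain. They are, up to sign and η, the coefficients
v_{p,i} of (1 - Θ(x)Θ(y)⁻¹)/(x - y), and the contribution is ∑ Tr(D_{p,i} v_{p,i}), with D_{p,i} the
coefficient of z^{-2-i} in δ̃_z^{k+1} z^p. Commuting z∂_z + R(z) past δ̃_z^{k+1} multiplies D by k
(`monoCoeff_commutator`); transposed onto v, the same operation produces R_{p+i+1} - Θ_p 𝒰 Θ⁻¹_i,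
with subscripts denoting coefficients (`bezout_identity`). The R-term is traceless by conformality.
The other term is the trace of 𝒰 times the z^{-2} coefficient of δ_z^{k+1} 1, an elementary
computation giving k/2 times the required sum. The factor k cancels (`trace_bezout`); k = 0 and k =
-1 are checked directly.

Infinite sums are controlled by the weight filtration in which u_ℓ has weight ℓ: the coefficients of
σ_k and the sections 𝐬_j have weights tending to infinity (`lev_faa`, `wt_sInt`). -/

namespace JetVirasoro

noncomputable section

set_option linter.unusedSectionVars false

section

/-! ### Coefficientwise finite families -/

section CoefficientwiseSums

open MvPowerSeries

variable {τ ι κ : Type*}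

/-- Every monomial occurs in finitely many members of the family. -/
def CFin (f : ι → MvPowerSeries τ ℂ) : Prop :=
  ∀ m, (Function.support fun i => coeff m (f i)).Finite

theorem coeff_csum (f : ι → MvPowerSeries τ ℂ) (m : τ →₀ ℕ) :
    coeff m (csum f) = ∑ᶠ i, coeff m (f i) := rfl

theorem CFin.of_support_subset {f : ι → MvPowerSeries τ ℂ} (s : Finset ι)
    (h : ∀ i, i ∉ s → f i = 0) : CFin f := fun m =>
  s.finite_toSet.subset fun i hi => by
    by_contra hs
    exact hi (by simp [h i hs])

theorem CFin.zero : CFin (fun _ : ι => (0 : MvPowerSeries τ ℂ)) := fun m => by simp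

theorem CFin.mono {f g : ι → MvPowerSeries τ ℂ} (hf : CFin f)
    (h : ∀ i m, coeff m (f i) = 0 → coeff m (g i) = 0) : CFin g := fun m =>
  (hf m).subset fun i hi hi' => hi (h i m hi')

theorem CFin.add {f g : ι → MvPowerSeries τ ℂ} (hf : CFin f) (hg : CFin g) :
    CFin (fun i => f i + g i) := fun m =>
  ((hf m).union (hg m)).subset fun i hi => by
    by_contra h
    simp only [Set.mem_union, Function.mem_support, not_or, not_not] at h
    exact hi (by simp [h.1, h.2])

theorem CFin.sum {s : Finset κ} {f : κ → ι → MvPowerSeries τ ℂ} (hf : ∀ j ∈ s, CFin (f j)) :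
    CFin (fun i => ∑ j ∈ s, f j i) := by
  classical
  induction s using Finset.induction_on with
  | empty => simpa using CFin.zero
  | insert a s ha ih =>
    simp only [Finset.sum_insert ha]
    exact (hf a (by simp)).add (ih fun j hj => hf j (by simp [hj]))

/-- A coefficient of a product involves only finitely many coefficients of the factors, so
finiteness of one factor is enough and `g` may be arbitrary. -/
theorem CFin.mul_left {f : ι → MvPowerSeries τ ℂ} (hf : CFin f) (g : ι → MvPowerSeries τ ℂ) :
    CFin (fun i => g i * f i) := fun m => by
  classical
  refine ((Finset.HasAntidiagonal.antidiagonal m).finite_toSet.biUnion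
    fun q _ => hf q.2).subset fun i hi => ?_
  by_contra h
  refine hi ?_
  simp only [Set.mem_iUnion, not_exists, Function.mem_support, not_not] at h
  change coeff m (g i * f i) = 0
  rw [coeff_mul]
  exact Finset.sum_eq_zero fun q hq => by rw [h q hq, mul_zero]

theorem CFin.mul_right {f : ι → MvPowerSeries τ ℂ} (hf : CFin f) (g : ι → MvPowerSeries τ ℂ) :
    CFin (fun i => f i * g i) := by
  simpa only [mul_comm] using hf.mul_left g

theorem CFin.smul {f : ι → MvPowerSeries τ ℂ} (hf : CFin f) (c : ι → ℂ) :
    CFin (fun i => c i • f i) :=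
  hf.mono fun i m h => by simp [h]

theorem CFin.prod {f : ι → MvPowerSeries τ ℂ} {g : κ → MvPowerSeries τ ℂ} (hf : CFin f)
    (hg : CFin g) : CFin fun x : ι × κ => f x.1 * g x.2 := fun m => by
  classical
  let s := (Finset.HasAntidiagonal.antidiagonal m)
  have h1 : (⋃ q ∈ s, Function.support fun i => coeff q.1 (f i)).Finite :=
    s.finite_toSet.biUnion fun q _ => hf q.1
  have h2 : (⋃ q ∈ s, Function.support fun i => coeff q.2 (g i)).Finite :=
    s.finite_toSet.biUnion fun q _ => hg q.2
  refine (h1.prod h2).subset fun x hx => ?_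
  have hx' : coeff m (f x.1 * g x.2) ≠ 0 := hx
  rw [coeff_mul] at hx'
  obtain ⟨q, hq, hne⟩ := Finset.exists_ne_zero_of_sum_ne_zero hx'
  exact ⟨Set.mem_biUnion hq (left_ne_zero_of_mul hne),
    Set.mem_biUnion hq (right_ne_zero_of_mul hne)⟩

theorem CFin.pderiv {f : ι → MvPowerSeries τ ℂ} (hf : CFin f) (p : τ) :
    CFin (fun i => MvPowerSeries.pderiv ℂ p (f i)) := fun m =>
  (hf (m + Finsupp.single p 1)).subset fun i hi hi' => hi <| by
    simp only at hi'
    simp [coeff_pderiv, hi']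

theorem CFin.comp_injective {f : ι → MvPowerSeries τ ℂ} (hf : CFin f) {e : κ → ι}
    (he : Function.Injective e) : CFin (fun i => f (e i)) := fun m =>
  ((hf m).preimage he.injOn)

theorem csum_zero : csum (fun _ : ι => (0 : MvPowerSeries τ ℂ)) = 0 := by
  ext m; simp [coeff_csum]

theorem csum_add {f g : ι → MvPowerSeries τ ℂ} (hf : CFin f) (hg : CFin g) :
    csum (fun i => f i + g i) = csum f + csum g := by
  ext m
  simp only [coeff_csum, map_add]
  exact finsum_add_distrib (hf m) (hg m)

theorem csum_smul {f : ι → MvPowerSeries τ ℂ} (c : ℂ) :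
    csum (fun i => c • f i) = c • csum f := by
  ext m
  simp only [coeff_csum, map_smul]
  exact (smul_finsum c _).symm

theorem csum_neg (f : ι → MvPowerSeries τ ℂ) : csum (fun i => - f i) = - csum f := by
  ext m
  simp only [coeff_csum, map_neg]
  exact finsum_neg_distrib _

theorem csum_sub {f g : ι → MvPowerSeries τ ℂ} (hf : CFin f) (hg : CFin g) :
    csum (fun i => f i - g i) = csum f - csum g := by
  ext m
  simp only [coeff_csum, map_sub]
  exact finsum_sub_distrib (hf m) (hg m)

theorem csum_sum {s : Finset κ} {f : κ → ι → MvPowerSeries τ ℂ} (hf : ∀ j ∈ s, CFin (f j)) :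
    csum (fun i => ∑ j ∈ s, f j i) = ∑ j ∈ s, csum (f j) := by
  ext m
  simp only [coeff_csum, map_sum]
  exact finsum_sum_comm _ _ fun j hj => hf j hj m

theorem csum_mul_left {f : ι → MvPowerSeries τ ℂ} (hf : CFin f) (g : MvPowerSeries τ ℂ) :
    csum (fun i => g * f i) = g * csum f := by
  classical
  ext m
  simp only [coeff_csum, coeff_mul]
  rw [finsum_sum_comm]
  · refine Finset.sum_congr rfl fun q _ => ?_
    exact (mul_finsum' _ _ (hf q.2)).symm
  · intro q _
    exact (hf q.2).subset fun i hi hi' => hi (by simp only at hi'; simp [hi'])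

theorem csum_mul_right {f : ι → MvPowerSeries τ ℂ} (hf : CFin f) (g : MvPowerSeries τ ℂ) :
    csum (fun i => f i * g) = csum f * g := by
  simpa only [mul_comm] using csum_mul_left hf g

theorem csum_eq_sum {f : ι → MvPowerSeries τ ℂ} (s : Finset ι) (h : ∀ i, i ∉ s → f i = 0) :
    csum f = ∑ i ∈ s, f i := by
  ext m
  rw [coeff_csum, map_sum]
  refine finsum_eq_sum_of_support_subset _ fun i hi => ?_
  by_contra hs
  exact hi (by simp [h i hs])

theorem csum_eq_single {f : ι → MvPowerSeries τ ℂ} (a : ι) (h : ∀ i, i ≠ a → f i = 0) :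
    csum f = f a := by
  rw [csum_eq_sum {a} (by simpa using h), Finset.sum_singleton]

theorem csum_fintype [Fintype ι] (f : ι → MvPowerSeries τ ℂ) : csum f = ∑ i, f i :=
  csum_eq_sum _ (by simp)

theorem csum_equiv (e : κ ≃ ι) (f : ι → MvPowerSeries τ ℂ) :
    csum (fun i => f (e i)) = csum f := by
  ext m
  exact finsum_comp_equiv e (f := fun i => coeff m (f i))

theorem csum_prod {f : ι × κ → MvPowerSeries τ ℂ} (hf : CFin f) :
    csum f = csum fun i => csum fun j => f (i, j) := by
  ext m
  simp only [coeff_csum]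
  exact finsum_curry _ (hf m)

theorem CFin.csum_inner {f : ι × κ → MvPowerSeries τ ℂ} (hf : CFin f) :
    CFin fun i => csum fun j => f (i, j) := fun m => by
  refine ((hf m).image Prod.fst).subset fun i hi => ?_
  by_contra h
  refine hi ?_
  change coeff m (csum fun j => f (i, j)) = 0
  rw [coeff_csum, finsum_eq_zero_of_forall_eq_zero]
  intro j
  by_contra hj
  exact h ⟨(i, j), hj, rfl⟩

theorem CFin.swap {f : ι → κ → MvPowerSeries τ ℂ} (hf : CFin fun p : ι × κ => f p.1 p.2) :
    CFin fun p : κ × ι => f p.2 p.1 :=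
  hf.comp_injective (Equiv.prodComm κ ι).injective

theorem csum_comm {f : ι → κ → MvPowerSeries τ ℂ} (hf : CFin fun p : ι × κ => f p.1 p.2) :
    (csum fun i => csum fun j => f i j) = csum fun j => csum fun i => f i j := by
  rw [← csum_prod (f := fun p : ι × κ => f p.1 p.2) hf,
    ← csum_prod (f := fun p : κ × ι => f p.2 p.1) hf.swap]
  exact csum_equiv (Equiv.prodComm ι κ) (fun p : κ × ι => f p.2 p.1)

/-- No finiteness is needed: a coefficient of the derivative is a scalar multiple of one coefficient
of the series. -/
theorem pderiv_csum {f : ι → MvPowerSeries τ ℂ} (p : τ) :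
    MvPowerSeries.pderiv ℂ p (csum f) = csum fun i => MvPowerSeries.pderiv ℂ p (f i) := by
  ext m
  simp only [coeff_csum, coeff_pderiv]
  rw [finsum_mul]

/-! ### Formal vector fields -/

/-- The formal vector field `∑ c_p ∂_p`. -/
def vf (c : τ → MvPowerSeries τ ℂ) (f : MvPowerSeries τ ℂ) : MvPowerSeries τ ℂ :=
  csum fun p => c p * MvPowerSeries.pderiv ℂ p f

theorem vf_C (c : τ → MvPowerSeries τ ℂ) (a : ℂ) : vf c (C a) = 0 := by
  simp [vf, csum_zero]

theorem vf_one (c : τ → MvPowerSeries τ ℂ) : vf c 1 = 0 := by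
  simp [vf, csum_zero]

theorem vf_X (c : τ → MvPowerSeries τ ℂ) (p : τ) : vf c (X p) = c p := by
  classical
  rw [vf, csum_eq_single p]
  · simp
  · intro q hq
    rw [pderiv_X_of_ne (Ne.symm hq), mul_zero]

theorem vf_zero (c : τ → MvPowerSeries τ ℂ) : vf c 0 = 0 := by
  simp [vf, csum_zero]

theorem vf_smul (c : τ → MvPowerSeries τ ℂ) (a : ℂ) (f : MvPowerSeries τ ℂ) :
    vf c (a • f) = a • vf c f := by
  simp only [vf, Derivation.map_smul, mul_smul_comm, csum_smul]

theorem vf_neg (c : τ → MvPowerSeries τ ℂ) (f : MvPowerSeries τ ℂ) : vf c (-f) = - vf c f := by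
  simp only [vf, map_neg, mul_neg, csum_neg]

variable {c : τ → MvPowerSeries τ ℂ}

theorem vf_add (hc : CFin c) (f g : MvPowerSeries τ ℂ) : vf c (f + g) = vf c f + vf c g := by
  simp only [vf, map_add, mul_add]
  exact csum_add (hc.mul_right _) (hc.mul_right _)

theorem vf_sub (hc : CFin c) (f g : MvPowerSeries τ ℂ) : vf c (f - g) = vf c f - vf c g := by
  rw [sub_eq_add_neg, vf_add hc, vf_neg, sub_eq_add_neg]

theorem vf_mul (hc : CFin c) (f g : MvPowerSeries τ ℂ) : vf c (f * g) = vf c f * g + f * vf c g := by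
  simp only [vf, Derivation.leibniz, smul_eq_mul, mul_add]
  rw [csum_add (hc.mul_right _) (hc.mul_right _), add_comm,
    ← csum_mul_right (hc.mul_right _), ← csum_mul_left (hc.mul_right _)]
  congr 1 <;> exact congrArg csum (funext fun p => by ring)

theorem vf_sum (hc : CFin c) (s : Finset κ) (f : κ → MvPowerSeries τ ℂ) :
    vf c (∑ i ∈ s, f i) = ∑ i ∈ s, vf c (f i) := by
  classical
  induction s using Finset.induction_on with
  | empty => simp [vf_zero]
  | insert a s ha ih => rw [Finset.sum_insert ha, Finset.sum_insert ha, vf_add hc, ih]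

/-- For a fixed monomial, finiteness of `c` leaves finitely many directions `p`; for each of them
the family of derivatives is still finite, leaving finitely many `i`. This is what allows a formal
vector field to pass through an infinite sum. -/
theorem cfin_vf_prod (hc : CFin c) {f : ι → MvPowerSeries τ ℂ} (hf : CFin f) :
    CFin fun q : ι × τ => c q.2 * MvPowerSeries.pderiv ℂ q.2 (f q.1) := fun m => by
  classical
  let s := (Finset.HasAntidiagonal.antidiagonal m)
  let P : Set τ := ⋃ q ∈ s, Function.support fun i => coeff q.1 (c i)
  have hP : P.Finite := s.finite_toSet.biUnion fun q _ => hc q.1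
  let I : Set ι := ⋃ p ∈ P, ⋃ q ∈ s, Function.support fun i =>
    coeff q.2 (MvPowerSeries.pderiv ℂ p (f i))
  have hI : I.Finite := hP.biUnion fun p _ => s.finite_toSet.biUnion fun q _ => hf.pderiv p q.2
  refine (hI.prod hP).subset fun x hx => ?_
  have hx' : coeff m (c x.2 * MvPowerSeries.pderiv ℂ x.2 (f x.1)) ≠ 0 := hx
  rw [coeff_mul] at hx'
  obtain ⟨q, hq, hne⟩ := Finset.exists_ne_zero_of_sum_ne_zero hx'
  have h2 : x.2 ∈ P := Set.mem_biUnion hq (left_ne_zero_of_mul hne)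
  exact ⟨Set.mem_biUnion h2 (Set.mem_biUnion hq (right_ne_zero_of_mul hne)), h2⟩

theorem CFin.vf {f : ι → MvPowerSeries τ ℂ} (hf : CFin f) (hc : CFin c) : CFin fun i => vf c (f i) :=
  (cfin_vf_prod hc hf).csum_inner

theorem vf_csum (hc : CFin c) {f : ι → MvPowerSeries τ ℂ} (hf : CFin f) :
    vf c (csum f) = csum fun i => vf c (f i) := by
  simp only [JetVirasoro.vf, pderiv_csum]
  rw [csum_comm (f := fun i p => c p * MvPowerSeries.pderiv ℂ p (f i)) (cfin_vf_prod hc hf)]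
  exact congrArg csum (funext fun p => (csum_mul_left (hf.pderiv p) _).symm)

theorem vf_eq_zero_of_pderiv {f : MvPowerSeries τ ℂ} (h : ∀ p, MvPowerSeries.pderiv ℂ p f = 0) :
    vf c f = 0 := by
  simp [JetVirasoro.vf, h, csum_zero]

theorem pderiv_pderiv_comm (p q : τ) (f : MvPowerSeries τ ℂ) :
    MvPowerSeries.pderiv ℂ p (MvPowerSeries.pderiv ℂ q f) =
      MvPowerSeries.pderiv ℂ q (MvPowerSeries.pderiv ℂ p f) := by
  classical
  ext m
  simp only [coeff_pderiv, Finsupp.add_apply]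
  rw [add_right_comm m]
  rcases eq_or_ne p q with rfl | h
  · rfl
  · rw [Finsupp.single_eq_of_ne h, Finsupp.single_eq_of_ne (Ne.symm h)]
    simp only [Nat.add_zero]
    ring

/-- The commutator of two formal vector fields, in coordinates. -/
theorem vf_vf_sub (hc : CFin c) {d : τ → MvPowerSeries τ ℂ} (hd : CFin d) (f : MvPowerSeries τ ℂ) :
    vf c (vf d f) - vf d (vf c f) =
      csum fun p => (vf c (d p) - vf d (c p)) * MvPowerSeries.pderiv ℂ p f := by
  have key : ∀ {c d : τ → MvPowerSeries τ ℂ}, CFin c → CFin d →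
      JetVirasoro.vf c (JetVirasoro.vf d f) =
        csum (fun p => JetVirasoro.vf c (d p) * MvPowerSeries.pderiv ℂ p f) +
        csum fun p => csum fun q => d p * (c q * MvPowerSeries.pderiv ℂ q
          (MvPowerSeries.pderiv ℂ p f)) := by
    intro c d hc hd
    conv_lhs => rw [JetVirasoro.vf.eq_def d f]
    have h2 : CFin fun p => csum fun q => d p * (c q * MvPowerSeries.pderiv ℂ q
        (MvPowerSeries.pderiv ℂ p f)) :=
      CFin.csum_inner (f := fun x : τ × τ => d x.1 * (c x.2 * MvPowerSeries.pderiv ℂ x.2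
        (MvPowerSeries.pderiv ℂ x.1 f))) (by
        simpa only [mul_assoc] using (hd.prod hc).mul_right fun x => MvPowerSeries.pderiv ℂ x.2
          (MvPowerSeries.pderiv ℂ x.1 f))
    rw [vf_csum hc (hd.mul_right _), ← csum_add ((hd.vf hc).mul_right _) h2]
    refine congrArg csum (funext fun p => ?_)
    rw [vf_mul hc, csum_mul_left (hc.mul_right _)]
    rfl
  rw [key hc hd, key hd hc]
  have h3 : CFin fun x : τ × τ => d x.1 * (c x.2 * MvPowerSeries.pderiv ℂ x.2
      (MvPowerSeries.pderiv ℂ x.1 f)) := by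
    simpa only [mul_assoc] using (hd.prod hc).mul_right fun x => MvPowerSeries.pderiv ℂ x.2
      (MvPowerSeries.pderiv ℂ x.1 f)
  rw [csum_comm (f := fun p q => d p * (c q * MvPowerSeries.pderiv ℂ q
      (MvPowerSeries.pderiv ℂ p f))) h3]
  -- Mixed partial derivatives commute, so the second-order terms of the two compositions coincide
  -- and drop out of the commutator.
  have h4 : (csum fun j => csum fun i => d i * (c j * MvPowerSeries.pderiv ℂ j
      (MvPowerSeries.pderiv ℂ i f))) = csum fun p => csum fun q => c p * (d q *
        MvPowerSeries.pderiv ℂ q (MvPowerSeries.pderiv ℂ p f)) :=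
    congrArg csum (funext fun p => congrArg csum (funext fun q => by
      rw [pderiv_pderiv_comm p q]; ring))
  rw [h4, add_sub_add_right_eq_sub, ← csum_sub ((hd.vf hc).mul_right _) ((hc.vf hd).mul_right _)]
  exact congrArg csum (funext fun p => by ring)

end CoefficientwiseSums

end

section

open MvPowerSeries

variable {A : Type*}

/-! ### The weight filtration on functions on the jet space -/

/-- The weight `∑ ℓ m(ℓ, a)` of a monomial. -/
def wt (m : ℕ × A →₀ ℕ) : ℕ := Finsupp.weight (fun p : ℕ × A => p.1) m

theorem wt_add (m m' : ℕ × A →₀ ℕ) : wt (m + m') = wt m + wt m' := map_add _ _ _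

theorem wt_single (p : ℕ × A) : wt (Finsupp.single p 1) = p.1 := by
  simp [wt, Finsupp.weight_single]

/-- Every monomial of `f` has weight at least `d`. -/
def Wt (d : ℕ) (f : Jet A) : Prop := ∀ m, coeff m f ≠ 0 → d ≤ wt m

theorem Wt.zero_left (f : Jet A) : Wt 0 f := fun _ _ => Nat.zero_le _

theorem Wt.zero_right (d : ℕ) : Wt d (0 : Jet A) := fun m h => absurd (by simp) h

theorem Wt.mono {d d' : ℕ} {f : Jet A} (h : Wt d f) (hd : d' ≤ d) : Wt d' f := fun m hm =>
  hd.trans (h m hm)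

theorem Wt.add {d : ℕ} {f g : Jet A} (hf : Wt d f) (hg : Wt d g) : Wt d (f + g) := fun m hm => by
  by_contra h
  have h1 := not_imp_not.mpr (hf m) h
  have h2 := not_imp_not.mpr (hg m) h
  rw [not_not] at h1 h2
  exact hm (by rw [map_add, h1, h2, add_zero])

theorem Wt.neg {d : ℕ} {f : Jet A} (hf : Wt d f) : Wt d (-f) := fun m hm =>
  hf m fun h => hm (by rw [map_neg, h, neg_zero])

theorem Wt.smul {d : ℕ} {f : Jet A} (hf : Wt d f) (c : ℂ) : Wt d (c • f) := fun m hm =>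
  hf m fun h => hm (by rw [map_smul, h, smul_zero])

theorem Wt.sum {ι : Type*} {d : ℕ} {s : Finset ι} {f : ι → Jet A} (hf : ∀ i ∈ s, Wt d (f i)) :
    Wt d (∑ i ∈ s, f i) := fun m hm => by
  rw [map_sum] at hm
  obtain ⟨i, hi, h⟩ := Finset.exists_ne_zero_of_sum_ne_zero hm
  exact hf i hi m h

theorem Wt.csum {ι : Type*} {d : ℕ} {f : ι → Jet A} (hf : ∀ i, Wt d (f i)) :
    Wt d (csum f) := fun m hm => by
  rw [coeff_csum] at hm
  by_contra hd
  refine hm (finsum_eq_zero_of_forall_eq_zero fun i => ?_)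
  by_contra h
  exact hd (hf i m h)

theorem Wt.mul {d d' : ℕ} {f g : Jet A} (hf : Wt d f) (hg : Wt d' g) :
    Wt (d + d') (f * g) := fun m hm => by
  classical
  rw [coeff_mul] at hm
  obtain ⟨q, hq, h⟩ := Finset.exists_ne_zero_of_sum_ne_zero hm
  rw [Finset.HasAntidiagonal.mem_antidiagonal] at hq
  rw [← hq, wt_add]
  exact add_le_add (hf _ (left_ne_zero_of_mul h)) (hg _ (right_ne_zero_of_mul h))

theorem Wt.mul_left {d : ℕ} {f : Jet A} (hf : Wt d f) (g : Jet A) : Wt d (g * f) := by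
  simpa using (Wt.zero_left g).mul hf

theorem Wt.mul_right {d : ℕ} {f : Jet A} (hf : Wt d f) (g : Jet A) : Wt d (f * g) := by
  simpa using hf.mul (Wt.zero_left g)

theorem wt_X (p : ℕ × A) : Wt p.1 (X p : Jet A) := fun m hm => by
  classical
  rw [coeff_X] at hm
  split_ifs at hm with h
  · rw [h, wt_single]
  · exact absurd rfl hm

theorem Wt.pderiv {d : ℕ} {f : Jet A} (hf : Wt d f) (p : ℕ × A) :
    Wt (d - p.1) (MvPowerSeries.pderiv ℂ p f) := fun m hm => by
  rw [coeff_pderiv] at hm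
  have := hf _ (left_ne_zero_of_mul hm)
  rw [wt_add, wt_single] at this
  omega

theorem eq_zero_of_wt {f : Jet A} (h : ∀ d, Wt d f) : f = 0 := by
  ext m
  by_contra hm
  have := h (wt m + 1) m hm
  omega

/-- The source of almost all finiteness below: a monomial has one finite weight, so only members
with small lower bound can contain it. -/
theorem Wt.cfin {ι : Type*} {f : ι → Jet A} (d : ι → ℕ) (h : ∀ i, Wt (d i) (f i))
    (hd : ∀ N, {i | d i ≤ N}.Finite) : CFin f := fun m =>
  (hd (wt m)).subset fun i hi => h i m hi

/-! ### Pullbacks -/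

theorem embDomain_add_single (x : A →₀ ℕ) (a : A) :
    Finsupp.embDomain zeroIndex (x + Finsupp.single a 1) =
      Finsupp.embDomain zeroIndex x + Finsupp.single (0, a) 1 := by
  rw [← Finsupp.embDomain.addMonoidHom_apply, map_add]
  simp [zeroIndex]

theorem coeff_pull_of_notMem (f : Base A) {m : ℕ × A →₀ ℕ}
    (hm : m ∉ Set.range (Finsupp.embDomain (zeroIndex (A := A)))) : coeff m (pull f) = 0 :=
  coeff_rename_eq_zero _ _ fun ⟨x, hx⟩ => hm ⟨x, by rw [Finsupp.embDomain_eq_mapDomain]; exact hx⟩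

theorem pderiv_pull (ℓ : ℕ) (a : A) (f : Base A) :
    MvPowerSeries.pderiv ℂ (ℓ, a) (pull f) =
      if ℓ = 0 then pull (MvPowerSeries.pderiv ℂ a f) else 0 := by
  classical
  ext m
  rw [coeff_pderiv]
  by_cases hm : ℓ = 0 ∧ m ∈ Set.range (Finsupp.embDomain (zeroIndex (A := A)))
  · obtain ⟨rfl, x, rfl⟩ := hm
    rw [if_pos rfl, ← embDomain_add_single, pull, coeff_embDomain_rename, coeff_embDomain_rename,
      coeff_pderiv]
    congr 3
    exact Finsupp.embDomain_apply_self zeroIndex x a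
  · rw [coeff_pull_of_notMem, zero_mul]
    · split_ifs with h
      · exact (coeff_pull_of_notMem _ fun h' => hm ⟨h, h'⟩).symm
      · simp
    -- If m plus one copy of the variable (ℓ, a) came from the base, then ℓ = 0, and removing that
    -- variable again shows that m comes from the base, contrary to `hm`.
    · rintro ⟨y, hy⟩
      have h1 : Finsupp.embDomain zeroIndex y (ℓ, a) ≠ 0 := by simp [hy]
      have hℓ : ℓ = 0 := by
        by_contra h
        refine h1 (Finsupp.embDomain_of_notMem_range _ _ _ ?_)
        rintro ⟨b, hb⟩
        exact h (congrArg Prod.fst hb).symm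
      subst hℓ
      have h2 : y a ≠ 0 := by
        rwa [show ((0 : ℕ), a) = zeroIndex a from rfl, Finsupp.embDomain_apply_self] at h1
      refine hm ⟨rfl, y - Finsupp.single a 1, ?_⟩
      have h3 : y - Finsupp.single a 1 + Finsupp.single a 1 = y :=
        Finsupp.sub_add_single_one_cancel h2
      rw [← h3, embDomain_add_single] at hy
      exact add_right_cancel hy

theorem vf_pull [Fintype A] (c : ℕ × A → Jet A) (f : Base A) :
    vf c (pull f) = ∑ b, c (0, b) * pull (MvPowerSeries.pderiv ℂ b f) := by
  classical
  rw [vf, csum_eq_sum (Finset.univ.map zeroIndex)]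
  · rw [Finset.sum_map]
    refine Finset.sum_congr rfl fun b _ => ?_
    change c (0, b) * MvPowerSeries.pderiv ℂ (0, b) (pull f) = _
    rw [pderiv_pull, if_pos rfl]
  · rintro ⟨ℓ, b⟩ h
    rw [pderiv_pull, if_neg, mul_zero]
    rintro rfl
    exact h (Finset.mem_map.mpr ⟨b, Finset.mem_univ b, rfl⟩)

/-! ### The vector fields `∂`, `𝒬`, `σ_{k,a}` -/

variable [Fintype A] [DecidableEq A] (F : FrobeniusGerm A)

namespace FrobeniusGerm

theorem total_eq : F.total = vf fun p : ℕ × A => F.jetCoord (p.1 + 1) p.2 := rfl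

theorem dilaton_eq : F.dilaton = vf fun p : ℕ × A => (p.1 : ℂ) • F.jetCoord p.1 p.2 := by
  funext f
  simp only [dilaton, vf, smul_mul_assoc, jetPartial]

theorem sigma_eq (k : ℕ) (a : A) : F.sigma k a = vf fun p : ℕ × A => F.faa p.1 k a p.2 := rfl

theorem finite_fst_le (N : ℕ) : {p : ℕ × A | p.1 ≤ N}.Finite :=
  ((Set.finite_Iic N).prod (Set.finite_univ (α := A))).subset fun _ hp => ⟨hp, Set.mem_univ _⟩

theorem finite_sub_le (N k : ℕ) : {p : ℕ × A | p.1 - k ≤ N}.Finite :=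
  (finite_fst_le (N + k)).subset fun p hp => by
    simp only [Set.mem_ofPred_eq] at hp ⊢; omega

theorem cfin_jetCoord : CFin fun p : ℕ × A => F.jetCoord p.1 p.2 := by
  refine CFin.add (f := fun p : ℕ × A => X p) ?_ ?_
  · exact Wt.cfin (fun p => p.1) wt_X finite_fst_le
  · refine CFin.of_support_subset {((1 : ℕ), F.e)} fun p hp => if_neg ?_
    rintro ⟨h1, h2⟩
    exact hp (by simp [Prod.ext_iff, h1, h2])

theorem cfin_total : CFin fun p : ℕ × A => F.jetCoord (p.1 + 1) p.2 :=
  F.cfin_jetCoord.comp_injective (e := fun p : ℕ × A => (p.1 + 1, p.2)) fun p q h => by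
    simpa [Prod.ext_iff] using h

theorem cfin_dilaton : CFin fun p : ℕ × A => (p.1 : ℂ) • F.jetCoord p.1 p.2 :=
  F.cfin_jetCoord.smul _

theorem vf_jetCoord {c : ℕ × A → Jet A} (hc : CFin c) (ℓ : ℕ) (a : A) :
    vf c (F.jetCoord ℓ a) = c (ℓ, a) := by
  rw [jetCoord, vf_add hc, vf_X]
  split_ifs <;> simp [vf_one, vf_zero]

theorem total_pull (f : Base A) :
    F.total (pull f) = ∑ b, F.jetCoord 1 b * pull (MvPowerSeries.pderiv ℂ b f) :=
  vf_pull _ f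

theorem dilaton_pull (f : Base A) : F.dilaton (pull f) = 0 := by
  rw [dilaton_eq, vf_pull]; simp

theorem pderiv_e_jetCoord (ℓ : ℕ) (b : A) :
    MvPowerSeries.pderiv ℂ (0, F.e) (F.jetCoord (ℓ + 1) b) = 0 := by
  rw [jetCoord, map_add, pderiv_X_of_ne (by simp)]
  split_ifs <;> simp

/-- Functions independent of the coordinate `u^e`, all of whose monomials have weight at
least `d`. -/
def Lev (d : ℕ) (f : Jet A) : Prop := MvPowerSeries.pderiv ℂ (0, F.e) f = 0 ∧ Wt d f

variable {F}

theorem Lev.mul {d d' : ℕ} {f g : Jet A} (hf : F.Lev d f) (hg : F.Lev d' g) :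
    F.Lev (d + d') (f * g) :=
  ⟨by rw [Derivation.leibniz, hf.1, hg.1]; simp, hf.2.mul hg.2⟩

theorem Lev.add {d : ℕ} {f g : Jet A} (hf : F.Lev d f) (hg : F.Lev d g) : F.Lev d (f + g) :=
  ⟨by rw [map_add, hf.1, hg.1, add_zero], hf.2.add hg.2⟩

theorem Lev.neg {d : ℕ} {f : Jet A} (hf : F.Lev d f) : F.Lev d (-f) :=
  ⟨by rw [map_neg, hf.1, neg_zero], hf.2.neg⟩

theorem Lev.sum {ι : Type*} {d : ℕ} {s : Finset ι} {f : ι → Jet A} (hf : ∀ i ∈ s, F.Lev d (f i)) :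
    F.Lev d (∑ i ∈ s, f i) :=
  ⟨by rw [map_sum]; exact Finset.sum_eq_zero fun i hi => (hf i hi).1, Wt.sum fun i hi => (hf i hi).2⟩

theorem Lev.zero (d : ℕ) : F.Lev d 0 := ⟨map_zero _, Wt.zero_right d⟩

theorem Lev.mono {d d' : ℕ} {f : Jet A} (h : F.Lev d f) (hd : d' ≤ d) : F.Lev d' f :=
  ⟨h.1, h.2.mono hd⟩

/-- Replacing u_ℓ by u_{ℓ+1} raises the weight by one. The dilaton shift adds to ∂ the single term
∂/∂u^e_0, which does not raise the weight; this is why independence of u^e is part of the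
definition. -/
theorem Lev.total {d : ℕ} {f : Jet A} (hf : F.Lev d f) : F.Lev (d + 1) (F.total f) := by
  constructor
  · rw [FrobeniusGerm.total, pderiv_csum, ← csum_zero (ι := ℕ × A)]
    refine congrArg JetVirasoro.csum (funext fun p => ?_)
    rw [Derivation.leibniz, pderiv_e_jetCoord, jetPartial, pderiv_pderiv_comm, hf.1]
    simp
  · refine Wt.csum fun p => ?_
    rw [jetCoord, add_mul]
    refine Wt.add ?_ ?_
    · exact ((wt_X (p.1 + 1, p.2)).mul (hf.2.pderiv p)).mono (by simp only; omega)
    · split_ifs with h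
      · have : jetPartial p.1 p.2 f = 0 := by
          rw [jetPartial, h.2, show p.1 = 0 by omega, hf.1]
        rw [this, mul_zero]
        exact Wt.zero_right _
      · rw [zero_mul]
        exact Wt.zero_right _

variable (F)

theorem lev_jetCoord (ℓ : ℕ) (b : A) : F.Lev 0 (F.jetCoord (ℓ + 1) b) :=
  ⟨F.pderiv_e_jetCoord ℓ b, Wt.zero_left _⟩

/-- By flatness this is the derivative of 𝒜_e, which is the identity matrix. -/
theorem pderiv_e_mul (a b c : A) : MvPowerSeries.pderiv ℂ F.e (F.mul a b c) = 0 := by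
  rw [F.mul_flat, F.one_mul]
  rcases eq_or_ne b c with rfl | h
  · simp
  · simp [Matrix.one_apply_ne h]

theorem lev_mul (a b c : A) : F.Lev 0 (pullMat (F.mul a) b c) :=
  ⟨by rw [pullMat, Matrix.map_apply, pderiv_pull, if_pos rfl, pderiv_e_mul, map_zero],
    Wt.zero_left _⟩

theorem 𝒳_apply (a c : A) : F.𝒳 a c = ∑ b, F.jetCoord 1 b * pullMat (F.mul b) a c := by
  simp [𝒳, Matrix.sum_apply]

theorem lev_𝒳 (a c : A) : F.Lev 0 (F.𝒳 a c) := by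
  rw [𝒳_apply]
  exact Lev.sum fun b _ => (F.lev_jetCoord 0 b).mul (F.lev_mul b a c)

/-- Of the ℓ factors ∂ + z𝒳, exactly k contribute z𝒳, which costs no weight, and the others
contribute ∂, which raises the level by one. Hence σ_{k,a} is a coefficientwise finite vector field.
-/
theorem lev_faa (ℓ k : ℕ) (a c : A) : F.Lev (ℓ - k) (F.faa ℓ k a c) := by
  induction ℓ generalizing k a c with
  | zero =>
    cases k with
    | zero => exact F.lev_𝒳 a c
    | succ k => rw [faa]; exact Lev.zero _
  | succ n ih =>
    cases k with
    | zero => exact (ih 0 a c).total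
    | succ j =>
      rw [faa, Matrix.add_apply, Matrix.map_apply, Matrix.mul_apply]
      refine Lev.add ?_ (Lev.sum fun b _ => ?_)
      · exact (ih (j + 1) a c).total.mono (by omega)
      · exact ((F.lev_𝒳 a b).mul (ih j b c)).mono (by omega)

theorem cfin_sigma (k : ℕ) (a : A) : CFin fun p : ℕ × A => F.faa p.1 k a p.2 :=
  Wt.cfin (fun p => p.1 - k) (fun p => (F.lev_faa p.1 k a p.2).2) fun N => finite_sub_le N k

theorem faa_of_lt {ℓ k : ℕ} (h : ℓ < k) : F.faa ℓ k = 0 := by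
  induction ℓ generalizing k with
  | zero => obtain ⟨k, rfl⟩ := Nat.exists_eq_succ_of_ne_zero h.ne'; rfl
  | succ n ih =>
    obtain ⟨k, rfl⟩ := Nat.exists_eq_succ_of_ne_zero (Nat.ne_zero_of_lt h)
    rw [Nat.succ_eq_add_one, faa, ih (by omega), ih (by omega), mul_zero, add_zero]
    exact Matrix.ext fun i j => vf_zero _

/-- Together with `faa_of_lt`, this says that σ is triangular with respect to the ∂_ℓ, with diagonal
blocks 𝒳^{k+1} that turn out to be invertible. -/
theorem faa_self (ℓ : ℕ) : F.faa ℓ ℓ = F.𝒳 ^ (ℓ + 1) := by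
  induction ℓ with
  | zero => rw [faa, zero_add, pow_one]
  | succ n ih =>
    rw [faa, F.faa_of_lt (Nat.lt_succ_self n), ih, pow_succ' F.𝒳 (n + 1)]
    convert zero_add _
    exact Matrix.ext fun i j => vf_zero _

end FrobeniusGerm

end

section

open MvPowerSeries

variable {A : Type*} [Fintype A] [DecidableEq A] (F : FrobeniusGerm A)

theorem pullMat_mul (S T : Matrix A A (Base A)) : pullMat (S * T) = pullMat S * pullMat T := by
  simp [pullMat, Matrix.map_mul]

theorem pullMat_one : pullMat (1 : Matrix A A (Base A)) = 1 := by
  simp [pullMat]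

namespace FrobeniusGerm

/-! ### The algebra of the multiplication on the tangent bundle -/

theorem mul_mul_comm (a b : A) : F.mul a * F.mul b = F.mul b * F.mul a := by
  refine Matrix.ext fun c f => ?_
  simp only [Matrix.mul_apply]
  calc ∑ d, F.mul a c d * F.mul b d f = ∑ d, F.mul a c d * F.mul d b f := by
        simp only [F.mul_comm b]
    _ = ∑ d, F.mul c b d * F.mul a d f := F.mul_assoc a c b f
    _ = ∑ d, F.mul b c d * F.mul a d f := by simp only [F.mul_comm b]

theorem pullMat_mul_comm (a b : A) :
    pullMat (F.mul a) * pullMat (F.mul b) = pullMat (F.mul b) * pullMat (F.mul a) := by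
  rw [← pullMat_mul, F.mul_mul_comm, pullMat_mul]

theorem commute_𝒳 (a : A) : Commute F.𝒳 (pullMat (F.mul a)) := by
  rw [𝒳]
  exact Commute.sum_left _ _ _ fun b _ => Commute.smul_left (F.pullMat_mul_comm b a) _

theorem 𝒲_apply (c d f : A) : F.𝒲 c d f = ∑ b, F.𝒳 c b * pullMat (F.mul b) d f := by
  simp [𝒲, Matrix.sum_apply]

theorem commute_𝒳_𝒲 (c : A) : Commute F.𝒳 (F.𝒲 c) := by
  rw [𝒲]
  exact Commute.sum_right _ _ _ fun b _ => Commute.smul_right (F.commute_𝒳 b) _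

theorem 𝒲_e (c h : A) : F.𝒲 c F.e h = F.𝒳 c h := by
  rw [𝒲_apply, Finset.sum_eq_single h]
  · simp [pullMat, F.mul_comm h, F.one_mul]
  · intro b _ hb
    simp [pullMat, F.mul_comm b, F.one_mul, Matrix.one_apply_ne hb]
  · simp

/-- At the jet p + te the only nonzero u_1 coordinate is u^e_1 = 1, so there 𝒳 = 𝒜_e = 1. -/
theorem isUnit_𝒳 : IsUnit F.𝒳.det := by
  rw [MvPowerSeries.isUnit_iff_constantCoeff, RingHom.map_det]
  have : (MvPowerSeries.constantCoeff (σ := ℕ × A) (R := ℂ)).mapMatrix F.𝒳 = 1 := by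
    ext a c
    rw [RingHom.mapMatrix_apply, Matrix.map_apply, 𝒳_apply, map_sum, Finset.sum_eq_single F.e]
    · rw [map_mul]
      simp [jetCoord, F.one_mul, pullMat_one, Matrix.one_apply, apply_ite]
    · intro b _ hb
      simp [jetCoord, hb]
    · simp
  simp [this]

theorem 𝒳_mul_inv : F.𝒳 * F.𝒳⁻¹ = 1 := Matrix.mul_nonsing_inv _ F.isUnit_𝒳

theorem inv_mul_𝒳 : F.𝒳⁻¹ * F.𝒳 = 1 := Matrix.nonsing_inv_mul _ F.isUnit_𝒳

theorem commute_𝒳_inv_𝒲 (c : A) : Commute F.𝒳⁻¹ (F.𝒲 c) := by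
  have h := (F.commute_𝒳_𝒲 c).eq
  change F.𝒳⁻¹ * F.𝒲 c = F.𝒲 c * F.𝒳⁻¹
  calc F.𝒳⁻¹ * F.𝒲 c = F.𝒳⁻¹ * (F.𝒲 c * F.𝒳) * F.𝒳⁻¹ := by
        rw [_root_.mul_assoc, _root_.mul_assoc, 𝒳_mul_inv, _root_.mul_one]
    _ = _ := by rw [← h, ← _root_.mul_assoc, inv_mul_𝒳, _root_.one_mul]

theorem inv_𝒲_e (c h : A) : (F.𝒳⁻¹ * F.𝒲 c) F.e h = (1 : Matrix A A (Jet A)) c h := by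
  rw [(F.commute_𝒳_inv_𝒲 c).eq, ← F.𝒳_mul_inv, Matrix.mul_apply, Matrix.mul_apply]
  simp only [𝒲_e]

theorem map_pderiv_e_one : (1 : Matrix A A (Jet A)).map (MvPowerSeries.pderiv ℂ (0, F.e)) = 0 := by
  refine Matrix.ext fun i j => ?_
  rcases eq_or_ne i j with rfl | h
  · simp
  · simp [Matrix.one_apply_ne h]

/-- Differentiate 𝒳𝒳⁻¹ = 1 along ∂/∂u^e, which kills 𝒳. -/
theorem lev_inv (a c : A) : F.Lev 0 (F.𝒳⁻¹ a c) := by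
  refine ⟨?_, Wt.zero_left _⟩
  have h : F.𝒳.map (MvPowerSeries.pderiv ℂ (0, F.e)) = 0 :=
    Matrix.ext fun i j => (F.lev_𝒳 i j).1
  have h1 : (F.𝒳 * F.𝒳⁻¹).map (MvPowerSeries.pderiv ℂ (0, F.e)) =
      F.𝒳 * F.𝒳⁻¹.map (MvPowerSeries.pderiv ℂ (0, F.e)) := by
    refine Matrix.ext fun i j => ?_
    simp only [Matrix.map_apply, Matrix.mul_apply, map_sum, Derivation.leibniz, smul_eq_mul,
      (F.lev_𝒳 _ _).1, mul_zero, add_zero]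
  rw [𝒳_mul_inv, map_pderiv_e_one] at h1
  have h2 : F.𝒳⁻¹.map (MvPowerSeries.pderiv ℂ (0, F.e)) = 0 := by
    rw [← _root_.one_mul (F.𝒳⁻¹.map _), ← inv_mul_𝒳, _root_.mul_assoc, ← h1, mul_zero]
  exact congrFun (congrFun h2 a) c

/-! ### The action of the vector fields on basic functions -/

theorem sigma_pull (k : ℕ) (a : A) (f : Base A) :
    F.sigma k a (pull f) =
      if k = 0 then ∑ b, F.𝒳 a b * pull (MvPowerSeries.pderiv ℂ b f) else 0 := by
  rw [sigma_eq, vf_pull]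
  split_ifs with h
  · subst h; rfl
  · exact Finset.sum_eq_zero fun b _ => by rw [F.faa_of_lt (Nat.pos_of_ne_zero h)]; simp

theorem faa_one_zero : F.faa 1 0 = F.𝒳.map F.total := rfl

theorem faa_one_one : F.faa 1 1 = F.𝒳 * F.𝒳 := by rw [faa_self, pow_two]

/-- In 𝒳 = u_1^b 𝒜_b the coordinates u_1 vary by 𝒫_2 = ∂𝒳 + z𝒳². Flatness exchanges the two
directions in the derivative of 𝒜_b, so the z-independent terms assemble into ∂𝒲_a. -/
theorem sigma_𝒳 (k : ℕ) (a : A) : F.𝒳.map (F.sigma k a) =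
    (if k = 0 then (F.𝒲 a).map F.total else 0) +
      if k = 1 then ∑ c, F.𝒳 a c • F.𝒲 c else 0 := by
  have hs : ∀ d f, F.sigma k a (F.𝒳 d f) =
      ∑ b, (F.faa 1 k a b * pullMat (F.mul b) d f +
        F.jetCoord 1 b * if k = 0 then ∑ c, F.𝒳 a c *
          pull (MvPowerSeries.pderiv ℂ c (F.mul b d f)) else 0) := by
    intro d f
    rw [𝒳_apply, sigma_eq, vf_sum (F.cfin_sigma k a)]
    refine Finset.sum_congr rfl fun b _ => ?_
    rw [vf_mul (F.cfin_sigma k a), vf_jetCoord F (F.cfin_sigma k a)]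
    congr 2
    exact F.sigma_pull k a _
  refine Matrix.ext fun d f => ?_
  rw [Matrix.map_apply, hs]
  match k with
  | 0 =>
    simp only [if_true, Matrix.add_apply, Matrix.map_apply, 𝒲_apply, faa_one_zero]
    rw [if_neg (by norm_num), Matrix.zero_apply, add_zero, total_eq, vf_sum F.cfin_total]
    simp only [vf_mul F.cfin_total, Finset.sum_add_distrib]
    congr 1
    simp only [Finset.mul_sum]
    rw [Finset.sum_comm]
    refine Finset.sum_congr rfl fun b _ => ?_
    rw [pullMat, Matrix.map_apply, ← total_eq, total_pull, Finset.mul_sum]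
    refine Finset.sum_congr rfl fun c _ => ?_
    rw [F.mul_flat b c]
    ring
  | 1 =>
    simp only [Matrix.add_apply, if_neg one_ne_zero, if_true, Matrix.zero_apply, zero_add,
      mul_zero, add_zero, Matrix.sum_apply, Matrix.smul_apply, smul_eq_mul, 𝒲_apply, faa_one_one,
      Matrix.mul_apply, Finset.mul_sum, Finset.sum_mul]
    rw [Finset.sum_comm]
    exact Finset.sum_congr rfl fun b _ => Finset.sum_congr rfl fun c _ => by ring
  | k + 2 =>
    rw [F.faa_of_lt (by omega : 1 < k + 2)]
    simp

/-- In coordinates the recursion 𝒫_{ℓ+2} = (∂ + z𝒳)𝒫_{ℓ+1} says precisely that σ(z)∂ = (∂ + z𝒳)σ(z).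
-/
theorem sigma_total (k : ℕ) (a : A) (f : Jet A) :
    F.sigma k a (F.total f) = F.total (F.sigma k a f) +
      if k = 0 then 0 else ∑ b, F.𝒳 a b * F.sigma (k - 1) b f := by
  rw [← sub_eq_iff_eq_add', sigma_eq, total_eq, vf_vf_sub (F.cfin_sigma k a) F.cfin_total]
  simp only [vf_jetCoord F (F.cfin_sigma k a)]
  rcases k with _ | k
  · rw [if_pos rfl, ← csum_zero (ι := ℕ × A)]
    refine congrArg csum (funext fun p => ?_)
    rw [← total_eq, faa, Matrix.map_apply, sub_self, zero_mul]
  · rw [if_neg (Nat.succ_ne_zero k)]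
    simp only [Nat.add_sub_cancel, sigma_eq, vf]
    simp only [← csum_mul_left ((F.cfin_sigma k _).mul_right _)]
    rw [← csum_sum fun b _ => ((F.cfin_sigma k b).mul_right _).mul_left _]
    refine congrArg csum (funext fun p => ?_)
    change (F.faa (p.1 + 1) (k + 1) a p.2 - F.total (F.faa p.1 (k + 1) a p.2)) * _ = _
    rw [faa, Matrix.add_apply, Matrix.map_apply, add_sub_cancel_left, Matrix.mul_apply,
      Finset.sum_mul]
    exact Finset.sum_congr rfl fun b _ => by ring

theorem dilaton_total (f : Jet A) : F.dilaton (F.total f) = F.total (F.dilaton f) + F.total f := by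
  rw [← sub_eq_iff_eq_add', dilaton_eq, total_eq, vf_vf_sub F.cfin_dilaton F.cfin_total, vf]
  refine congrArg csum (funext fun p => ?_)
  rw [vf_jetCoord F F.cfin_dilaton, vf_smul, vf_jetCoord F F.cfin_total]
  push_cast
  rw [add_smul, one_smul, add_sub_cancel_left]

theorem dilaton_𝒳 : F.𝒳.map F.dilaton = F.𝒳 := by
  refine Matrix.ext fun d f => ?_
  rw [Matrix.map_apply, 𝒳_apply, dilaton_eq, vf_sum F.cfin_dilaton]
  refine Finset.sum_congr rfl fun b _ => ?_
  rw [vf_mul F.cfin_dilaton, vf_jetCoord F F.cfin_dilaton, pullMat, Matrix.map_apply,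
    ← dilaton_eq, dilaton_pull]
  simp

/-! ### The intrinsic sections `s_j` -/

/-- `𝐬_j`: zero for `j ≤ 0`, and `intrinsicSucc n` for `j = n + 1`. -/
def sInt : ℤ → A → Jet A
  | .ofNat 0 => 0
  | .ofNat (n + 1) => intrinsicSucc F n
  | .negSucc _ => 0

theorem sInt_of_nonpos {j : ℤ} (hj : j ≤ 0) : F.sInt j = 0 := by
  match j, hj with
  | .ofNat 0, _ => rfl
  | .negSucc _, _ => rfl

theorem lev_intrinsicSucc (n : ℕ) (a : A) : F.Lev n (intrinsicSucc F n a) := by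
  induction n generalizing a with
  | zero => exact (F.lev_inv F.e a).neg
  | succ n ih =>
    rw [intrinsicSucc, Matrix.vecMul, dotProduct]
    exact Lev.sum fun b _ => (ih b).total.mul (F.lev_inv b a)

theorem wt_sInt (j : ℤ) (a : A) : Wt (j - 1).toNat (F.sInt j a) := by
  match j with
  | .ofNat 0 => exact Wt.zero_right _
  | .negSucc _ => exact Wt.zero_right _
  | .ofNat (n + 1) =>
    have : (Int.ofNat (n + 1) - 1).toNat = n := by simp
    rw [this]
    exact (F.lev_intrinsicSucc n a).2

theorem intrinsicSucc_zero_vecMul_𝒳 : intrinsicSucc F 0 ᵥ* F.𝒳 = -(1 : Matrix A A (Jet A)) F.e := by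
  rw [← F.inv_mul_𝒳, intrinsicSucc, Matrix.neg_vecMul]
  rfl

theorem intrinsicSucc_succ_vecMul_𝒳 (n : ℕ) :
    intrinsicSucc F (n + 1) ᵥ* F.𝒳 = fun a => F.total (intrinsicSucc F n a) := by
  rw [intrinsicSucc, Matrix.vecMul_vecMul, F.inv_mul_𝒳, Matrix.vecMul_one]

theorem intrinsicSucc_zero_vecMul_𝒲 (c : A) :
    intrinsicSucc F 0 ᵥ* F.𝒲 c = -(1 : Matrix A A (Jet A)) c := by
  rw [intrinsicSucc, Matrix.neg_vecMul]
  congr 1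
  funext h
  exact F.inv_𝒲_e c h

end FrobeniusGerm

end

section

open MvPowerSeries

variable {A : Type*} [Fintype A] [DecidableEq A] (F : FrobeniusGerm A)

/-! ### Fundamental solutions on the base -/

/-- The coefficientwise action of `∂/∂u^a` on power series of endomorphisms. -/
def psDeriv (a : A) (P : PowerSeries (Matrix A A (Base A))) : PowerSeries (Matrix A A (Base A)) :=
  PowerSeries.mk fun n => (PowerSeries.coeff n P).map (MvPowerSeries.pderiv ℂ a)

theorem coeff_psDeriv (a : A) (P : PowerSeries (Matrix A A (Base A))) (n : ℕ) :
    PowerSeries.coeff n (psDeriv a P) = (PowerSeries.coeff n P).map (MvPowerSeries.pderiv ℂ a) :=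
  PowerSeries.coeff_mk _ _

theorem map_add_pderiv (a : A) (S T : Matrix A A (Base A)) :
    (S + T).map (MvPowerSeries.pderiv ℂ a) =
      S.map (MvPowerSeries.pderiv ℂ a) + T.map (MvPowerSeries.pderiv ℂ a) :=
  Matrix.ext fun i j => map_add (MvPowerSeries.pderiv ℂ a) (S i j) (T i j)

theorem map_sum_pderiv {ι : Type*} (s : Finset ι) (a : A) (S : ι → Matrix A A (Base A)) :
    (∑ i ∈ s, S i).map (MvPowerSeries.pderiv ℂ a) =
      ∑ i ∈ s, (S i).map (MvPowerSeries.pderiv ℂ a) :=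
  Matrix.ext fun _ _ => by simp [Matrix.sum_apply]

theorem map_mul_pderiv (a : A) (S T : Matrix A A (Base A)) :
    (S * T).map (MvPowerSeries.pderiv ℂ a) =
      S.map (MvPowerSeries.pderiv ℂ a) * T + S * T.map (MvPowerSeries.pderiv ℂ a) :=
  Matrix.ext fun i j => by
    simp only [Matrix.map_apply, Matrix.mul_apply, Matrix.add_apply, map_sum, Derivation.leibniz,
      smul_eq_mul, Finset.sum_add_distrib]
    rw [add_comm]
    congr 1
    exact Finset.sum_congr rfl fun k _ => mul_comm _ _

theorem psDeriv_add (a : A) (P Q : PowerSeries (Matrix A A (Base A))) :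
    psDeriv a (P + Q) = psDeriv a P + psDeriv a Q := by
  ext n : 1
  simp only [coeff_psDeriv, map_add, map_add_pderiv]

theorem psDeriv_mul (a : A) (P Q : PowerSeries (Matrix A A (Base A))) :
    psDeriv a (P * Q) = psDeriv a P * Q + P * psDeriv a Q := by
  ext n : 1
  simp only [coeff_psDeriv, map_add, PowerSeries.coeff_mul, map_sum_pderiv, map_mul_pderiv,
    Finset.sum_add_distrib]

theorem map_one_pderiv (a : A) :
    (1 : Matrix A A (Base A)).map (MvPowerSeries.pderiv ℂ a) = 0 := by
  refine Matrix.ext fun i j => ?_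
  rcases eq_or_ne i j with rfl | h
  · simp
  · simp [Matrix.one_apply_ne h]

theorem psDeriv_one (a : A) : psDeriv a (1 : PowerSeries (Matrix A A (Base A))) = 0 := by
  ext n : 1
  rw [coeff_psDeriv, PowerSeries.coeff_one, map_zero]
  split_ifs
  · exact map_one_pderiv a
  · exact Matrix.ext fun _ _ => map_zero (MvPowerSeries.pderiv ℂ a)

variable {F} {θ : ℕ → Matrix A A (Base A)}

/-- `Θ(z)⁻¹` as a power series. -/
def thetaInvSeries (θ : ℕ → Matrix A A (Base A)) : PowerSeries (Matrix A A (Base A)) :=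
  PowerSeries.invOfUnit (PowerSeries.mk θ) 1

theorem mk_mul_thetaInvSeries (h : IsFundamental F θ) :
    PowerSeries.mk θ * thetaInvSeries θ = 1 :=
  PowerSeries.mul_invOfUnit _ _ (by simp [h.1])

theorem thetaInvSeries_mul_mk (h : IsFundamental F θ) :
    thetaInvSeries θ * PowerSeries.mk θ = 1 :=
  PowerSeries.invOfUnit_mul _ _ (by simp [h.1])

theorem psDeriv_theta (h : IsFundamental F θ) (a : A) :
    psDeriv a (PowerSeries.mk θ) =
      PowerSeries.X * (PowerSeries.mk θ * PowerSeries.C (F.mul a)) := by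
  ext n : 1
  rw [coeff_psDeriv, PowerSeries.coeff_mk]
  rcases n with _ | n
  · rw [h.1, map_one_pderiv, PowerSeries.coeff_zero_X_mul]
  · rw [PowerSeries.coeff_succ_X_mul, PowerSeries.coeff_mul_C, PowerSeries.coeff_mk]
    exact h.2 n a

/-- Differentiate ΘΘ⁻¹ = 1 and multiply by Θ⁻¹ on the left. -/
theorem psDeriv_thetaInvSeries (h : IsFundamental F θ) (a : A) :
    psDeriv a (thetaInvSeries θ) =
      -(PowerSeries.X * (PowerSeries.C (F.mul a) * thetaInvSeries θ)) := by
  have h1 := congrArg (psDeriv a) (mk_mul_thetaInvSeries h)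
  rw [psDeriv_mul, psDeriv_one, psDeriv_theta h] at h1
  have h2 := congrArg (fun P => thetaInvSeries θ * P) h1
  simp only [mul_add, mul_zero, ← mul_assoc] at h2
  rw [thetaInvSeries_mul_mk h, one_mul] at h2
  rw [eq_neg_of_add_eq_zero_right h2, ← PowerSeries.X_mul, mul_assoc _ (thetaInvSeries θ),
    mul_assoc, thetaInvSeries_mul_mk h, mul_one]

theorem thetaInv_eq (n : ℕ) : thetaInv θ n = PowerSeries.coeff n (thetaInvSeries θ) := rfl

theorem thetaInv_zero (h : IsFundamental F θ) : thetaInv θ 0 = 1 := by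
  have := congrArg (PowerSeries.coeff 0) (mk_mul_thetaInvSeries h)
  simpa [h.1, PowerSeries.coeff_mul, thetaInv_eq] using this

theorem sum_theta_mul_thetaInv (h : IsFundamental F θ) (n : ℕ) :
    ∑ p ∈ Finset.HasAntidiagonal.antidiagonal n, θ p.1 * thetaInv θ p.2 =
      if n = 0 then 1 else 0 := by
  have := congrArg (PowerSeries.coeff n) (mk_mul_thetaInvSeries h)
  simpa [PowerSeries.coeff_mul, PowerSeries.coeff_one, thetaInv_eq] using this

theorem sum_thetaInv_mul_theta (h : IsFundamental F θ) (n : ℕ) :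
    ∑ p ∈ Finset.HasAntidiagonal.antidiagonal n, thetaInv θ p.1 * θ p.2 =
      if n = 0 then 1 else 0 := by
  have := congrArg (PowerSeries.coeff n) (thetaInvSeries_mul_mk h)
  simpa [PowerSeries.coeff_mul, PowerSeries.coeff_one, thetaInv_eq] using this

theorem map_pderiv_thetaInv_succ (h : IsFundamental F θ) (n : ℕ) (a : A) :
    (thetaInv θ (n + 1)).map (MvPowerSeries.pderiv ℂ a) = -(F.mul a * thetaInv θ n) := by
  have := congrArg (PowerSeries.coeff (n + 1)) (psDeriv_thetaInvSeries h a)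
  rw [coeff_psDeriv] at this
  rw [thetaInv_eq, this, map_neg, PowerSeries.coeff_succ_X_mul, PowerSeries.coeff_C_mul, thetaInv_eq]

/-! ### The vector fields `σ_{k,a}` on `Θ(z)` and its inverse -/

theorem pullMat_sum {ι : Type*} (s : Finset ι) (S : ι → Matrix A A (Base A)) :
    pullMat (∑ i ∈ s, S i) = ∑ i ∈ s, pullMat (S i) :=
  Matrix.ext fun _ _ => by simp [pullMat, Matrix.sum_apply]

theorem pullMat_zero : pullMat (0 : Matrix A A (Base A)) = 0 :=
  Matrix.ext fun _ _ => map_zero pull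

theorem pullMat_neg (S : Matrix A A (Base A)) : pullMat (-S) = -pullMat S :=
  Matrix.ext fun i j => map_neg pull (S i j)

theorem sum_pull_theta_mul_thetaInv (h : IsFundamental F θ) (n : ℕ) :
    ∑ p ∈ Finset.HasAntidiagonal.antidiagonal n, pullMat (θ p.1) * pullMat (thetaInv θ p.2) =
      if n = 0 then 1 else 0 := by
  simp only [← pullMat_mul, ← pullMat_sum, sum_theta_mul_thetaInv h]
  split_ifs
  exacts [pullMat_one, pullMat_zero]

theorem sum_pull_thetaInv_mul_theta (h : IsFundamental F θ) (n : ℕ) :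
    ∑ p ∈ Finset.HasAntidiagonal.antidiagonal n, pullMat (thetaInv θ p.1) * pullMat (θ p.2) =
      if n = 0 then 1 else 0 := by
  simp only [← pullMat_mul, ← pullMat_sum, sum_thetaInv_mul_theta h]
  split_ifs
  exacts [pullMat_one, pullMat_zero]

theorem map_sigma_pullMat (k : ℕ) (a : A) (T : Matrix A A (Base A)) :
    (pullMat T).map (F.sigma k a) =
      if k = 0 then ∑ b, F.𝒳 a b • pullMat (T.map (MvPowerSeries.pderiv ℂ b)) else 0 := by
  refine Matrix.ext fun i j => ?_
  rw [pullMat, Matrix.map_apply, Matrix.map_apply, F.sigma_pull]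
  split_ifs
  · simp [Matrix.sum_apply, pullMat]
  · rfl

theorem map_sigma_thetaInv_zero (h : IsFundamental F θ) (k : ℕ) (a : A) :
    (pullMat (thetaInv θ 0)).map (F.sigma k a) = 0 := by
  rw [map_sigma_pullMat, thetaInv_zero h]
  simp [map_one_pderiv, pullMat_zero]

theorem map_sigma_thetaInv_succ (h : IsFundamental F θ) (k : ℕ) (a : A) (n : ℕ) :
    (pullMat (thetaInv θ (n + 1))).map (F.sigma k a) =
      if k = 0 then -(F.𝒲 a * pullMat (thetaInv θ n)) else 0 := by
  rw [map_sigma_pullMat]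
  simp only [map_pderiv_thetaInv_succ h, pullMat_neg, pullMat_mul, FrobeniusGerm.𝒲,
    Finset.sum_mul, Matrix.smul_mul, smul_neg, Finset.sum_neg_distrib]

/-! ### The vector fields `σ_{k,a}` on `𝐬(z)` -/

namespace FrobeniusGerm

variable (F)

theorem vecMul_apply' (v : A → Jet A) (T : Matrix A A (Jet A)) (b : A) :
    (v ᵥ* T) b = ∑ c, v c * T c b := rfl

theorem sigma_vecMul (k : ℕ) (a : A) (v : A → Jet A) (T : Matrix A A (Jet A)) :
    (fun b => F.sigma k a ((v ᵥ* T) b)) =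
      (fun b => F.sigma k a (v b)) ᵥ* T + v ᵥ* T.map (F.sigma k a) := by
  funext b
  simp only [vecMul_apply', Pi.add_apply, sigma_eq, vf_sum (F.cfin_sigma k a),
    vf_mul (F.cfin_sigma k a), Finset.sum_add_distrib, Matrix.map_apply]

theorem total_vecMul (v : A → Jet A) (T : Matrix A A (Jet A)) :
    (fun b => F.total ((v ᵥ* T) b)) = (fun b => F.total (v b)) ᵥ* T + v ᵥ* T.map F.total := by
  funext b
  simp only [vecMul_apply', Pi.add_apply, total_eq, vf_sum F.cfin_total,
    vf_mul F.cfin_total, Finset.sum_add_distrib, Matrix.map_apply]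

theorem vecMul_𝒳_injective {v w : A → Jet A} (h : v ᵥ* F.𝒳 = w ᵥ* F.𝒳) : v = w := by
  have := congrArg (fun x => x ᵥ* F.𝒳⁻¹) h
  simpa [Matrix.vecMul_vecMul, 𝒳_mul_inv] using this

theorem sigma_one_row (k : ℕ) (a c : A) :
    (fun b => F.sigma k a ((1 : Matrix A A (Jet A)) c b)) = 0 := by
  funext b
  rw [Matrix.one_apply, sigma_eq]
  split_ifs
  exacts [vf_one _, vf_zero _]

theorem total_one_row (c : A) :
    (fun b => F.total ((1 : Matrix A A (Jet A)) c b)) = 0 := by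
  funext b
  rw [Matrix.one_apply, total_eq]
  split_ifs
  exacts [vf_one _, vf_zero _]

/-- By induction through the recursion 𝐬_{n+2}𝒳 = ∂𝐬_{n+1}: after multiplying by the invertible 𝒳,
everything reduces to the action of σ on 𝒳 and its commutator with ∂. The commutator shifts the
index q by one and thereby propagates the delta term. -/
theorem sigma_intrinsicSucc (q n : ℕ) (c : A) :
    (fun b => F.sigma q c (intrinsicSucc F n b)) =
      (if q = 0 then intrinsicSucc F (n + 1) ᵥ* F.𝒲 c else 0) +
        if q = n + 1 then (1 : Matrix A A (Jet A)) c else 0 := by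
  induction n generalizing q c with
  | zero =>
    apply F.vecMul_𝒳_injective
    have h := F.sigma_vecMul q c (intrinsicSucc F 0) F.𝒳
    have h0 : (fun b => F.sigma q c ((intrinsicSucc F 0 ᵥ* F.𝒳) b)) = 0 := by
      rw [intrinsicSucc_zero_vecMul_𝒳]
      funext b
      rw [Pi.neg_apply, sigma_eq, vf_neg, ← sigma_eq]
      simpa using congrFun (F.sigma_one_row q c F.e) b
    rw [h0] at h
    -- Since 𝐬_1𝒳 is minus a constant row, (σ𝐬_1)𝒳 = -𝐬_1(σ𝒳). Likewise 𝐬_1𝒲_c is constant, so below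
    -- 𝐬_1 ∂𝒲_c = -(∂𝐬_1)𝒲_c.
    rw [eq_neg_of_add_eq_zero_left h.symm, sigma_𝒳]
    have h1 := F.total_vecMul (intrinsicSucc F 0) (F.𝒲 c)
    have h2 : (fun b => F.total ((intrinsicSucc F 0 ᵥ* F.𝒲 c) b)) = 0 := by
      rw [intrinsicSucc_zero_vecMul_𝒲]
      funext b
      rw [Pi.neg_apply, total_eq, vf_neg, ← total_eq]
      simpa using congrFun (F.total_one_row c) b
    rw [h2, ← F.intrinsicSucc_succ_vecMul_𝒳] at h1
    rw [Matrix.add_vecMul, Matrix.vecMul_add, neg_add]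
    congr 1
    · split_ifs
      · rw [← eq_neg_of_add_eq_zero_left h1.symm, Matrix.vecMul_vecMul, Matrix.vecMul_vecMul,
          (F.commute_𝒳_𝒲 c).eq]
      · simp
    · simp only [zero_add]
      split_ifs
      · rw [Matrix.vecMul_sum]
        simp only [Matrix.vecMul_smul, intrinsicSucc_zero_vecMul_𝒲]
        rw [← Finset.sum_neg_distrib]
        funext b
        simp [Matrix.vecMul, dotProduct, Matrix.one_apply]
      · simp
  | succ n ih =>
    apply F.vecMul_𝒳_injective
    have h := F.sigma_vecMul q c (intrinsicSucc F (n + 1)) F.𝒳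
    rw [eq_sub_of_add_eq h.symm, intrinsicSucc_succ_vecMul_𝒳]
    have h1 : (fun b => F.sigma q c (F.total (intrinsicSucc F n b))) =
        (fun b => F.total (F.sigma q c (intrinsicSucc F n b))) +
          if q = 0 then 0 else ∑ d, F.𝒳 c d • fun b => F.sigma (q - 1) d (intrinsicSucc F n b) := by
      funext b
      rw [sigma_total, Pi.add_apply]
      split_ifs <;> simp
    rw [h1, sigma_𝒳, Matrix.add_vecMul]
    have h2 : ∀ b, F.sigma q c (intrinsicSucc F n b) =
      ((if q = 0 then intrinsicSucc F (n + 1) ᵥ* F.𝒲 c else 0) +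
        if q = n + 1 then (1 : Matrix A A (Jet A)) c else 0) b := fun b => congrFun (ih q c) b
    simp only [h2]
    match q with
    | 0 =>
      simp only [if_true, Pi.add_apply]
      rw [if_neg (by omega), if_neg (by omega), if_neg (by omega)]
      simp only [Pi.zero_apply, add_zero, Matrix.zero_vecMul]
      rw [F.total_vecMul, ← intrinsicSucc_succ_vecMul_𝒳, add_sub_cancel_right,
        Matrix.vecMul_vecMul, Matrix.vecMul_vecMul, (F.commute_𝒳_𝒲 c).eq]
    | q + 1 =>
      have h3 : (fun b => F.total (((if q + 1 = 0 then intrinsicSucc F (n + 1) ᵥ* F.𝒲 c else 0) +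
          if q + 1 = n + 1 then (1 : Matrix A A (Jet A)) c else 0) b)) = 0 := by
        rw [if_neg (by omega), zero_add]
        split_ifs
        · exact F.total_one_row c
        · funext b; exact vf_zero _
      rw [h3]
      simp only [if_neg (Nat.succ_ne_zero q), Nat.add_sub_cancel, zero_add, Matrix.zero_vecMul, ih]
      simp only [smul_add, Finset.sum_add_distrib, add_left_inj]
      rcases q with _ | q
      · simp [Matrix.vecMul_sum, Matrix.vecMul_smul]
      · simp only [if_neg (Nat.succ_ne_zero q), smul_zero, Finset.sum_const_zero, zero_add,
          Nat.add_right_cancel_iff]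
        rw [if_neg (by omega), Matrix.vecMul_zero, sub_zero]
        split_ifs
        · funext b
          simp [Matrix.vecMul, dotProduct, Matrix.one_apply]
        · simp

/-- Extension by zero keeps the formula valid for every integer index: at i = 0 the two terms on the
right cancel because 𝐬_1𝒲_c is minus the c-th row of the identity. -/
theorem sigma_sInt (q : ℕ) (i : ℤ) (c : A) :
    (fun b => F.sigma q c (F.sInt i b)) =
      (if q = 0 then F.sInt (i + 1) ᵥ* F.𝒲 c else 0) +
        if (q : ℤ) = i then (1 : Matrix A A (Jet A)) c else 0 := by
  match i with
  | .ofNat (n + 1) =>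
    have h1 : F.sInt (Int.ofNat (n + 1)) = intrinsicSucc F n := rfl
    have h2 : F.sInt (Int.ofNat (n + 1) + 1) = intrinsicSucc F (n + 1) := rfl
    have h3 : ((q : ℤ) = Int.ofNat (n + 1)) = (q = n + 1) := by
      simp only [Int.ofNat_eq_natCast, Nat.cast_inj]
    rw [h1, h2, F.sigma_intrinsicSucc q n c]
    simp only [h3]
  | .ofNat 0 =>
    have h1 : F.sInt (Int.ofNat 0) = 0 := rfl
    have h2 : F.sInt (Int.ofNat 0 + 1) = intrinsicSucc F 0 := rfl
    rw [h1, h2, intrinsicSucc_zero_vecMul_𝒲]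
    have h3 : ((q : ℤ) = Int.ofNat 0) = (q = 0) := by simp
    simp only [h3]
    funext b
    split_ifs <;> simp [sigma_eq, vf_zero]
  | .negSucc m =>
    have h1 : F.sInt (Int.negSucc m) = 0 := rfl
    have h2 : F.sInt (Int.negSucc m + 1) = 0 := F.sInt_of_nonpos (by omega)
    rw [h1, h2, if_neg (by omega : ¬ (q : ℤ) = Int.negSucc m)]
    funext b
    simp [sigma_eq, vf_zero]

theorem dilaton_vecMul (v : A → Jet A) (T : Matrix A A (Jet A)) :
    (fun b => F.dilaton ((v ᵥ* T) b)) = (fun b => F.dilaton (v b)) ᵥ* T +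
      v ᵥ* T.map F.dilaton := by
  funext b
  simp only [vecMul_apply', Pi.add_apply, dilaton_eq, vf_sum F.cfin_dilaton,
    vf_mul F.cfin_dilaton, Finset.sum_add_distrib, Matrix.map_apply]

/-- Both 𝒳 and ∂ have degree one for 𝒬, so 𝒳⁻¹e has degree -1 and each further factor 𝒳⁻¹∂ has
degree zero. -/
theorem dilaton_intrinsicSucc (n : ℕ) (a : A) :
    F.dilaton (intrinsicSucc F n a) = - intrinsicSucc F n a := by
  refine congrFun (a := a) (f := fun b => F.dilaton (intrinsicSucc F n b))
    (g := - intrinsicSucc F n) ?_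
  apply F.vecMul_𝒳_injective
  induction n with
  | zero =>
    have h := F.dilaton_vecMul (intrinsicSucc F 0) F.𝒳
    have h0 : (fun b => F.dilaton ((intrinsicSucc F 0 ᵥ* F.𝒳) b)) = 0 := by
      rw [intrinsicSucc_zero_vecMul_𝒳]
      funext b
      rw [Pi.neg_apply, dilaton_eq, vf_neg, Matrix.one_apply]
      split_ifs <;> simp [vf_one, vf_zero]
    rw [h0, dilaton_𝒳] at h
    rw [eq_neg_of_add_eq_zero_left h.symm, Matrix.neg_vecMul]
  | succ n ih =>
    have h := F.dilaton_vecMul (intrinsicSucc F (n + 1)) F.𝒳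
    rw [dilaton_𝒳, intrinsicSucc_succ_vecMul_𝒳] at h
    have h1 : (fun b => F.dilaton (F.total (intrinsicSucc F n b))) = 0 := by
      have h2 := F.vecMul_𝒳_injective ih
      funext b
      rw [dilaton_total, show F.dilaton (intrinsicSucc F n b) = _ from congrFun h2 b, Pi.neg_apply,
        total_eq, vf_neg, neg_add_cancel]
      rfl
    rw [h1] at h
    rw [eq_neg_of_add_eq_zero_left h.symm, Matrix.neg_vecMul, intrinsicSucc_succ_vecMul_𝒳]

theorem dilaton_sInt (j : ℤ) (a : A) : F.dilaton (F.sInt j a) = - F.sInt j a := by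
  match j with
  | .ofNat 0 => simp [sInt, dilaton_eq, vf_zero]
  | .negSucc _ => simp [sInt, dilaton_eq, vf_zero]
  | .ofNat (n + 1) => exact F.dilaton_intrinsicSucc n a

end FrobeniusGerm

end

section

open MvPowerSeries

/-! ### Convolutions -/

section

variable {τ ι κ : Type*}

theorem csum_comp_injective {f : ι → MvPowerSeries τ ℂ} {e : κ → ι} (he : Function.Injective e)
    (h : ∀ i, i ∉ Set.range e → f i = 0) : csum (fun j => f (e j)) = csum f := by
  classical
  ext m
  simp only [coeff_csum]
  rw [← finsum_mem_range (f := fun i => coeff m (f i)) he, finsum_mem_def]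
  refine finsum_congr fun i => ?_
  rw [Set.indicator_apply]
  split_ifs with hi
  · rfl
  · rw [h i hi, map_zero]

theorem csum_antidiagonal {f : ℕ × ℕ → MvPowerSeries τ ℂ} (hf : CFin f) :
    csum f = csum fun n : ℕ => ∑ p ∈ Finset.HasAntidiagonal.antidiagonal n, f p := by
  classical
  ext m
  simp only [coeff_csum, map_sum]
  set s := (hf m).toFinset with hs
  have hmem : ∀ p, coeff m (f p) ≠ 0 → p ∈ s := fun p hp => by simpa [hs] using hp
  rw [finsum_eq_sum_of_support_subset (s := s) _ (by simp [hs]),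
    finsum_eq_sum_of_support_subset (s := s.image fun p => p.1 + p.2),
    ← Finset.sum_fiberwise_of_maps_to (t := s.image fun p => p.1 + p.2)
      fun p hp => Finset.mem_image_of_mem _ hp]
  · refine Finset.sum_congr rfl fun n _ => Finset.sum_subset ?_ ?_
    · intro p hp
      simpa [Finset.HasAntidiagonal.mem_antidiagonal] using (Finset.mem_filter.mp hp).2
    · intro p hp hp'
      by_contra h
      exact hp' (Finset.mem_filter.mpr ⟨hmem p h, by
        simpa [Finset.HasAntidiagonal.mem_antidiagonal] using hp⟩)
  · intro n hn
    obtain ⟨p, hp, h⟩ := Finset.exists_ne_zero_of_sum_ne_zero hn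
    exact Finset.mem_coe.mpr (Finset.mem_image.mpr ⟨p, hmem p h, by
      simpa [Finset.HasAntidiagonal.mem_antidiagonal] using hp⟩)

end

variable {A : Type*} [Fintype A] [DecidableEq A] (F : FrobeniusGerm A)

/-- The coefficients of `∑_k z^{-k-1} g_k` have monomials of weight at least `k - c`. -/
def Tame (c : ℤ) (g : ℤ → A → Jet A) : Prop := ∀ j b, Wt (j - c).toNat (g j b)

/-- The product of `∑_k z^{-k-1} g_k` with the power series `∑ z^n T_n`. -/
def conv (g : ℤ → A → Jet A) (T : ℕ → Matrix A A (Jet A)) (k : ℤ) (b : A) : Jet A :=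
  csum fun n : ℕ => (g (k + n) ᵥ* T n) b

theorem wt_vecMul {d : ℕ} {v : A → Jet A} (h : ∀ b, Wt d (v b)) (T : Matrix A A (Jet A)) (b : A) :
    Wt d ((v ᵥ* T) b) :=
  Wt.sum fun a _ => (h a).mul_right _

variable {F} {c : ℤ} {g : ℤ → A → Jet A}

theorem finite_toNat_le (e : ℤ) (N : ℕ) : {n : ℕ | (e + n).toNat ≤ N}.Finite :=
  (Set.finite_Iic (N + e.natAbs)).subset fun n hn => by
    simp only [Set.mem_ofPred_eq] at hn
    simp only [Set.mem_Iic]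
    omega

theorem finite_toNat_prod_le (e : ℤ) (N : ℕ) : {p : ℕ × ℕ | (e + p.1 + p.2).toNat ≤ N}.Finite :=
  ((Set.finite_Iic (N + e.natAbs)).prod (Set.finite_Iic (N + e.natAbs))).subset fun n hn => by
    simp only [Set.mem_ofPred_eq] at hn
    simp only [Set.mem_prod, Set.mem_Iic]
    omega

theorem Tame.cfin (hg : Tame c g) (T : ℕ → Matrix A A (Jet A)) (k : ℤ) (b : A) :
    CFin fun n : ℕ => (g (k + n) ᵥ* T n) b :=
  Wt.cfin (fun n => ((k - c) + n).toNat)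
    (fun n => wt_vecMul (fun b => (hg (k + n) b).mono (by omega)) _ _)
    (finite_toNat_le _)

theorem Tame.conv (hg : Tame c g) (T : ℕ → Matrix A A (Jet A)) : Tame c (conv g T) := fun k b =>
  Wt.csum fun n => wt_vecMul (fun b => (hg (k + n) b).mono (by omega)) _ _

theorem conv_vecMul (hg : Tame c g) (T : ℕ → Matrix A A (Jet A)) (S : Matrix A A (Jet A))
    (k : ℤ) (b : A) : (conv g T k ᵥ* S) b = csum fun m : ℕ => (g (k + m) ᵥ* (T m * S)) b := by
  rw [FrobeniusGerm.vecMul_apply']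
  refine (Finset.sum_congr rfl fun a _ => (csum_mul_right (hg.cfin T k a) _).symm).trans ?_
  rw [← csum_sum fun a _ => (hg.cfin T k a).mul_right _]
  refine congrArg csum (funext fun m => ?_)
  change (g (k + m) ᵥ* T m ᵥ* S) b = _
  rw [Matrix.vecMul_vecMul]

/-- Associativity of the right action of power series; tameness makes the double sum finite so that
it may be collected along antidiagonals. -/
theorem conv_conv (hg : Tame c g) (T S : ℕ → Matrix A A (Jet A)) (k : ℤ) (b : A) :
    conv (conv g T) S k b = conv g
      (fun n => ∑ p ∈ Finset.HasAntidiagonal.antidiagonal n, T p.1 * S p.2) k b := by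
  have hf : CFin fun p : ℕ × ℕ => (g (k + p.1 + p.2) ᵥ* (T p.2 * S p.1)) b :=
    Wt.cfin (fun p => ((k - c) + p.1 + p.2).toNat)
      (fun p => wt_vecMul (fun b => (hg _ b).mono (by omega)) _ _)
      (finite_toNat_prod_le _)
  rw [conv]
  simp only [conv_vecMul hg]
  rw [← csum_prod (f := fun p : ℕ × ℕ => (g (k + p.1 + p.2) ᵥ* (T p.2 * S p.1)) b) hf,
    csum_antidiagonal hf]
  refine congrArg csum (funext fun n => ?_)
  rw [Matrix.vecMul_sum, Finset.sum_apply, ← Finset.Nat.sum_antidiagonal_swap]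
  refine Finset.sum_congr rfl fun p hp => ?_
  rw [Finset.HasAntidiagonal.mem_antidiagonal] at hp
  simp only [Prod.fst_swap, Prod.snd_swap]
  rw [show k + (p.2 : ℤ) + p.1 = k + n by omega]

theorem conv_one (g : ℤ → A → Jet A) (k : ℤ) (b : A) :
    conv g (fun n => if n = 0 then 1 else 0) k b = g k b := by
  rw [conv, csum_eq_single 0]
  · simp
  · intro n hn
    simp [hn]

/-! ### The flat generating function -/

variable {θ : ℕ → Matrix A A (Base A)}

variable (F) in
theorem tame_sInt : Tame 1 F.sInt := F.wt_sInt

variable (F θ) in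
/-- The construction of `𝐭(z) = 𝐬(z) Θ(z)⁻¹` from the intrinsic sections. -/
def tSol : ℤ → A → Jet A := conv F.sInt fun n => pullMat (thetaInv θ n)

/-- In 𝐬(z)Θ(z)⁻¹, the term z𝐬(z)𝒲_c coming from σ_{0,c}𝐬 cancels the derivative -z𝒲_cΘ⁻¹ of Θ⁻¹.
Only the delta term of `sigma_sInt` survives. -/
theorem sigma_tSol (h : IsFundamental F θ) (q : ℕ) (c : A) (k : ℤ) (b : A) :
    F.sigma q c (tSol F θ k b) =
      if k ≤ q then pullMat (thetaInv θ ((q : ℤ) - k).toNat) c b else 0 := by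
  rw [tSol, conv, F.sigma_eq, vf_csum (F.cfin_sigma q c) ((tame_sInt F).cfin _ k b), ← F.sigma_eq]
  -- The cancellation takes the form of a telescoping sum: differentiating 𝐬 in the n-th term gives
  -- u (n + 1), differentiating Θ⁻¹ gives -u n. The guard n ≠ 0 makes u 0 = 0, so there is no
  -- boundary term.
  let u : ℕ → Jet A := fun n => if q = 0 ∧ n ≠ 0 then
    (F.sInt (k + n) ᵥ* (F.𝒲 c * pullMat (thetaInv θ (n - 1)))) b else 0
  let w : ℕ → Jet A := fun n => if (q : ℤ) = k + n then pullMat (thetaInv θ n) c b else 0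
  have hterm : ∀ n : ℕ, F.sigma q c ((F.sInt (k + n) ᵥ* pullMat (thetaInv θ n)) b) =
      (u (n + 1) - u n) + w n := by
    intro n
    have h1 := congrFun (F.sigma_vecMul q c (F.sInt (k + n)) (pullMat (thetaInv θ n))) b
    refine h1.trans ?_
    rw [F.sigma_sInt, Matrix.add_vecMul, Pi.add_apply, Pi.add_apply, add_right_comm]
    congr 1
    · rw [sub_eq_add_neg]
      congr 1
      · simp only [u]
        split_ifs with h2 h3 h3
        · rw [Matrix.vecMul_vecMul, Nat.add_sub_cancel]; push_cast; rw [add_assoc]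
        · exact absurd ⟨h2, Nat.succ_ne_zero n⟩ h3
        · exact absurd h3.1 h2
        · simp
      · simp only [u]
        rcases n with _ | n
        · rw [map_sigma_thetaInv_zero h]; simp
        · rw [map_sigma_thetaInv_succ h]
          split_ifs with h2 h3 h3
          · simp [Matrix.vecMul_neg]
          · exact absurd ⟨h2, Nat.succ_ne_zero n⟩ h3
          · exact absurd h3.1 h2
          · simp
    · simp only [w]
      split_ifs
      · simp [Matrix.vecMul, dotProduct, Matrix.one_apply]
      · simp
  have hu : CFin u := by
    refine Wt.cfin (fun n => ((k - 1) + n).toNat) (fun n => ?_) (finite_toNat_le _)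
    simp only [u]
    split_ifs
    · exact wt_vecMul (fun b => (F.wt_sInt (k + n) b).mono (by omega)) _ _
    · exact Wt.zero_right _
  have hu' : CFin fun n => u (n + 1) := hu.comp_injective (add_left_injective 1)
  have hw : ∀ n : ℕ, n ≠ ((q : ℤ) - k).toNat → w n = 0 := fun n hn => if_neg (by omega)
  simp only [hterm]
  rw [csum_add, csum_sub hu' hu, csum_comp_injective (add_left_injective 1), sub_self, zero_add,
    csum_eq_single _ hw]
  · simp only [w]
    refine if_congr ?_ rfl rfl
    omega
  · intro n hn
    have : n = 0 := by
      by_contra h0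
      exact hn ⟨n - 1, Nat.succ_pred_eq_of_ne_zero h0⟩
    simp [u, this]
  · simpa only [sub_eq_add_neg, neg_one_smul] using hu'.add (hu.smul fun _ => -1)
  · refine CFin.of_support_subset {((q : ℤ) - k).toNat} fun n hn => hw n (by simpa using hn)

theorem dilaton_tSol (k : ℤ) (b : A) : F.dilaton (tSol F θ k b) = - tSol F θ k b := by
  rw [tSol, conv, F.dilaton_eq, vf_csum F.cfin_dilaton ((tame_sInt F).cfin _ k b), ← csum_neg,
    ← F.dilaton_eq]
  refine congrArg csum (funext fun n => ?_)
  have h := congrFun (F.dilaton_vecMul (F.sInt (k + n)) (pullMat (thetaInv θ n))) b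
  simp only [F.dilaton_sInt] at h
  rw [h, Pi.add_apply, show (pullMat (thetaInv θ n)).map F.dilaton = 0 from
    Matrix.ext fun _ _ => F.dilaton_pull _]
  change ((-F.sInt (k + n)) ᵥ* pullMat (thetaInv θ n)) b + _ = _
  simp [Matrix.neg_vecMul]

theorem isFlatGenerating_tSol (h : IsFundamental F θ) : IsFlatGenerating F θ (tSol F θ) := by
  refine ⟨dilaton_tSol, fun j a k b => ?_⟩
  simp only [flatField, sigma_tSol h]
  rw [← Finset.Nat.sum_antidiagonal_swap, Finset.Nat.sum_antidiagonal_eq_sum_range_succ_mk]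
  refine Finset.sum_congr rfl fun m _ => ?_
  simp only [Prod.fst_swap, Prod.snd_swap]
  split_ifs
  · change ∑ c, _ = pullMat _ a b
    rw [pullMat_mul, Matrix.mul_apply]
  · simp

/-! ### Uniqueness -/

theorem flatField_add (k : ℕ) (a : A) (f g : Jet A) :
    flatField F θ k a (f + g) = flatField F θ k a f + flatField F θ k a g := by
  simp only [flatField, F.sigma_eq, vf_add (F.cfin_sigma _ _), mul_add, Finset.sum_add_distrib]

theorem flatField_smul (k : ℕ) (a : A) (x : ℂ) (f : Jet A) :
    flatField F θ k a (x • f) = x • flatField F θ k a f := by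
  simp only [flatField, F.sigma_eq, vf_smul, Finset.smul_sum, mul_smul_comm]

theorem flatField_mul (k : ℕ) (a : A) (f g : Jet A) :
    flatField F θ k a (f * g) = flatField F θ k a f * g + f * flatField F θ k a g := by
  simp only [flatField, F.sigma_eq, vf_mul (F.cfin_sigma _ _), Finset.sum_mul, Finset.mul_sum,
    ← Finset.sum_add_distrib]
  exact Finset.sum_congr rfl fun _ _ => Finset.sum_congr rfl fun _ _ => by ring

theorem flatField_sum {ι : Type*} (k : ℕ) (a : A) (s : Finset ι) (f : ι → Jet A) :
    flatField F θ k a (∑ i ∈ s, f i) = ∑ i ∈ s, flatField F θ k a (f i) := by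
  classical
  induction s using Finset.induction_on with
  | empty => simp [flatField_zero]
  | insert x s hx ih => rw [Finset.sum_insert hx, Finset.sum_insert hx, flatField_add, ih]

theorem flatField_csum {ι : Type*} {f : ι → Jet A} (hf : CFin f) (k : ℕ) (a : A) :
    flatField F θ k a (csum f) = csum fun i => flatField F θ k a (f i) := by
  refine Eq.symm ((csum_sum fun p _ => CFin.sum fun b _ =>
    (hf.vf (F.cfin_sigma p.2 b)).mul_left fun _ => pullMat (θ p.1) a b).trans ?_)
  refine Finset.sum_congr rfl fun p _ => ?_
  refine (csum_sum fun b _ =>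
    (hf.vf (F.cfin_sigma p.2 b)).mul_left fun _ => pullMat (θ p.1) a b).trans ?_
  refine Finset.sum_congr rfl fun b _ => ?_
  rw [F.sigma_eq, vf_csum (F.cfin_sigma _ _) hf, csum_mul_left (hf.vf (F.cfin_sigma _ _))]

/-- Θ has leading coefficient 1, so the relation between the two frames is unipotent and can be
inverted by induction on k. -/
theorem sigma_eq_zero_of_flatField (h : IsFundamental F θ) {f : Jet A}
    (hf : ∀ k a, flatField F θ k a f = 0) (k : ℕ) (a : A) : F.sigma k a f = 0 := by
  induction k using Nat.strong_induction_on generalizing a with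
  | _ k ih =>
    have h1 := hf k a
    rw [flatField, Finset.sum_eq_single (0, k)] at h1
    · simpa [h.1, pullMat_one, Matrix.one_apply] using h1
    · intro p hp hne
      rw [Finset.HasAntidiagonal.mem_antidiagonal] at hp
      have hlt : p.2 < k := by
        rcases Nat.eq_zero_or_pos p.1 with h0 | h0
        · exact absurd (Prod.ext h0 (by simp only; omega)) hne
        · omega
      exact Finset.sum_eq_zero fun b _ => by rw [ih _ hlt, mul_zero]
    · intro h0
      exact absurd (by simp [Finset.HasAntidiagonal.mem_antidiagonal]) h0

/-- The derivatives of f are shown to have arbitrarily large weight. In σ_k f = 0 the terms with ℓ <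
k vanish, the block ℓ = k is 𝒳^{k+1} applied to ∂_k f, and each term with ℓ > k carries a
coefficient of positive weight. Solving for the block improves a bound d on all derivatives to d +
1. -/
theorem pderiv_eq_zero_of_sigma {f : Jet A} (hf : ∀ k a, F.sigma k a f = 0) (p : ℕ × A) :
    MvPowerSeries.pderiv ℂ p f = 0 := by
  suffices ∀ d : ℕ, ∀ p : ℕ × A, Wt d (MvPowerSeries.pderiv ℂ p f) from
    eq_zero_of_wt fun d => this d p
  intro d
  induction d with
  | zero => exact fun p => Wt.zero_left _
  | succ d ih =>
    rintro ⟨k, b⟩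
    let x : A → Jet A := fun b => MvPowerSeries.pderiv ℂ (k, b) f
    have hx : ∀ a, Wt (d + 1) ((F.𝒳 ^ (k + 1) *ᵥ x) a) := by
      intro a
      let rest : ℕ × A → Jet A := fun p => if p.1 = k then 0 else
        F.faa p.1 k a p.2 * MvPowerSeries.pderiv ℂ p f
      let main : ℕ × A → Jet A := fun p => if p.1 = k then
        F.faa p.1 k a p.2 * MvPowerSeries.pderiv ℂ p f else 0
      have hc : CFin fun p : ℕ × A => F.faa p.1 k a p.2 * MvPowerSeries.pderiv ℂ p f :=
        (F.cfin_sigma k a).mul_right _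
      have hrest : CFin rest := hc.mono fun p m h0 => by
        simp only [rest]; split_ifs; exacts [map_zero _, h0]
      have hmain : CFin main := hc.mono fun p m h0 => by
        simp only [main]; split_ifs; exacts [h0, map_zero _]
      have h1 : csum main + csum rest = 0 := by
        rw [← csum_add hmain hrest, ← hf k a, F.sigma_eq, vf]
        refine congrArg csum (funext fun p => ?_)
        simp only [main, rest]
        split_ifs <;> simp
      have h2 : csum main = (F.𝒳 ^ (k + 1) *ᵥ x) a := by
        rw [← csum_comp_injective (e := fun b : A => (k, b)) (fun _ _ h => (Prod.mk.inj h).2),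
          csum_fintype]
        · refine Finset.sum_congr rfl fun b _ => ?_
          simp only [main, if_true, F.faa_self, x]
        · rintro ⟨l, b⟩ hl
          refine if_neg fun h0 => hl ⟨b, ?_⟩
          simp only at h0
          rw [h0]
      rw [← h2, eq_neg_of_add_eq_zero_left h1]
      refine Wt.neg (Wt.csum fun p => ?_)
      simp only [rest]
      split_ifs with hp
      · exact Wt.zero_right _
      · rcases lt_or_gt_of_ne hp with hlt | hgt
        · rw [F.faa_of_lt hlt, Matrix.zero_apply, zero_mul]
          exact Wt.zero_right _
        · exact ((F.lev_faa p.1 k a p.2).2.mul (ih p)).mono (by omega)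
    have h3 : x = (F.𝒳⁻¹) ^ (k + 1) *ᵥ (F.𝒳 ^ (k + 1) *ᵥ x) := by
      rw [Matrix.mulVec_mulVec, ← Commute.mul_pow, F.inv_mul_𝒳, one_pow, Matrix.one_mulVec]
      change F.𝒳⁻¹ * F.𝒳 = F.𝒳 * F.𝒳⁻¹
      rw [F.inv_mul_𝒳, F.𝒳_mul_inv]
    change Wt (d + 1) (x b)
    rw [h3]
    exact Wt.sum fun a _ => (hx a).mul_left _

/-- All partial derivatives vanish, so 𝒬f = 0, while 𝒬f = -f. -/
theorem eq_zero_of_flatField (h : IsFundamental F θ) {f : Jet A}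
    (hf : ∀ k a, flatField F θ k a f = 0) (hd : F.dilaton f = -f) : f = 0 := by
  have h1 := pderiv_eq_zero_of_sigma (sigma_eq_zero_of_flatField h hf)
  rw [F.dilaton_eq, vf_eq_zero_of_pderiv h1] at hd
  exact neg_eq_zero.mp hd.symm

theorem isFlatGenerating_flatGen (h : IsFundamental F θ) : IsFlatGenerating F θ (flatGen F θ) :=
  Classical.epsilon_spec ⟨_, isFlatGenerating_tSol h⟩

theorem flatGen_eq (h : IsFundamental F θ) : flatGen F θ = tSol F θ := by
  funext k b
  rw [← sub_eq_zero]
  have h1 := isFlatGenerating_flatGen h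
  have h2 := isFlatGenerating_tSol h
  refine eq_zero_of_flatField h (fun j a => ?_) ?_
  · rw [sub_eq_add_neg, ← neg_one_smul ℂ, flatField_add, flatField_smul, h1.2, h2.2,
      neg_one_smul, add_neg_cancel]
  · rw [F.dilaton_eq, vf_sub F.cfin_dilaton, ← F.dilaton_eq, h1.1, h2.1]
    ring

theorem tame_flatGen (h : IsFundamental F θ) : Tame 1 (flatGen F θ) := by
  rw [flatGen_eq h]
  exact (tame_sInt F).conv _

/-- `𝐬(z) = Θ*(z) 𝐭(z)` is intrinsic. -/
theorem sVec_eq (h : IsFundamental F θ) : sVec F θ = F.sInt := by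
  funext k b
  change conv (flatGen F θ) (fun n => pullMat (θ n)) k b = _
  rw [flatGen_eq h, tSol, conv_conv (tame_sInt F)]
  simp only [sum_pull_thetaInv_mul_theta h]
  exact conv_one _ _ _

end

section

open MvPowerSeries

variable {A : Type*} [Fintype A] [DecidableEq A] {F : FrobeniusGerm A}
  {θ : ℕ → Matrix A A (Base A)}

/-! ### Constant matrices and adjoints -/

section

variable {τ : Type*}

theorem constMat_mul (S T : Matrix A A ℂ) :
    constMat (τ := τ) (S * T) = constMat S * constMat T :=
  Matrix.map_mul (f := (MvPowerSeries.C : ℂ →+* MvPowerSeries τ ℂ))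

theorem constMat_one : constMat (τ := τ) (1 : Matrix A A ℂ) = 1 :=
  Matrix.map_one _ (map_zero _) (map_one _)

theorem constMat_add (S T : Matrix A A ℂ) :
    constMat (τ := τ) (S + T) = constMat S + constMat T :=
  Matrix.map_add _ (map_add _) S T

theorem constMat_sub (S T : Matrix A A ℂ) :
    constMat (τ := τ) (S - T) = constMat S - constMat T :=
  Matrix.map_sub _ (map_sub _) S T

theorem constMat_smul (c : ℂ) (T : Matrix A A ℂ) :
    constMat (τ := τ) (c • T) = c • constMat T :=
  Matrix.ext fun _ _ => by
    simp [constMat, MvPowerSeries.smul_eq_C_mul]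

theorem constMat_transpose (T : Matrix A A ℂ) : (constMat (τ := τ) T)ᵀ = constMat Tᵀ := rfl

theorem pullMat_constMat (T : Matrix A A ℂ) : pullMat (constMat T) = constMat T :=
  Matrix.ext fun _ _ => rename_C _ _

end

theorem pullMat_smul (c : ℂ) (T : Matrix A A (Base A)) : pullMat (c • T) = c • pullMat T :=
  Matrix.ext fun i j => map_smul pull c (T i j)

theorem pullMat_transpose (T : Matrix A A (Base A)) : pullMat Tᵀ = (pullMat T)ᵀ := rfl

namespace FrobeniusGerm

variable (F)

theorem η_transpose : F.ηᵀ = F.η := Matrix.ext fun a b => F.η_symm b a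

theorem η_mul_inv : F.η * F.η⁻¹ = 1 := Matrix.mul_nonsing_inv _ F.η_nondeg

theorem inv_mul_η : F.η⁻¹ * F.η = 1 := Matrix.nonsing_inv_mul _ F.η_nondeg

theorem η_inv_transpose : F.η⁻¹ᵀ = F.η⁻¹ := by rw [Matrix.transpose_nonsing_inv, η_transpose]

theorem constMat_η_mul_inv {τ : Type*} : constMat (τ := τ) F.η * constMat F.η⁻¹ = 1 := by
  rw [← constMat_mul, η_mul_inv, constMat_one]

theorem constMat_inv_mul_η {τ : Type*} : constMat (τ := τ) F.η⁻¹ * constMat F.η = 1 := by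
  rw [← constMat_mul, inv_mul_η, constMat_one]

end FrobeniusGerm

theorem thetaInv_eq_adjoint (hθ : IsSymmetricFundamental F θ) (n : ℕ) :
    thetaInv θ n = (-1 : ℂ) ^ n • (constMat F.η * (θ n)ᵀ * constMat F.η⁻¹) := by
  have h1 : PowerSeries.mk (fun n => (-1 : ℂ) ^ n • (constMat F.η * (θ n)ᵀ * constMat F.η⁻¹)) *
      PowerSeries.mk θ = 1 := by
    ext n : 1
    rw [PowerSeries.coeff_mul, PowerSeries.coeff_one, ← hθ.2.2 n]
    simp only [PowerSeries.coeff_mk, smul_mul_assoc]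
  have h2 := left_inv_eq_right_inv h1 (mk_mul_thetaInvSeries hθ.1)
  rw [thetaInv_eq, ← h2, PowerSeries.coeff_mk]

theorem pull_thetaInv_mul_η (hθ : IsSymmetricFundamental F θ) (n : ℕ) :
    pullMat (thetaInv θ n) * constMat F.η =
      (-1 : ℂ) ^ n • (constMat F.η * (pullMat (θ n))ᵀ) := by
  rw [thetaInv_eq_adjoint hθ, pullMat_smul, pullMat_mul, pullMat_mul, pullMat_constMat,
    pullMat_constMat, smul_mul_assoc, mul_assoc, F.constMat_inv_mul_η, mul_one, pullMat_transpose]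

/-! ### The genus zero two-point functions -/

variable (F θ) in
/-- The matrix `(∂_{j,a} ∂_{k,b} ℱ_0)_{ab}`. -/
def twoPoint (j k : ℕ) : Matrix A A (Jet A) :=
  (-1 : ℂ) ^ k • (∑ p ∈ Finset.HasAntidiagonal.antidiagonal j,
    pullMat (θ p.1) * pullMat (thetaInv θ (p.2 + k + 1))) * constMat F.η

theorem flatField_flatGen_neg (h : IsFundamental F θ) (j k : ℕ) (a b : A) :
    flatField F θ j a (flatGen F θ (-(k : ℤ) - 1) b) =
      (∑ p ∈ Finset.HasAntidiagonal.antidiagonal j,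
        pullMat (θ p.1) * pullMat (thetaInv θ (p.2 + k + 1))) a b := by
  rw [flatField, Matrix.sum_apply]
  refine Finset.sum_congr rfl fun p _ => ?_
  rw [Matrix.mul_apply]
  refine Finset.sum_congr rfl fun c _ => ?_
  rw [flatGen_eq h, sigma_tSol h, if_pos (by omega)]
  congr 4
  omega

/-- For k ≥ 0 the sum is the full coefficient of x^j in Θ(x) x^k Θ(x)⁻¹ = x^k. -/
theorem flatField_flatGen_nonneg (h : IsFundamental F θ) (j k : ℕ) (a b : A) :
    flatField F θ j a (flatGen F θ k b) =
      if j = k then (1 : Matrix A A (Jet A)) a b else 0 := by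
  have h1 : PowerSeries.coeff j (PowerSeries.mk θ * (PowerSeries.X ^ k * thetaInvSeries θ)) =
      if j = k then 1 else 0 := by
    rw [← mul_assoc, (PowerSeries.commute_X_pow (PowerSeries.mk θ) k).eq, mul_assoc,
      mk_mul_thetaInvSeries h, mul_one, PowerSeries.coeff_X_pow]
  rw [PowerSeries.coeff_mul] at h1
  have h2 := congrArg pullMat h1
  rw [pullMat_sum, apply_ite pullMat, pullMat_one, pullMat_zero] at h2
  have h3 := congrFun (congrFun h2 a) b
  rw [Matrix.sum_apply] at h3
  have h4 : (if j = k then (1 : Matrix A A (Jet A)) else 0) a b =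
      if j = k then (1 : Matrix A A (Jet A)) a b else 0 := by split_ifs <;> rfl
  rw [← h4, ← h3, flatField]
  refine Finset.sum_congr rfl fun p _ => ?_
  rw [pullMat_mul, Matrix.mul_apply]
  refine Finset.sum_congr rfl fun c _ => ?_
  rw [PowerSeries.coeff_mk, flatGen_eq h, sigma_tSol h, PowerSeries.coeff_X_pow_mul']
  congr 1
  by_cases hk : k ≤ p.2
  · rw [if_pos (by omega), if_pos hk, thetaInv_eq]
    congr 4
    omega
  · rw [if_neg (by omega), if_neg hk, pullMat_zero]
    rfl

theorem twoPoint_eq (hθ : IsSymmetricFundamental F θ) (j k : ℕ) :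
    twoPoint F θ j k = ∑ p ∈ Finset.HasAntidiagonal.antidiagonal j,
      (-1 : ℂ) ^ (p.2 + 1) • (pullMat (θ p.1) * constMat F.η * (pullMat (θ (p.2 + k + 1)))ᵀ) := by
  rw [twoPoint, smul_mul_assoc, Finset.sum_mul, Finset.smul_sum]
  refine Finset.sum_congr rfl fun p _ => ?_
  rw [mul_assoc, pull_thetaInv_mul_η hθ, mul_smul_comm, smul_smul, mul_assoc]
  congr 1
  rw [← pow_add, show k + (p.2 + k + 1) = 2 * k + (p.2 + 1) by ring, pow_add, pow_mul]
  simp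

theorem sum_theta_mul_adjoint (hθ : IsSymmetricFundamental F θ) (n : ℕ) :
    ∑ p ∈ Finset.HasAntidiagonal.antidiagonal (n + 1), (-1 : ℂ) ^ p.2 •
      (pullMat (θ p.1) * constMat F.η * (pullMat (θ p.2))ᵀ) = 0 := by
  have h := congrArg (fun T => T * constMat (τ := ℕ × A) F.η)
    (sum_pull_theta_mul_thetaInv hθ.1 (n + 1))
  simp only [if_neg (Nat.succ_ne_zero n), zero_mul, Finset.sum_mul, mul_assoc,
    pull_thetaInv_mul_η hθ, mul_smul_comm] at h
  simpa only [mul_assoc] using h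

/-- After Θ⁻¹ is rewritten through the adjoint, the two sides become complementary partial sums, up
to a sign, of the coefficient of degree j + k + 1 in Θ(x)Θ*(-x) = 1. That coefficient is zero. This
symmetry is the integrability condition for F_0. -/
theorem twoPoint_transpose (hθ : IsSymmetricFundamental F θ) (j k : ℕ) :
    (twoPoint F θ j k)ᵀ = twoPoint F θ k j := by
  have h := sum_theta_mul_adjoint hθ (k + j)
  let f : ℕ → ℕ → Matrix A A (Jet A) := fun i l =>
    (-1 : ℂ) ^ l • (pullMat (θ i) * constMat F.η * (pullMat (θ l))ᵀ)
  have hf : ∀ i l, (f i l)ᵀ = (-1 : ℂ) ^ (i + l) • f l i := by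
    intro i l
    simp only [f, Matrix.transpose_smul, Matrix.transpose_mul, Matrix.transpose_transpose,
      constMat_transpose, F.η_transpose, smul_smul, mul_assoc]
    congr 1
    rw [← pow_add, show i + l + i = 2 * i + l by ring, pow_add, pow_mul]
    simp
  have e1 : twoPoint F θ k j = ∑ i ∈ Finset.range (k + 1), (-1 : ℂ) ^ j • f i (k + j + 1 - i) := by
    rw [twoPoint_eq hθ, Finset.Nat.sum_antidiagonal_eq_sum_range_succ_mk]
    refine Finset.sum_congr rfl fun i hi => ?_
    have hi' : i ≤ k := Nat.lt_succ_iff.mp (Finset.mem_range.mp hi)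
    simp only [f, smul_smul]
    rw [show k - i + j + 1 = k + j + 1 - i by omega, ← pow_add,
      show j + (k + j + 1 - i) = 2 * j + (k - i + 1) by omega, pow_add _ (2 * j), pow_mul]
    simp
  have e2 : (twoPoint F θ j k)ᵀ =
      - ∑ i ∈ Finset.range (j + 1), (-1 : ℂ) ^ j • f (k + 1 + i) (k + j + 1 - (k + 1 + i)) := by
    rw [twoPoint_eq hθ, ← Finset.Nat.sum_antidiagonal_swap,
      Finset.Nat.sum_antidiagonal_eq_sum_range_succ_mk, Matrix.transpose_sum,
      ← Finset.sum_neg_distrib]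
    refine Finset.sum_congr rfl fun i hi => ?_
    have hi' : i ≤ j := Nat.lt_succ_iff.mp (Finset.mem_range.mp hi)
    simp only [Prod.fst_swap, Prod.snd_swap]
    have h1 : (-1 : ℂ) ^ (i + 1) • (pullMat (θ (j - i)) * constMat F.η *
        (pullMat (θ (i + k + 1)))ᵀ) = (-1 : ℂ) ^ k • f (j - i) (i + k + 1) := by
      simp only [f, smul_smul]
      rw [← pow_add, show k + (i + k + 1) = 2 * k + (i + 1) by ring, pow_add _ (2 * k), pow_mul]
      simp
    rw [h1, Matrix.transpose_smul, hf, smul_smul, ← pow_add,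
      show k + (j - i + (i + k + 1)) = 2 * k + (j + 1) by omega, pow_add, pow_mul,
      show i + k + 1 = k + 1 + i by ring, show k + j + 1 - (k + 1 + i) = j - i by omega]
    rw [neg_one_sq, one_pow, one_mul, pow_succ, mul_neg_one, neg_smul]
  rw [e1, e2, neg_eq_iff_add_eq_zero, add_comm, ← Finset.sum_range_add
    (fun i => (-1 : ℂ) ^ j • f i (k + j + 1 - i)) (k + 1) (j + 1), ← Finset.smul_sum]
  rw [Finset.Nat.sum_antidiagonal_eq_sum_range_succ_mk] at h
  rw [show k + 1 + (j + 1) = (k + j + 1).succ by omega, h, smul_zero]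

/-! ### The genus zero potential -/

theorem sVec_eq_conv : sVec F θ = conv (flatGen F θ) fun n => pullMat (θ n) := rfl

/-- The Euler relation for ∂_{j,c}F_0. Writing the two-point matrix as a partial sum of products of
coefficients of Θ and Θ⁻¹ and summing first against Θ turns 𝐭 into 𝐬; the remaining sum 𝐬Θ⁻¹ returns
𝐭_{-j-1}. -/
theorem csum_flatGen_twoPoint (hθ : IsSymmetricFundamental F θ) (j : ℕ) (c : A) :
    (csum fun k : ℕ => ∑ a, flatGen F θ k a * twoPoint F θ k j a c) =
      (-1 : ℂ) ^ j • ∑ b, F.η c b • flatGen F θ (-(j : ℤ) - 1) b := by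
  let f : ℕ × ℕ → Jet A := fun p => (flatGen F θ (0 + (p.1 : ℤ) + p.2) ᵥ*
    (pullMat (θ p.2) * (pullMat (thetaInv θ (p.1 + j + 1)) * constMat F.η))) c
  have hf : CFin f := Wt.cfin (fun p => (-1 + p.1 + p.2 : ℤ).toNat)
    (fun p => wt_vecMul (fun b => (tame_flatGen hθ.1 _ b).mono (by omega)) _ _)
    (finite_toNat_prod_le _)
  have h1 : ∀ k : ℕ, ∑ a, flatGen F θ k a * twoPoint F θ k j a c =
      (-1 : ℂ) ^ j • ∑ p ∈ Finset.HasAntidiagonal.antidiagonal k, f p := by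
    intro k
    change (flatGen F θ k ᵥ* twoPoint F θ k j) c = _
    rw [twoPoint, Matrix.smul_mul, Matrix.vecMul_smul, Pi.smul_apply, Finset.sum_mul,
      Matrix.vecMul_sum, Finset.sum_apply, ← Finset.Nat.sum_antidiagonal_swap]
    congr 1
    refine Finset.sum_congr rfl fun p hp => ?_
    rw [Finset.HasAntidiagonal.mem_antidiagonal] at hp
    simp only [f, Prod.fst_swap, Prod.snd_swap, mul_assoc]
    rw [show (0 + (p.1 : ℤ) + p.2) = k by omega]
  simp only [h1]
  rw [csum_smul, ← csum_antidiagonal hf, csum_prod hf]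
  congr 1
  have h2 : ∀ m : ℕ, (csum fun n : ℕ => f (m, n)) =
      (F.sInt (0 + (m : ℤ)) ᵥ* (pullMat (thetaInv θ (m + j + 1)) * constMat F.η)) c := by
    intro m
    rw [← sVec_eq hθ.1, sVec_eq_conv, conv_vecMul (tame_flatGen hθ.1)]
  simp only [h2]
  have h3 : ∑ b, F.η c b • flatGen F θ (-(j : ℤ) - 1) b =
      (flatGen F θ (-(j : ℤ) - 1) ᵥ* constMat F.η) c := by
    refine Finset.sum_congr rfl fun b _ => ?_
    rw [F.η_symm, smul_eq_C_mul, mul_comm]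
    rfl
  rw [h3, flatGen_eq hθ.1, tSol, conv_vecMul (tame_sInt F)]
  refine Eq.trans ?_ (csum_comp_injective (e := fun m : ℕ => m + (j + 1))
    (add_left_injective _) ?_)
  · refine congrArg csum (funext fun m => ?_)
    rw [show (-(j : ℤ) - 1 + ((m + (j + 1) : ℕ) : ℤ)) = 0 + m by push_cast; ring, add_assoc]
  -- The terms missing from the shifted sum involve 𝐬_i with i ≤ -1, which vanish.
  · intro n hn
    have : n < j + 1 := by
      by_contra h
      exact hn ⟨n - (j + 1), by simp only; omega⟩
    rw [F.sInt_of_nonpos (by omega)]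
    simp

variable (F θ) in
/-- The construction of the genus zero potential. -/
def genusZeroSol : Jet A := (1 / 2 : ℂ) • csum fun k : ℕ => (-1 : ℂ) ^ k •
  ∑ a, ∑ b, F.η a b • (flatGen F θ k a * flatGen F θ (-(k : ℤ) - 1) b)

theorem cfin_flatGen (h : IsFundamental F θ) (a : A) : CFin fun k : ℕ => flatGen F θ k a :=
  Wt.cfin (fun k => (-1 + (k : ℤ)).toNat) (fun k => (tame_flatGen h k a).mono (by omega))
    (finite_toNat_le _)

/-- F_0 is homogeneous of degree two, so Euler's formula writes it as half the sum of 𝐭_k against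
its would-be derivatives. Differentiating the first factor gives one copy of the answer,
differentiating the second gives another by symmetry of the two-point functions and the Euler
relation, and the prefactor 1/2 compensates. -/
theorem genusZeroSol_spec (hθ : IsSymmetricFundamental F θ) :
    (∀ (k : ℕ) (a : A), flatField F θ k a (genusZeroSol F θ) =
      (-1 : ℂ) ^ k • ∑ b, F.η a b • flatGen F θ (-(k : ℤ) - 1) b) ∧
    F.dilaton (genusZeroSol F θ) = (-2 : ℂ) • genusZeroSol F θ := by
  have hc : CFin fun k : ℕ => (-1 : ℂ) ^ k •
      ∑ a, ∑ b, F.η a b • (flatGen F θ k a * flatGen F θ (-(k : ℤ) - 1) b) :=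
    (CFin.sum fun a _ => CFin.sum fun b _ =>
      ((cfin_flatGen hθ.1 a).mul_right _).smul _).smul _
  constructor
  · intro j c
    rw [genusZeroSol, flatField_smul, flatField_csum hc]
    have h1 : ∀ k : ℕ, flatField F θ j c ((-1 : ℂ) ^ k •
        ∑ a, ∑ b, F.η a b • (flatGen F θ k a * flatGen F θ (-(k : ℤ) - 1) b)) =
        (if k = j then (-1 : ℂ) ^ j • ∑ b, F.η c b • flatGen F θ (-(j : ℤ) - 1) b else 0) +
          ∑ a, flatGen F θ k a * twoPoint F θ k j a c := by
      intro k
      simp only [flatField_smul, flatField_sum, flatField_mul, flatField_flatGen_nonneg hθ.1,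
        smul_add, Finset.sum_add_distrib]
      congr 1
      · split_ifs with hk hk' hk'
        · subst hk
          congr 1
          rw [Finset.sum_comm]
          refine Finset.sum_congr rfl fun b _ => ?_
          rw [Finset.sum_eq_single c]
          · simp
          · intro a _ ha
            simp [Matrix.one_apply_ne (Ne.symm ha)]
          · simp
        · exact absurd hk.symm hk'
        · exact absurd hk'.symm hk
        · simp
      · rw [Finset.smul_sum]
        refine Finset.sum_congr rfl fun a _ => ?_
        rw [← twoPoint_transpose hθ, Matrix.transpose_apply, twoPoint, Matrix.smul_mul,
          Matrix.smul_apply, Matrix.mul_apply, mul_smul_comm, Finset.mul_sum]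
        congr 1
        refine Finset.sum_congr rfl fun b _ => ?_
        rw [flatField_flatGen_neg hθ.1, F.η_symm, smul_eq_C_mul]
        change _ = _ * (_ * C (F.η b a))
        ring
    simp only [h1]
    rw [csum_add, csum_flatGen_twoPoint hθ, csum_eq_single j, if_pos rfl, ← two_smul ℂ, smul_smul]
    · norm_num
    · intro k hk
      exact if_neg hk
    · exact CFin.of_support_subset {j} fun k hk => if_neg (by simpa using hk)
    · exact CFin.sum fun a _ => (cfin_flatGen hθ.1 a).mul_right _
  · rw [genusZeroSol, F.dilaton_eq, vf_smul, vf_csum F.cfin_dilaton hc, smul_comm (-2 : ℂ) (1 / 2 : ℂ)]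
    congr 1
    rw [← csum_smul]
    refine congrArg csum (funext fun k => ?_)
    simp only [vf_smul, vf_sum F.cfin_dilaton, vf_mul F.cfin_dilaton]
    rw [← F.dilaton_eq]
    simp only [(isFlatGenerating_flatGen hθ.1).1]
    rw [smul_comm (-2 : ℂ)]
    congr 1
    rw [Finset.smul_sum]
    refine Finset.sum_congr rfl fun a _ => ?_
    rw [Finset.smul_sum]
    refine Finset.sum_congr rfl fun b _ => ?_
    rw [smul_comm (-2 : ℂ)]
    congr 1
    rw [neg_smul, two_smul]
    ring

theorem flatField_genusZero (hθ : IsSymmetricFundamental F θ) (k : ℕ) (a : A) :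
    flatField F θ k a (genusZero F θ) =
      (-1 : ℂ) ^ k • ∑ b, F.η a b • flatGen F θ (-(k : ℤ) - 1) b :=
  (Classical.epsilon_spec (p := fun f : Jet A =>
    (∀ (k : ℕ) (a : A), flatField F θ k a f =
      (-1 : ℂ) ^ k • ∑ b, F.η a b • flatGen F θ (-(k : ℤ) - 1) b) ∧
    F.dilaton f = (-2 : ℂ) • f) ⟨_, genusZeroSol_spec hθ⟩).1 k a

theorem flatField_flatField_genusZero (hθ : IsSymmetricFundamental F θ) (j k : ℕ) (a c : A) :
    flatField F θ j a (flatField F θ k c (genusZero F θ)) = twoPoint F θ j k a c := by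
  rw [flatField_genusZero hθ, flatField_smul, flatField_sum, twoPoint, Matrix.smul_mul,
    Matrix.smul_apply, Matrix.mul_apply]
  congr 1
  refine Finset.sum_congr rfl fun b _ => ?_
  rw [flatField_smul, flatField_flatGen_neg hθ.1, F.η_symm, smul_eq_C_mul, mul_comm]
  rfl

end

section

/-! ### Laurent series with coefficients in a noncommutative algebra -/

section Laurent

variable {Q : Type*} [Ring Q] [Algebra ℂ Q]

theorem finite_support_coeff_mul (f g : HahnSeries ℤ Q) (m : ℤ) :
    (Function.support fun i => f.coeff i * g.coeff (m - i)).Finite := by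
  refine ((Finset.antidiagonal f.isPWO_support g.isPWO_support m).image
    Prod.fst).finite_toSet.subset fun i hi => ?_
  rw [Finset.coe_image]
  refine ⟨(i, m - i), ?_, rfl⟩
  rw [Finset.mem_coe, Finset.mem_antidiagonal]
  exact ⟨left_ne_zero_of_mul hi, right_ne_zero_of_mul hi, add_sub_cancel _ _⟩

theorem coeff_mul_eq_finsum (f g : HahnSeries ℤ Q) (m : ℤ) :
    (f * g).coeff m = ∑ᶠ i, f.coeff i * g.coeff (m - i) := by
  classical
  rw [HahnSeries.coeff_mul, finsum_eq_sum_of_support_subset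
    (s := (Finset.antidiagonal f.isPWO_support g.isPWO_support m).image Prod.fst),
    Finset.sum_image]
  · refine Finset.sum_congr rfl fun ij hij => ?_
    rw [← (Finset.mem_antidiagonal.mp hij).2.2, add_sub_cancel_left]
  · intro x hx y hy hxy
    have h1 := (Finset.mem_antidiagonal.mp hx).2.2
    have h2 := (Finset.mem_antidiagonal.mp hy).2.2
    exact Prod.ext hxy (by omega)
  · intro i hi
    rw [Finset.coe_image]
    refine ⟨(i, m - i), ?_, rfl⟩
    rw [Finset.mem_coe, Finset.mem_antidiagonal]
    exact ⟨left_ne_zero_of_mul hi, right_ne_zero_of_mul hi, add_sub_cancel _ _⟩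

/-- The derivation `z ∂_z`. -/
def euler (f : HahnSeries ℤ Q) : HahnSeries ℤ Q where
  coeff m := (m : ℂ) • f.coeff m
  isPWO_support' := f.isPWO_support.mono fun m hm h => hm (by simp only; rw [h, smul_zero])

@[simp] theorem coeff_euler (f : HahnSeries ℤ Q) (m : ℤ) :
    (euler f).coeff m = (m : ℂ) • f.coeff m := rfl

theorem euler_add (f g : HahnSeries ℤ Q) : euler (f + g) = euler f + euler g := by
  ext m; simp

theorem euler_sub (f g : HahnSeries ℤ Q) : euler (f - g) = euler f - euler g := by
  ext m; simp [smul_sub]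

theorem euler_mul (f g : HahnSeries ℤ Q) : euler (f * g) = euler f * g + f * euler g := by
  ext m
  rw [coeff_euler, HahnSeries.coeff_add, coeff_mul_eq_finsum, coeff_mul_eq_finsum,
    coeff_mul_eq_finsum, ← finsum_add_distrib (finite_support_coeff_mul _ _ _)
      (finite_support_coeff_mul _ _ _), smul_finsum' _ (finite_support_coeff_mul _ _ _)]
  refine finsum_congr fun i => ?_
  simp only [coeff_euler, smul_mul_assoc, mul_smul_comm, ← add_smul]
  congr 1
  push_cast
  ring

theorem euler_one : euler (1 : HahnSeries ℤ Q) = 0 := by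
  ext m
  rw [coeff_euler, HahnSeries.coeff_one]
  split_ifs with h
  · simp [h]
  · simp

theorem euler_single (p : ℤ) (q : Q) :
    euler (HahnSeries.single p q) = HahnSeries.single p ((p : ℂ) • q) := by
  ext m
  rw [coeff_euler, HahnSeries.coeff_single, HahnSeries.coeff_single]
  split_ifs with h
  · rw [h]
  · simp

theorem single_one_mul_comm (p : ℤ) (f : HahnSeries ℤ Q) :
    HahnSeries.single p 1 * f = f * HahnSeries.single p 1 := by
  ext m
  rw [HahnSeries.coeff_single_mul, HahnSeries.coeff_mul_single, one_mul, mul_one]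

/-- The operator `z ∂_z + R(z)`. -/
def zdop (R f : HahnSeries ℤ Q) : HahnSeries ℤ Q := euler f + R * f

/-- The operator `∂_z + z⁻¹ R(z)`. -/
def dop (R f : HahnSeries ℤ Q) : HahnSeries ℤ Q := HahnSeries.single (-1) 1 * zdop R f

theorem coeff_dop (R f : HahnSeries ℤ Q) (m : ℤ) :
    (dop R f).coeff m = ((m : ℂ) + 1) • f.coeff (m + 1) + (R * f).coeff (m + 1) := by
  rw [dop, HahnSeries.coeff_single_mul, one_mul, sub_neg_eq_add, zdop, HahnSeries.coeff_add,
    coeff_euler]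
  push_cast
  rfl

theorem zdop_add (R f g : HahnSeries ℤ Q) : zdop R (f + g) = zdop R f + zdop R g := by
  simp only [zdop, euler_add, mul_add]; abel

theorem dop_add (R f g : HahnSeries ℤ Q) : dop R (f + g) = dop R f + dop R g := by
  rw [dop, zdop_add, mul_add]; rfl

theorem dop_zero (R : HahnSeries ℤ Q) : dop R 0 = 0 := by
  have := dop_add R 0 0
  rw [add_zero] at this
  exact left_eq_add.mp this

theorem dop_mul_C (R f : HahnSeries ℤ Q) (q : Q) :
    dop R (f * HahnSeries.single 0 q) = dop R f * HahnSeries.single 0 q := by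
  rw [dop, dop, zdop, zdop, euler_mul, euler_single]
  simp [mul_assoc, add_mul]

theorem iterate_dop_add (R f g : HahnSeries ℤ Q) (n : ℕ) :
    (dop R)^[n] (f + g) = (dop R)^[n] f + (dop R)^[n] g := by
  induction n with
  | zero => rfl
  | succ n ih => rw [Function.iterate_succ_apply', ih, dop_add,
      ← Function.iterate_succ_apply' (dop R), ← Function.iterate_succ_apply' (dop R)]

theorem iterate_dop_zero (R : HahnSeries ℤ Q) (n : ℕ) : (dop R)^[n] 0 = 0 := by
  induction n with
  | zero => rfl
  | succ n ih => rw [Function.iterate_succ_apply', ih, dop_zero]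

theorem iterate_dop_sum {ι : Type*} (R : HahnSeries ℤ Q) (n : ℕ) (s : Finset ι)
    (f : ι → HahnSeries ℤ Q) :
    (dop R)^[n] (∑ i ∈ s, f i) = ∑ i ∈ s, (dop R)^[n] (f i) := by
  classical
  induction s using Finset.induction_on with
  | empty => simp [iterate_dop_zero]
  | insert a s ha ih => rw [Finset.sum_insert ha, Finset.sum_insert ha, iterate_dop_add, ih]

theorem iterate_dop_mul_C (R f : HahnSeries ℤ Q) (q : Q) (n : ℕ) :
    (dop R)^[n] (f * HahnSeries.single 0 q) = (dop R)^[n] f * HahnSeries.single 0 q := by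
  induction n with
  | zero => rfl
  | succ n ih => rw [Function.iterate_succ_apply', ih, dop_mul_C,
      ← Function.iterate_succ_apply' (dop R)]

theorem iterate_dop_single (R : HahnSeries ℤ Q) (n : ℕ) (p m : ℤ) (q : Q) :
    ((dop R)^[n] (HahnSeries.single p q)).coeff m =
      ((dop R)^[n] (HahnSeries.single p 1)).coeff m * q := by
  have : HahnSeries.single p q = HahnSeries.single p 1 * HahnSeries.single 0 q := by
    rw [HahnSeries.single_mul_single, add_zero, one_mul]
  rw [this, iterate_dop_mul_C, HahnSeries.coeff_mul_single_zero]

/-- The coefficients of `z^m`, `m < N`, vanish. -/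
def LowerBound (N : ℤ) (f : HahnSeries ℤ Q) : Prop := ∀ m, m < N → f.coeff m = 0

theorem LowerBound.mul {N M : ℤ} {f g : HahnSeries ℤ Q} (hf : LowerBound N f)
    (hg : LowerBound M g) : LowerBound (N + M) (f * g) := fun m hm => by
  rw [coeff_mul_eq_finsum]
  refine finsum_eq_zero_of_forall_eq_zero fun i => ?_
  rcases lt_or_ge i N with h | h
  · rw [hf i h, zero_mul]
  · rw [hg _ (by omega), mul_zero]

theorem lowerBound_single (p : ℤ) (q : Q) : LowerBound p (HahnSeries.single p q) := fun _ hm =>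
  HahnSeries.coeff_single_of_ne hm.ne

theorem lowerBound_ofPowerSeries (P : PowerSeries Q) :
    LowerBound 0 (HahnSeries.ofPowerSeries ℤ Q P) := fun m hm => by
  rw [HahnSeries.ofPowerSeries_apply, HahnSeries.embDomain_of_notMem_range]
  rintro ⟨n, hn⟩
  have : ((n : ℕ) : ℤ) = m := hn
  omega

theorem coeff_ofPowerSeries (P : PowerSeries Q) (m : ℤ) :
    (HahnSeries.ofPowerSeries ℤ Q P).coeff m =
      if 0 ≤ m then PowerSeries.coeff m.toNat P else 0 := by
  split_ifs with h
  · obtain ⟨n, rfl⟩ := Int.eq_ofNat_of_zero_le h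
    simp
  · exact lowerBound_ofPowerSeries P m (by omega)

theorem LowerBound.dop {N : ℤ} {R f : HahnSeries ℤ Q} (hR : LowerBound 0 R)
    (hf : LowerBound N f) : LowerBound (N - 1) (dop R f) := fun m hm => by
  rw [coeff_dop, hf _ (by omega), (hR.mul hf) _ (by omega), smul_zero, add_zero]

theorem LowerBound.iterate_dop {N : ℤ} {R f : HahnSeries ℤ Q} (hR : LowerBound 0 R)
    (hf : LowerBound N f) (n : ℕ) : LowerBound (N - n) ((JetVirasoro.dop R)^[n] f) := by
  induction n with
  | zero => simpa using hf
  | succ n ih =>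
    rw [Function.iterate_succ_apply']
    have := hR.dop ih
    intro m hm
    exact this m (by push_cast at hm; omega)

/-- The expansion of `(∂_z + z⁻¹ R(z))^n f` in terms of the monomials occurring in `f`. -/
theorem coeff_iterate_dop {N M m : ℤ} {R f : HahnSeries ℤ Q} (hR : LowerBound 0 R)
    (hf : LowerBound N f) (n : ℕ) (hM : m + n < M) :
    ((dop R)^[n] f).coeff m =
      ∑ p ∈ Finset.Ico N M, ((dop R)^[n] (HahnSeries.single p 1)).coeff m * f.coeff p := by
  classical
  -- Each application of the operator lowers exponents by at most one, so monomials z^p with p ≥ M >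
  -- m + n cannot reach z^m.
  have htail : LowerBound M (f - ∑ p ∈ Finset.Ico N M, HahnSeries.single p (f.coeff p)) := by
    intro l hl
    rw [HahnSeries.coeff_sub, HahnSeries.coeff_sum]
    by_cases h : l ∈ Finset.Ico N M
    · rw [Finset.sum_eq_single_of_mem l h fun p _ hp => HahnSeries.coeff_single_of_ne hp.symm,
        HahnSeries.coeff_single_same, sub_self]
    · rw [Finset.sum_eq_zero fun p hp =>
          HahnSeries.coeff_single_of_ne (by rintro rfl; exact h hp),
        hf l (by rw [Finset.mem_Ico] at h; omega), sub_zero]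
  have h1 := iterate_dop_add R (f - ∑ p ∈ Finset.Ico N M, HahnSeries.single p (f.coeff p))
    (∑ p ∈ Finset.Ico N M, HahnSeries.single p (f.coeff p)) n
  rw [sub_add_cancel] at h1
  rw [h1, HahnSeries.coeff_add, (hR.iterate_dop htail n) m (by omega), zero_add, iterate_dop_sum,
    HahnSeries.coeff_sum]
  exact Finset.sum_congr rfl fun p _ => iterate_dop_single _ _ _ _ _

theorem zdop_mul {R ρ Θ : HahnSeries ℤ Q} (h : euler Θ + R * Θ = Θ * ρ) (f : HahnSeries ℤ Q) :
    zdop R (Θ * f) = Θ * zdop ρ f := by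
  rw [zdop, euler_mul, ← mul_assoc, add_right_comm, ← add_mul, h, zdop, mul_add, mul_assoc,
    add_comm]

/-- The hypothesis is the gauge relation (z∂_z + R) ∘ Θ = Θ ∘ (z∂_z + ρ); the central factor z⁻¹
passes through. -/
theorem dop_mul {R ρ Θ : HahnSeries ℤ Q} (h : euler Θ + R * Θ = Θ * ρ) (f : HahnSeries ℤ Q) :
    dop R (Θ * f) = Θ * dop ρ f := by
  rw [dop, zdop_mul h, dop, ← mul_assoc, single_one_mul_comm, mul_assoc]

theorem iterate_dop_mul {R ρ Θ : HahnSeries ℤ Q} (h : euler Θ + R * Θ = Θ * ρ)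
    (f : HahnSeries ℤ Q) (n : ℕ) : (dop R)^[n] (Θ * f) = Θ * (dop ρ)^[n] f := by
  induction n with
  | zero => rfl
  | succ n ih => rw [Function.iterate_succ_apply', ih, dop_mul h,
      ← Function.iterate_succ_apply' (dop ρ)]

theorem zdop_single_mul (R g : HahnSeries ℤ Q) (p : ℤ) :
    zdop R (HahnSeries.single p 1 * g) = HahnSeries.single p 1 * (zdop R g + (p : ℂ) • g) := by
  have h : HahnSeries.single p ((p : ℂ) • (1 : Q)) * g =
      HahnSeries.single p 1 * ((p : ℂ) • g) := by
    ext m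
    simp [HahnSeries.coeff_single_mul]
  rw [zdop, euler_mul, euler_single, h, ← mul_assoc R, ← single_one_mul_comm, zdop, mul_add,
    mul_add, mul_assoc]
  abel

/-- The operator ∂_z + z⁻¹R equals z⁻¹(z∂_z + R), and z∂_z + R commutes with itself and lowers z⁻¹
by one degree. So each factor contributes -1 to the commutator. -/
theorem zdop_iterate_dop (R f : HahnSeries ℤ Q) (n : ℕ) :
    zdop R ((dop R)^[n] f) = (dop R)^[n] (zdop R f) - (n : ℂ) • (dop R)^[n] f := by
  have h1 : ∀ g : HahnSeries ℤ Q, zdop R (dop R g) = dop R (zdop R g) - dop R g := by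
    intro g
    rw [dop, zdop_single_mul, dop, ← mul_sub, Int.cast_neg, Int.cast_one, neg_smul, one_smul,
      sub_eq_add_neg]
  induction n with
  | zero => simp
  | succ n ih =>
    rw [Function.iterate_succ_apply', h1, ih, sub_eq_add_neg ((dop R)^[n] _), dop_add,
      ← Function.iterate_succ_apply' (dop R)]
    have h2 : dop R (-((n : ℂ) • (dop R)^[n] f)) = -((n : ℂ) • dop R ((dop R)^[n] f)) := by
      ext m
      simp only [coeff_dop, HahnSeries.coeff_neg, HahnSeries.coeff_smul, mul_neg, mul_smul_comm,
        smul_add, smul_neg, neg_add]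
      rw [smul_comm]
    rw [h2]
    push_cast
    rw [add_smul, one_smul]
    abel

/-! ### Adjoints -/

/-- The series `∑ (-z)^m T_m*`, for an additive map `T ↦ T*`. -/
def dagger (adj : Q →ₗ[ℂ] Q) (f : HahnSeries ℤ Q) : HahnSeries ℤ Q where
  coeff m := (-1 : ℂ) ^ m • adj (f.coeff m)
  isPWO_support' := f.isPWO_support.mono fun m hm h => hm (by
    simp only; rw [h, map_zero, smul_zero])

variable {adj : Q →ₗ[ℂ] Q}

@[simp] theorem coeff_dagger (f : HahnSeries ℤ Q) (m : ℤ) :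
    (dagger adj f).coeff m = (-1 : ℂ) ^ m • adj (f.coeff m) := rfl

theorem dagger_add (f g : HahnSeries ℤ Q) :
    dagger adj (f + g) = dagger adj f + dagger adj g := by
  ext m; simp

theorem dagger_sub (f g : HahnSeries ℤ Q) :
    dagger adj (f - g) = dagger adj f - dagger adj g := by
  ext m; simp [smul_sub]

theorem dagger_mul (hadj : ∀ a b, adj (a * b) = adj b * adj a) (f g : HahnSeries ℤ Q) :
    dagger adj (f * g) = dagger adj g * dagger adj f := by
  ext m
  rw [coeff_dagger, coeff_mul_eq_finsum, coeff_mul_eq_finsum,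
    map_finsum adj (finite_support_coeff_mul _ _ _), smul_finsum,
    ← finsum_comp_equiv (Equiv.subLeft m)]
  refine finsum_congr fun i => ?_
  rw [Equiv.subLeft_apply, sub_sub_cancel, hadj, coeff_dagger, coeff_dagger, smul_mul_smul_comm,
    ← zpow_add₀ (by norm_num), add_sub_cancel]

theorem dagger_euler (f : HahnSeries ℤ Q) : dagger adj (euler f) = euler (dagger adj f) := by
  ext m
  simp only [coeff_dagger, coeff_euler, map_smul]
  rw [smul_comm]

theorem dagger_dagger (hadj : ∀ a, adj (adj a) = a) (f : HahnSeries ℤ Q) :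
    dagger adj (dagger adj f) = f := by
  ext m
  simp only [coeff_dagger, map_smul, hadj, smul_smul]
  rw [← mul_zpow]
  simp

theorem dagger_single (p : ℤ) (q : Q) :
    dagger adj (HahnSeries.single p q) = HahnSeries.single p ((-1 : ℂ) ^ p • adj q) := by
  ext m
  rw [coeff_dagger, HahnSeries.coeff_single, HahnSeries.coeff_single]
  split_ifs with h
  · rw [h]
  · simp

/-- The operator `∂_z + z⁻¹ R(z)` is symmetric for the pairing `Res z f†(z) g(z)` when
`R† = 1 - R`. -/
theorem coeff_dagger_mul_dop (hadj : ∀ a b, adj (a * b) = adj b * adj a) (hone : adj 1 = 1)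
    {R : HahnSeries ℤ Q} (hR : dagger adj R = 1 - R) (f g : HahnSeries ℤ Q) :
    (dagger adj f * dop R g).coeff (-2) = (dagger adj (dop R f) * g).coeff (-2) := by
  have h1 : dagger adj (dop R f) = HahnSeries.single (-1) 1 *
      -(euler (dagger adj f) + dagger adj f - dagger adj f * R) := by
    rw [dop, dagger_mul hadj, dagger_single, hone, zdop, dagger_add, dagger_euler,
      dagger_mul hadj, hR, mul_sub, mul_one]
    have : HahnSeries.single (-1 : ℤ) ((-1 : ℂ) ^ (-1 : ℤ) • (1 : Q)) =
        -HahnSeries.single (-1 : ℤ) (1 : Q) := by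
      rw [← HahnSeries.single_neg]; norm_num
    rw [this, mul_neg, mul_neg, single_one_mul_comm, add_sub_assoc]
  -- With P = f†g the difference is z⁻¹∂_z(zP), whose z^{-2} coefficient is the residue of a
  -- derivative.
  have h2 : dagger adj f * dop R g - dagger adj (dop R f) * g =
      HahnSeries.single (-1) 1 * (euler (dagger adj f * g) + dagger adj f * g) := by
    rw [h1, dop, zdop, ← mul_assoc, ← single_one_mul_comm, mul_assoc, mul_assoc, ← mul_sub,
      euler_mul]
    congr 1
    noncomm_ring
  rw [← sub_eq_zero, ← HahnSeries.coeff_sub, h2, HahnSeries.coeff_single_mul, one_mul]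
  norm_num

theorem coeff_dagger_mul_iterate_dop (hadj : ∀ a b, adj (a * b) = adj b * adj a)
    (hone : adj 1 = 1) {R : HahnSeries ℤ Q} (hR : dagger adj R = 1 - R)
    (f g : HahnSeries ℤ Q) (n : ℕ) :
    (dagger adj f * (dop R)^[n] g).coeff (-2) = (dagger adj ((dop R)^[n] f) * g).coeff (-2) := by
  induction n generalizing f with
  | zero => rfl
  | succ n ih => rw [Function.iterate_succ_apply', coeff_dagger_mul_dop hadj hone hR, ih,
      ← Function.iterate_succ_apply]

end Laurent

end

section

/-! ### The trace in genus one -/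

section Trace

variable {Q : Type*} [Ring Q] [Algebra ℂ Q]

theorem coeff_mul_eq_sum {N m : ℤ} {s : ℕ} {f g : HahnSeries ℤ Q} (hf : LowerBound 0 f)
    (hg : LowerBound N g) (hs : m < N + s) :
    (f * g).coeff m = ∑ j ∈ Finset.range s, f.coeff (j : ℤ) * g.coeff (m - j) := by
  rw [coeff_mul_eq_finsum, finsum_eq_sum_of_support_subset
    (s := (Finset.range s).map Nat.castEmbedding), Finset.sum_map]
  · rfl
  · intro i hi
    have h1 : 0 ≤ i := by
      by_contra h; exact hi (by simp only; rw [hf i (by omega), zero_mul])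
    have h2 : N ≤ m - i := by
      by_contra h; exact hi (by simp only; rw [hg _ (by omega), mul_zero])
    rw [Finset.coe_map]
    refine ⟨i.toNat, ?_, ?_⟩
    · rw [Finset.mem_coe, Finset.mem_range]; omega
    · simp [h1]

theorem coeff_ofPowerSeries_mk (θ : ℕ → Q) (n : ℕ) :
    (HahnSeries.ofPowerSeries ℤ Q (PowerSeries.mk θ)).coeff (n : ℤ) = θ n := by
  simp

theorem euler_ofPowerSeries (θ : ℕ → Q) :
    euler (HahnSeries.ofPowerSeries ℤ Q (PowerSeries.mk θ)) =
      HahnSeries.ofPowerSeries ℤ Q (PowerSeries.mk fun m => m • θ m) := by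
  ext m
  rw [coeff_euler, coeff_ofPowerSeries, coeff_ofPowerSeries]
  split_ifs with h
  · obtain ⟨n, rfl⟩ := Int.eq_ofNat_of_zero_le h
    simp [Nat.cast_smul_eq_nsmul]
  · simp

theorem sum_range_sum_Ico {M : Type*} [AddCommMonoid M] (n : ℕ) (f : ℕ → ℕ → ℕ → M) :
    ∑ p ∈ Finset.range n, ∑ q ∈ Finset.Ico p n, f (q - p) p q =
      ∑ q ∈ Finset.range n, ∑ a ∈ Finset.HasAntidiagonal.antidiagonal q, f a.1 a.2 q := by
  rw [Finset.sum_comm' (t' := Finset.range n) (s' := fun q => Finset.range (q + 1))]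
  · refine Finset.sum_congr rfl fun q _ => ?_
    rw [← Finset.Nat.sum_antidiagonal_swap, Finset.Nat.sum_antidiagonal_eq_sum_range_succ_mk]
    rfl
  · intro p q
    simp only [Finset.mem_range, Finset.mem_Ico]
    omega

/-! ### The kernel (1 - Θ(x)Θ(y)⁻¹)/(x - y) and its differential equation -/

section

variable {θ φ R : ℕ → Q} {N U : Q}

/-- The gauge equation multiplied by Θ⁻¹ on both sides; the derivative of Θ is moved to Θ⁻¹ by
applying z∂_z to ΘΘ⁻¹ = 1. -/
theorem mk_inv_mul_mk (hR : PowerSeries.mk R * PowerSeries.mk θ =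
      PowerSeries.mk θ * (PowerSeries.C N + PowerSeries.X * PowerSeries.C U) -
        PowerSeries.mk fun m => m • θ m)
    (hθφ : PowerSeries.mk θ * PowerSeries.mk φ = 1)
    (hφθ : PowerSeries.mk φ * PowerSeries.mk θ = 1) :
    PowerSeries.mk φ * PowerSeries.mk R =
      (PowerSeries.C N + PowerSeries.X * PowerSeries.C U) * PowerSeries.mk φ +
        PowerSeries.mk fun m => m • φ m := by
  have h1 : PowerSeries.mk (fun m => m • θ m) * PowerSeries.mk φ =
      -(PowerSeries.mk θ * PowerSeries.mk fun m => m • φ m) := by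
    apply HahnSeries.ofPowerSeries_injective (Γ := ℤ)
    have h2 := euler_mul (HahnSeries.ofPowerSeries ℤ Q (PowerSeries.mk θ))
      (HahnSeries.ofPowerSeries ℤ Q (PowerSeries.mk φ))
    rw [← map_mul, hθφ, map_one, euler_one, euler_ofPowerSeries, euler_ofPowerSeries,
      ← map_mul, ← map_mul] at h2
    rw [map_neg]
    exact eq_neg_of_add_eq_zero_left h2.symm
  have h3 := congrArg (fun P => PowerSeries.mk φ * P * PowerSeries.mk φ) hR
  simp only [mul_sub, sub_mul] at h3
  rw [mul_assoc (PowerSeries.mk φ) (PowerSeries.mk fun m => m • θ m), h1, mul_neg,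
    ← mul_assoc (PowerSeries.mk φ) (PowerSeries.mk θ) (PowerSeries.mk _), hφθ, one_mul,
    ← mul_assoc (PowerSeries.mk φ) (PowerSeries.mk θ), hφθ, one_mul, mul_assoc, mul_assoc, hθφ,
    mul_one, sub_neg_eq_add] at h3
  exact h3

/-- The coefficients of `(1 - Θ(x) Θ(y)⁻¹) / (x - y)`. -/
def bezout (θ φ : ℕ → Q) (p i : ℕ) : Q :=
  -∑ a ∈ Finset.HasAntidiagonal.antidiagonal i, θ (a.1 + p + 1) * φ a.2

/-- Coefficient form of multiplying the kernel by x - y. -/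
theorem bezout_succ (p i : ℕ) :
    bezout θ φ p (i + 1) = bezout θ φ (p + 1) i - θ (p + 1) * φ (i + 1) := by
  rw [bezout, Finset.Nat.sum_antidiagonal_succ, bezout, neg_add, zero_add, add_comm,
    ← sub_eq_add_neg]
  simp only [add_comm, add_left_comm]

theorem bezout_zero_right (hφ : φ 0 = 1) (p : ℕ) : bezout θ φ p 0 = -θ (p + 1) := by
  simp [bezout, hφ]

theorem bezout_zero_left (hθ : θ 0 = 1) (hθφ : PowerSeries.mk θ * PowerSeries.mk φ = 1) (i : ℕ) :
    bezout θ φ 0 i = φ (i + 1) := by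
  have h := congrArg (PowerSeries.coeff (i + 1)) hθφ
  rw [PowerSeries.coeff_mul, Finset.Nat.sum_antidiagonal_succ, PowerSeries.coeff_one,
    if_neg (Nat.succ_ne_zero i)] at h
  simp only [PowerSeries.coeff_mk, hθ, one_mul] at h
  rw [bezout, eq_neg_of_add_eq_zero_left h]

/-- Let V be the kernel and L the operator x∂_x + y∂_y + R(x)· - ·R(y). The gauge equations for Θ(x)
and Θ(y)⁻¹ give L(1 - Θ(x)Θ(y)⁻¹) = R(x) - R(y) - (x - y)Θ(x)UΘ(y)⁻¹. Since L((x - y)V) = (x - y)(LV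
+ V), dividing by x - y gives the identity. Division is replaced here by induction on i along
`bezout_succ`. -/
theorem bezout_identity (hθ : θ 0 = 1) (hφ : φ 0 = 1)
    (hR : PowerSeries.mk R * PowerSeries.mk θ =
      PowerSeries.mk θ * (PowerSeries.C N + PowerSeries.X * PowerSeries.C U) -
        PowerSeries.mk fun m => m • θ m)
    (hθφ : PowerSeries.mk θ * PowerSeries.mk φ = 1)
    (hφθ : PowerSeries.mk φ * PowerSeries.mk θ = 1) (p i : ℕ) :
    (1 + i + p) • bezout θ φ p i +
        ∑ a ∈ Finset.HasAntidiagonal.antidiagonal p, R a.1 * bezout θ φ a.2 i -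
        ∑ a ∈ Finset.HasAntidiagonal.antidiagonal i, bezout θ φ p a.2 * R a.1 =
      R (p + i + 1) - θ p * U * φ i := by
  have e1 : ∀ q, ∑ a ∈ Finset.HasAntidiagonal.antidiagonal (q + 1), R a.1 * θ a.2 =
      θ (q + 1) * N + θ q * U - (q + 1) • θ (q + 1) := by
    intro q
    have h := congrArg (PowerSeries.coeff (q + 1)) hR
    rw [PowerSeries.coeff_mul] at h
    simpa [mul_add, ← mul_assoc, PowerSeries.coeff_succ_mul_X] using h
  have e2 : ∀ q, ∑ a ∈ Finset.HasAntidiagonal.antidiagonal (q + 1), φ a.1 * R a.2 =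
      N * φ (q + 1) + U * φ q + (q + 1) • φ (q + 1) := by
    intro q
    have h := congrArg (PowerSeries.coeff (q + 1)) (mk_inv_mul_mk hR hθφ hφθ)
    rw [PowerSeries.coeff_mul] at h
    simpa [add_mul, mul_assoc, PowerSeries.coeff_succ_X_mul] using h
  have e3 : R 0 = N := by
    have h := congrArg (PowerSeries.coeff 0) hR
    simpa [PowerSeries.coeff_mul, hθ] using h
  induction i generalizing p with
  | zero =>
    simp only [bezout_zero_right hφ, Finset.Nat.antidiagonal_zero, Finset.sum_singleton, e3, hφ,
      mul_one, add_zero]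
    have h := e1 p
    rw [Finset.Nat.sum_antidiagonal_succ'] at h
    simp only [hθ, mul_one] at h
    simp only [mul_neg, Finset.sum_neg_distrib]
    rw [eq_sub_of_add_eq' h, neg_mul, smul_neg, add_comm 1 p]
    abel
  | succ i ih =>
    have h1 := ih (p + 1)
    rw [Finset.Nat.sum_antidiagonal_succ'] at h1
    simp only [bezout_zero_left hθ hθφ] at h1
    rw [Finset.Nat.sum_antidiagonal_succ' (n := i)]
    simp only [bezout_succ, mul_sub, sub_mul, Finset.sum_sub_distrib, bezout_zero_right hφ]
    have h2 := e1 p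
    rw [Finset.Nat.sum_antidiagonal_succ'] at h2
    simp only [hθ, mul_one] at h2
    have h3 := e2 i
    rw [← Finset.Nat.sum_antidiagonal_swap, Finset.Nat.sum_antidiagonal_succ'] at h3
    simp only [Prod.fst_swap, Prod.snd_swap, hφ, one_mul] at h3
    have h4 : ∑ a ∈ Finset.HasAntidiagonal.antidiagonal p, R a.1 * (θ (a.2 + 1) * φ (i + 1)) =
        (θ (p + 1) * N + θ p * U - (p + 1) • θ (p + 1) - R (p + 1)) * φ (i + 1) := by
      rw [← eq_sub_of_add_eq' h2, Finset.sum_mul]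
      simp only [mul_assoc]
    have h5 : ∑ a ∈ Finset.HasAntidiagonal.antidiagonal i, θ (p + 1) * φ (a.2 + 1) * R a.1 =
        θ (p + 1) * (N * φ (i + 1) + U * φ i + (i + 1) • φ (i + 1) - R (i + 1)) := by
      rw [← eq_sub_of_add_eq' h3, Finset.mul_sum]
      simp only [mul_assoc]
    rw [h4, h5, smul_sub, show 1 + (i + 1) + p = 1 + i + (p + 1) by ring,
      show p + (i + 1) + 1 = p + 1 + i + 1 by ring, ← sub_eq_zero]
    rw [← sub_eq_zero] at h1
    rw [← h1]
    simp only [add_smul, one_smul, mul_add, add_mul, mul_sub, sub_mul, neg_mul, smul_mul_assoc,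
      mul_smul_comm, mul_assoc]
    abel

end

end Trace

end

/-! ### Coefficients of iterates of ∂_z + z⁻¹R(z) on monomials -/

section

section Trace

variable {Q : Type*} [Ring Q] [Algebra ℂ Q]

section

variable {θ φ R : ℕ → Q} {N U : Q}

/-- The coefficient of `z^m` in `(∂_z + z⁻¹ R(z))^n z^p`. -/
def monoCoeff (R : HahnSeries ℤ Q) (n : ℕ) (p m : ℤ) : Q :=
  ((dop R)^[n] (HahnSeries.single p 1)).coeff m

theorem monoCoeff_of_lt {R : HahnSeries ℤ Q} (hR : LowerBound 0 R) {n : ℕ} {p m : ℤ}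
    (h : m < p - n) : monoCoeff R n p m = 0 :=
  hR.iterate_dop (lowerBound_single p 1) n m h

/-- This is `zdop_iterate_dop` applied to z^p, read off at z^{-2-i}. Cutting the sums at n loses
nothing, since the coefficient for exponents q and -2 - j vanishes once q + j + 2 > n. -/
theorem monoCoeff_commutator (R : ℕ → Q) {n p i : ℕ} (hp : p < n) (hi : i < n) :
    ((n : ℂ) - 1) • monoCoeff (HahnSeries.ofPowerSeries ℤ Q (PowerSeries.mk R)) n p (-2 - i) =
      (1 + i + p) • monoCoeff (HahnSeries.ofPowerSeries ℤ Q (PowerSeries.mk R)) n p (-2 - i) +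
      ∑ q ∈ Finset.Ico p n,
        monoCoeff (HahnSeries.ofPowerSeries ℤ Q (PowerSeries.mk R)) n q (-2 - i) * R (q - p) -
      ∑ j ∈ Finset.Ico i n,
        R (j - i) * monoCoeff (HahnSeries.ofPowerSeries ℤ Q (PowerSeries.mk R)) n p (-2 - j) := by
  set H := HahnSeries.ofPowerSeries ℤ Q (PowerSeries.mk R) with hH
  have hL : LowerBound 0 H := lowerBound_ofPowerSeries _
  have h := congrArg (fun f => f.coeff (-2 - (i : ℤ)))
    (zdop_iterate_dop H (HahnSeries.single (p : ℤ) 1) n)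
  simp only [HahnSeries.coeff_sub, HahnSeries.coeff_smul] at h
  have hz : LowerBound (p : ℤ) (zdop H (HahnSeries.single (p : ℤ) 1)) := by
    intro m hm
    rw [zdop, HahnSeries.coeff_add, coeff_euler, lowerBound_single _ _ m hm,
      (hL.mul (lowerBound_single _ _)) m (by omega), smul_zero, add_zero]
  rw [coeff_iterate_dop (M := n) hL hz n (by omega), zdop, HahnSeries.coeff_add, coeff_euler,
    coeff_mul_eq_sum (s := n - i) hL (hL.iterate_dop (lowerBound_single _ _) n)
      (by omega)] at h
  have h1 : ∑ q ∈ Finset.Ico (p : ℤ) n, ((dop H)^[n] (HahnSeries.single q 1)).coeff (-2 - i) *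
      (zdop H (HahnSeries.single (p : ℤ) 1)).coeff q =
      p • monoCoeff H n p (-2 - i) +
        ∑ q ∈ Finset.Ico p n, monoCoeff H n q (-2 - i) * R (q - p) := by
    have hmap : Finset.Ico (p : ℤ) n = (Finset.Ico p n).map Nat.castEmbedding := by
      ext x
      simp only [Finset.mem_Ico, Finset.mem_map, Nat.castEmbedding_apply]
      constructor
      · intro hx; exact ⟨x.toNat, by omega, by omega⟩
      · rintro ⟨y, hy, rfl⟩; omega
    rw [hmap, Finset.sum_map]
    have hq : ∀ q ∈ Finset.Ico p n, (zdop H (HahnSeries.single (p : ℤ) 1)).coeff (q : ℤ) =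
        (if q = p then (p : Q) else 0) + R (q - p) := by
      intro q hq
      rw [Finset.mem_Ico] at hq
      rw [zdop, HahnSeries.coeff_add, coeff_euler, HahnSeries.coeff_mul_single, mul_one,
        show (q : ℤ) - p = ((q - p : ℕ) : ℤ) by omega, hH, coeff_ofPowerSeries_mk,
        HahnSeries.coeff_single]
      congr 1
      by_cases e : q = p
      · simp [e, Algebra.smul_def]
      · simp [e]
    rw [Finset.sum_congr rfl fun q hq' => by rw [Nat.castEmbedding_apply, hq q hq', mul_add],
      Finset.sum_add_distrib]
    congr 1
    rw [Finset.sum_eq_single_of_mem p (Finset.mem_Ico.mpr ⟨le_rfl, hp⟩)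
      fun q _ hq => by rw [if_neg hq, mul_zero], if_pos rfl, nsmul_eq_mul, Nat.cast_comm]
    rfl
  have h2 : ∑ j ∈ Finset.range (n - i), H.coeff (j : ℤ) *
      ((dop H)^[n] (HahnSeries.single (p : ℤ) 1)).coeff (-2 - (i : ℤ) - j) =
      ∑ j ∈ Finset.Ico i n, R (j - i) * monoCoeff H n p (-2 - j) := by
    rw [Finset.sum_Ico_eq_sum_range]
    refine Finset.sum_congr rfl fun j _ => ?_
    rw [hH, coeff_ofPowerSeries_mk, add_tsub_cancel_left, ← hH, monoCoeff]
    push_cast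
    rw [sub_sub]
  rw [h1, h2] at h
  change ((-2 - (i : ℤ) : ℤ) : ℂ) • monoCoeff H n p (-2 - i) + _ =
    _ - (n : ℂ) • monoCoeff H n p (-2 - i) at h
  rw [eq_sub_iff_add_eq] at h
  rw [eq_sub_iff_add_eq, ← Nat.cast_smul_eq_nsmul ℂ]
  rw [← Nat.cast_smul_eq_nsmul ℂ] at h
  push_cast at h ⊢
  have h3 : (1 + (i : ℂ) + p) • monoCoeff H n p (-2 - i) =
    (p : ℂ) • monoCoeff H n p (-2 - i) + (1 + (i : ℂ)) • monoCoeff H n p (-2 - i) := by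
    rw [← add_smul]; ring_nf
  rw [h3, add_right_comm, ← h]
  module

/-- The hypothesis says that ad S + z∂_z annihilates R. For this grading ∂_z + z⁻¹R has degree -1
and z^p has degree p, so the n-th iterate has degree p - n. -/
theorem weight_iterate_dop {R : HahnSeries ℤ Q} {S : Q}
    (hS : HahnSeries.single 0 S * R - R * HahnSeries.single 0 S = -euler R) (n : ℕ) (p : ℤ) :
    HahnSeries.single 0 S * (dop R)^[n] (HahnSeries.single p 1) -
      (dop R)^[n] (HahnSeries.single p 1) * HahnSeries.single 0 S =
      ((p : ℂ) - n) • (dop R)^[n] (HahnSeries.single p 1) -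
        euler ((dop R)^[n] (HahnSeries.single p 1)) := by
  induction n with
  | zero =>
    ext m
    simp only [Function.iterate_zero, id, HahnSeries.coeff_sub, HahnSeries.coeff_single_zero_mul,
      HahnSeries.coeff_mul_single_zero, HahnSeries.coeff_smul, coeff_euler,
      HahnSeries.coeff_single]
    split_ifs with h
    · simp [h]
    · simp
  | succ n ih =>
    rw [Function.iterate_succ_apply']
    set G := (dop R)^[n] (HahnSeries.single p 1)
    have e1 : HahnSeries.single 0 S * euler G - euler G * HahnSeries.single 0 S =
        euler (((p : ℂ) - n) • G - euler G) := by
      rw [← ih, euler_sub, euler_mul, euler_mul, euler_single]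
      simp
    have e2 : HahnSeries.single 0 S * (R * G) - (R * G) * HahnSeries.single 0 S =
        ((p : ℂ) - n) • (R * G) - euler (R * G) := by
      have : HahnSeries.single 0 S * (R * G) - (R * G) * HahnSeries.single 0 S =
        (HahnSeries.single 0 S * R - R * HahnSeries.single 0 S) * G +
          R * (HahnSeries.single 0 S * G - G * HahnSeries.single 0 S) := by noncomm_ring
      rw [this, hS, ih, euler_mul, mul_sub, neg_mul]
      have e3 : R * (((p : ℂ) - n) • G) = ((p : ℂ) - n) • (R * G) := by
        ext m
        rw [HahnSeries.coeff_smul, coeff_mul_eq_finsum, coeff_mul_eq_finsum,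
          smul_finsum' _ (finite_support_coeff_mul _ _ _)]
        simp only [HahnSeries.coeff_smul, mul_smul_comm]
      rw [e3]
      abel
    have e4 : HahnSeries.single 0 S * zdop R G - zdop R G * HahnSeries.single 0 S =
        ((p : ℂ) - n) • zdop R G - euler (zdop R G) := by
      rw [zdop, mul_add, add_mul, add_sub_add_comm, e1, e2, euler_add, euler_sub, smul_add]
      have e5 : euler (((p : ℂ) - n) • G) = ((p : ℂ) - n) • euler G := by
        ext m; simp only [coeff_euler, HahnSeries.coeff_smul]; rw [smul_comm]
      rw [e5]
      abel
    have e6 := congrArg (fun f => HahnSeries.single (-1) 1 * f) e4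
    simp only [mul_sub] at e6
    rw [← mul_assoc, single_one_mul_comm (-1) (HahnSeries.single 0 S), mul_assoc, ← mul_assoc _ (zdop R G)] at e6
    change HahnSeries.single 0 S * dop R G - dop R G * _ = _ at e6
    rw [e6]
    ext m
    simp only [HahnSeries.coeff_sub, HahnSeries.coeff_single_mul, one_mul, HahnSeries.coeff_smul,
      coeff_euler, dop]
    push_cast
    module

/-- By the gauge relation the n-th iterate on 1 for ρ is Θ⁻¹ times the n-th iterate on Θ for R; both
factors are expanded in monomials. Exponents i, p ≥ n cannot contribute to z^{-2}. -/
theorem coeff_inv_iterate_dop {ρ R Θ Φ : HahnSeries ℤ Q} (hR : LowerBound 0 R)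
    (hΘ : LowerBound 0 Θ) (hΦ : LowerBound 0 Φ) (h : euler Θ + R * Θ = Θ * ρ)
    (hΦΘ : Φ * Θ = 1) (n : ℕ) :
    ((dop ρ)^[n] 1).coeff (-2) = ∑ i ∈ Finset.range n, ∑ p ∈ Finset.range n,
      Φ.coeff (i : ℤ) * (monoCoeff R n p (-2 - i) * Θ.coeff (p : ℤ)) := by
  have h1 : (dop ρ)^[n] 1 = Φ * (dop R)^[n] Θ := by
    have := iterate_dop_mul h 1 n
    rw [mul_one] at this
    rw [this, ← mul_assoc, hΦΘ, one_mul]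
  rw [h1, coeff_mul_eq_sum (s := n) hΦ (hR.iterate_dop hΘ n) (by omega)]
  refine Finset.sum_congr rfl fun i _ => ?_
  rw [← Finset.mul_sum, coeff_iterate_dop (M := n) hR hΘ n (by omega)]
  congr 1
  have hmap : Finset.Ico (0 : ℤ) n = (Finset.range n).map Nat.castEmbedding := by
    ext x
    simp only [Finset.mem_Ico, Finset.mem_map, Nat.castEmbedding_apply, Finset.mem_range]
    constructor
    · intro hx; exact ⟨x.toNat, by omega, by omega⟩
    · rintro ⟨y, hy, rfl⟩; omega
  rw [hmap, Finset.sum_map]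
  rfl

end

end Trace

end

/-! ### The z^{-2} coefficient of (∂_z + z⁻¹N + U)^n 1 and its trace -/

section

section Trace

variable {Q : Type*} [Ring Q] [Algebra ℂ Q]

section

variable {N U : Q}

theorem coeff_dop_polynomial (N U : Q) (f : HahnSeries ℤ Q) (m : ℤ) :
    (dop (HahnSeries.single 0 N + HahnSeries.single 1 U) f).coeff m =
      ((m : ℂ) + 1) • f.coeff (m + 1) + N * f.coeff (m + 1) + U * f.coeff m := by
  rw [coeff_dop, add_mul, HahnSeries.coeff_add, HahnSeries.coeff_single_mul,
    HahnSeries.coeff_single_mul, sub_zero, add_sub_cancel_right, add_assoc]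

theorem coeff_iterate_dop_one_pos (N U : Q) (n : ℕ) (m : ℤ) (hm : 0 < m) :
    ((dop (HahnSeries.single 0 N + HahnSeries.single 1 U))^[n] 1).coeff m = 0 := by
  induction n generalizing m with
  | zero => simp [HahnSeries.coeff_one, hm.ne']
  | succ n ih =>
    rw [Function.iterate_succ_apply', coeff_dop_polynomial, ih m hm, ih (m + 1) (by omega)]
    simp

theorem coeff_iterate_dop_one_zero (N U : Q) (n : ℕ) :
    ((dop (HahnSeries.single 0 N + HahnSeries.single 1 U))^[n] 1).coeff 0 = U ^ n := by
  induction n with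
  | zero => simp
  | succ n ih =>
    rw [Function.iterate_succ_apply', coeff_dop_polynomial, ih,
      coeff_iterate_dop_one_pos _ _ _ _ (by norm_num), smul_zero, mul_zero, zero_add, zero_add,
      pow_succ']

theorem coeff_iterate_dop_one_neg_one (N U : Q) (n : ℕ) :
    ((dop (HahnSeries.single 0 N + HahnSeries.single 1 U))^[n] 1).coeff (-1) =
      ∑ a ∈ Finset.range n, U ^ a * N * U ^ (n - 1 - a) := by
  induction n with
  | zero => simp [HahnSeries.coeff_one]
  | succ n ih =>
    rw [Function.iterate_succ_apply', coeff_dop_polynomial, ih, neg_add_cancel,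
      coeff_iterate_dop_one_zero, Finset.sum_range_succ', Finset.mul_sum, add_comm]
    congr 1
    · refine Finset.sum_congr rfl fun a _ => ?_
      rw [pow_succ', show n + 1 - 1 - (a + 1) = n - 1 - a by omega]
      simp only [mul_assoc]
    · simp

/-- At z^{-2} the derivative ∂_z contributes the factor -1, which replaces N by N - 1. -/
theorem coeff_iterate_dop_one_succ (N U : Q) (n : ℕ) :
    ((dop (HahnSeries.single 0 N + HahnSeries.single 1 U))^[n + 1] 1).coeff (-2) =
      (N - 1) * ((dop (HahnSeries.single 0 N + HahnSeries.single 1 U))^[n] 1).coeff (-1) +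
      U * ((dop (HahnSeries.single 0 N + HahnSeries.single 1 U))^[n] 1).coeff (-2) := by
  rw [Function.iterate_succ_apply', coeff_dop_polynomial, sub_mul, one_mul]
  norm_num
  abel

variable {B : Type*} [AddCommGroup B] [Module ℂ B] {tr : Q →ₗ[ℂ] B}

/-- Unrolling the recursion moves one power of U at a time out of the iterate. The constraint n + j
= k + 1 keeps the total degree in U equal to k, and cyclicity of the trace collects the powers at
the end. -/
theorem trace_pow_mul_coeff_iterate_dop_one (htr : ∀ a b, tr (a * b) = tr (b * a)) (N U : Q)
    (k n j : ℕ) (h : n + j = k + 1) :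
    tr (U ^ (j + 1) * ((dop (HahnSeries.single 0 N + HahnSeries.single 1 U))^[n] 1).coeff (-2)) =
      ∑ q ∈ Finset.range n, ∑ a ∈ Finset.range q,
        tr ((N - 1) * U ^ a * N * U ^ (k - a)) := by
  induction n generalizing j with
  | zero => simp [HahnSeries.coeff_one]
  | succ n ih =>
    rw [coeff_iterate_dop_one_succ, mul_add, map_add, ← mul_assoc _ U, ← pow_succ,
      ih (j + 1) (by omega), Finset.sum_range_succ, add_comm, htr,
      coeff_iterate_dop_one_neg_one, Finset.mul_sum, Finset.sum_mul, map_sum]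
    congr 1
    refine Finset.sum_congr rfl fun a ha => ?_
    rw [Finset.mem_range] at ha
    congr 1
    simp only [mul_assoc, ← pow_add]
    rw [show n - 1 - a + (j + 1) = k - a by omega]

theorem sum_range_sum_range (g : ℕ → B) (K : ℕ) :
    ∑ q ∈ Finset.range K, ∑ a ∈ Finset.range q, g a =
      ∑ a ∈ Finset.range K, ((K : ℂ) - 1 - a) • g a := by
  induction K with
  | zero => simp
  | succ K ih =>
    rw [Finset.sum_range_succ, ih, Finset.sum_range_succ, ← Finset.sum_add_distrib]
    push_cast
    simp only [add_sub_cancel_right, sub_self, zero_smul, add_zero]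
    exact Finset.sum_congr rfl fun a _ => by module

/-- The index a occurs k - a times in the double sum; averaging with the reflected index k - a
replaces this multiplicity by k/2. -/
theorem two_smul_sum_range_sum_range (g : ℕ → B) (k : ℕ)
    (hg : ∀ a, a ≤ k → g (k - a) = g a) :
    (2 : ℂ) • ∑ q ∈ Finset.range (k + 1), ∑ a ∈ Finset.range q, g a =
      (k : ℂ) • ∑ a ∈ Finset.range (k + 1), g a := by
  have h1 : ∑ a ∈ Finset.range (k + 1), ((k : ℂ) - a) • g a =
      ∑ a ∈ Finset.range (k + 1), (a : ℂ) • g a := by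
    rw [← Finset.sum_range_reflect]
    refine Finset.sum_congr rfl fun a ha => ?_
    rw [Finset.mem_range] at ha
    rw [show k + 1 - 1 - a = k - a by omega, hg a (by omega), Nat.cast_sub (by omega)]
    congr 1
    ring
  rw [sum_range_sum_range, two_smul]
  push_cast
  simp only [add_sub_cancel_right]
  nth_rw 1 [h1]
  rw [← Finset.sum_add_distrib, Finset.smul_sum]
  exact Finset.sum_congr rfl fun a _ => by module

theorem two_smul_trace_mul_coeff_iterate_dop_one (htr : ∀ a b, tr (a * b) = tr (b * a))
    (N U : Q) (k : ℕ) :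
    (2 : ℂ) • tr (U *
        ((dop (HahnSeries.single 0 N + HahnSeries.single 1 U))^[k + 1] 1).coeff (-2)) =
      (k : ℂ) • ∑ a ∈ Finset.range (k + 1), tr ((N - 1) * U ^ a * N * U ^ (k - a)) := by
  have h := trace_pow_mul_coeff_iterate_dop_one htr N U k (k + 1) 0 (by omega)
  rw [zero_add, pow_one] at h
  rw [h]
  refine two_smul_sum_range_sum_range (fun a => tr ((N - 1) * U ^ a * N * U ^ (k - a))) k
    fun a ha => ?_
  -- The reflection symmetry is checked on the two parts of N - 1. The quadratic part is symmetric
  -- by cyclicity, and the linear part reduces to the trace of U^k N for every a.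
  simp only [sub_mul, one_mul, map_sub]
  congr 1
  · rw [Nat.sub_sub_self ha, mul_assoc, htr]
    simp only [mul_assoc]
  · rw [htr, htr (U ^ a * N), ← mul_assoc, ← mul_assoc, ← pow_add, ← pow_add,
      Nat.sub_sub_self ha, Nat.sub_add_cancel ha, Nat.add_sub_cancel' ha]

variable {θ φ R : ℕ → Q} {S : Q}

/-- The commutator identity for the iterates, transposed under the trace, becomes the left side of
`bezout_identity`, so k times the sum equals the sum against R_{p+i+1} - θ_p U φ_i. The factor k is
kept on both sides because for k = 0 the identity carries no information. -/
theorem trace_bezout (htr : ∀ a b, tr (a * b) = tr (b * a)) (hθ : θ 0 = 1) (hφ : φ 0 = 1)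
    (hR : PowerSeries.mk R * PowerSeries.mk θ =
      PowerSeries.mk θ * (PowerSeries.C N + PowerSeries.X * PowerSeries.C U) -
        PowerSeries.mk fun m => m • θ m)
    (hθφ : PowerSeries.mk θ * PowerSeries.mk φ = 1)
    (hφθ : PowerSeries.mk φ * PowerSeries.mk θ = 1)
    (hS : ∀ j, S * R j - R j * S = -((j : ℂ) • R j)) (k : ℕ) :
    (k : ℂ) • ∑ i ∈ Finset.range (k + 1), ∑ p ∈ Finset.range (k + 1),
        tr (monoCoeff (HahnSeries.ofPowerSeries ℤ Q (PowerSeries.mk R)) (k + 1) p (-2 - i) *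
          bezout θ φ p i) =
      (k : ℂ) • -((1 / 2 : ℂ) •
        ∑ a ∈ Finset.range (k + 1), tr ((N - 1) * U ^ a * N * U ^ (k - a))) := by
  set H := HahnSeries.ofPowerSeries ℤ Q (PowerSeries.mk R) with hH
  have hL : LowerBound 0 H := lowerBound_ofPowerSeries _
  rcases eq_or_ne k 0 with rfl | hk
  · simp
  set n := k + 1 with hn
  have hnk : (n : ℂ) - 1 = k := by rw [hn]; push_cast; ring
  have hSH : HahnSeries.single 0 S * H - H * HahnSeries.single 0 S = -euler H := by
    ext m
    rw [HahnSeries.coeff_sub, HahnSeries.coeff_single_zero_mul, HahnSeries.coeff_mul_single_zero,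
      HahnSeries.coeff_neg, coeff_euler]
    rcases lt_or_ge m 0 with h | h
    · rw [hL m h]; simp
    · obtain ⟨j, rfl⟩ := Int.eq_ofNat_of_zero_le h
      rw [hH, coeff_ofPowerSeries_mk, hS]
      simp
  -- The product has degree (p - n) + (2 + i) - (p + i + 1) = -k for ad S. A commutator is
  -- traceless, so k times its trace is zero.
  have hw : ∀ p i : ℕ, tr (monoCoeff H n p (-2 - i) * R (p + i + 1)) = 0 := by
    intro p i
    have h1 := congrArg (fun f => f.coeff (-2 - (i : ℤ))) (weight_iterate_dop hSH n p)
    simp only [HahnSeries.coeff_sub, HahnSeries.coeff_single_zero_mul,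
      HahnSeries.coeff_mul_single_zero, HahnSeries.coeff_smul, coeff_euler] at h1
    rw [← monoCoeff] at h1
    set D := monoCoeff H n p (-2 - i)
    have h2 : S * (D * R (p + i + 1)) - D * R (p + i + 1) * S =
        -((k : ℂ) • (D * R (p + i + 1))) := by
      have : S * (D * R (p + i + 1)) - D * R (p + i + 1) * S =
        (S * D - D * S) * R (p + i + 1) +
          D * (S * R (p + i + 1) - R (p + i + 1) * S) := by noncomm_ring
      rw [this, h1, hS, ← hnk, sub_mul, smul_mul_assoc, smul_mul_assoc, mul_neg, mul_smul_comm]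
      push_cast
      module
    have h3 := congrArg tr h2
    rw [map_sub, htr, sub_self, map_neg, map_smul, eq_comm, neg_eq_zero, smul_eq_zero] at h3
    exact h3.resolve_left (Nat.cast_ne_zero.mpr hk)
  have hZ := coeff_inv_iterate_dop (ρ := HahnSeries.single 0 N + HahnSeries.single 1 U) (R := H)
    (Θ := HahnSeries.ofPowerSeries ℤ Q (PowerSeries.mk θ))
    (Φ := HahnSeries.ofPowerSeries ℤ Q (PowerSeries.mk φ)) hL (lowerBound_ofPowerSeries _)
    (lowerBound_ofPowerSeries _) (by
      rw [euler_ofPowerSeries, hH, ← map_mul, hR, map_sub, add_sub_cancel, map_mul, map_add,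
        map_mul, HahnSeries.ofPowerSeries_C, HahnSeries.ofPowerSeries_C,
        HahnSeries.ofPowerSeries_X]
      congr 2
      rw [HahnSeries.C_apply, HahnSeries.single_mul_single, add_zero, one_mul])
    (by rw [← map_mul, hφθ, map_one]) n
  simp only [coeff_ofPowerSeries_mk] at hZ
  have key : (k : ℂ) • ∑ i ∈ Finset.range n, ∑ p ∈ Finset.range n,
        tr (monoCoeff H n p (-2 - i) * bezout θ φ p i) =
      ∑ i ∈ Finset.range n, ∑ p ∈ Finset.range n, tr (monoCoeff H n p (-2 - i) *
        (R (p + i + 1) - θ p * U * φ i)) := by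
    have hc : ∀ i ∈ Finset.range n, ∀ p ∈ Finset.range n,
        (k : ℂ) • tr (monoCoeff H n p (-2 - i) * bezout θ φ p i) =
        tr (monoCoeff H n p (-2 - i) * (1 + i + p) • bezout θ φ p i) +
        ∑ q ∈ Finset.Ico p n, tr (monoCoeff H n q (-2 - i) * (R (q - p) * bezout θ φ p i)) -
        ∑ j ∈ Finset.Ico i n, tr (monoCoeff H n p (-2 - j) * (bezout θ φ p i * R (j - i))) := by
      intro i hi p hp
      rw [Finset.mem_range] at hi hp
      rw [← map_smul, ← smul_mul_assoc, ← hnk, hH, monoCoeff_commutator R hp hi, ← hH, sub_mul,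
        add_mul, map_sub, map_add, Finset.sum_mul, Finset.sum_mul, map_sum, map_sum,
        smul_mul_assoc, mul_smul_comm]
      congr 1
      · congr 1
        exact Finset.sum_congr rfl fun q _ => by rw [mul_assoc]
      · exact Finset.sum_congr rfl fun q _ => by rw [mul_assoc, htr, mul_assoc]
    simp only [Finset.smul_sum]
    rw [Finset.sum_congr rfl fun i hi => Finset.sum_congr rfl (hc i hi)]
    simp only [Finset.sum_add_distrib, Finset.sum_sub_distrib]
    -- The triangular sums produced by the commutator are regrouped along antidiagonals, so that
    -- each coefficient multiplies exactly the terms of `bezout_identity`.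
    have s1 : ∀ i : ℕ, ∑ p ∈ Finset.range n, ∑ q ∈ Finset.Ico p n,
        tr (monoCoeff H n q (-2 - i) * (R (q - p) * bezout θ φ p i)) =
        ∑ q ∈ Finset.range n, tr (monoCoeff H n q (-2 - i) *
          ∑ a ∈ Finset.HasAntidiagonal.antidiagonal q, R a.1 * bezout θ φ a.2 i) := by
      intro i
      rw [sum_range_sum_Ico n fun x p q =>
        tr (monoCoeff H n q (-2 - i) * (R x * bezout θ φ p i))]
      simp only [Finset.mul_sum, map_sum]
    have s2 : ∑ i ∈ Finset.range n, ∑ p ∈ Finset.range n, ∑ j ∈ Finset.Ico i n,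
        tr (monoCoeff H n p (-2 - j) * (bezout θ φ p i * R (j - i))) =
        ∑ i ∈ Finset.range n, ∑ p ∈ Finset.range n, tr (monoCoeff H n p (-2 - i) *
          ∑ a ∈ Finset.HasAntidiagonal.antidiagonal i, bezout θ φ p a.2 * R a.1) := by
      rw [Finset.sum_comm, Finset.sum_comm (s := Finset.range n) (t := Finset.range n)
        (f := fun i p => tr (monoCoeff H n p (-2 - i) *
          ∑ a ∈ Finset.HasAntidiagonal.antidiagonal i, bezout θ φ p a.2 * R a.1))]
      refine Finset.sum_congr rfl fun p _ => ?_
      rw [sum_range_sum_Ico n fun x i j =>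
        tr (monoCoeff H n p (-2 - j) * (bezout θ φ p i * R x))]
      simp only [Finset.mul_sum, map_sum]
    simp only [s1]
    rw [s2, ← Finset.sum_add_distrib, ← Finset.sum_sub_distrib]
    refine Finset.sum_congr rfl fun i _ => ?_
    rw [← Finset.sum_add_distrib, ← Finset.sum_sub_distrib]
    refine Finset.sum_congr rfl fun p _ => ?_
    rw [← map_add, ← mul_add, ← map_sub, ← mul_sub, bezout_identity hθ hφ hR hθφ hφθ]
  rw [key]
  simp only [mul_sub, map_sub, hw, zero_sub, Finset.sum_neg_distrib]
  -- Cyclicity brings U to the front; what remains is the gauge expansion `hZ` of the iterate on 1.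
  have hs : ∑ i ∈ Finset.range n, ∑ p ∈ Finset.range n,
      tr (monoCoeff H n p (-2 - i) * (θ p * U * φ i)) =
      tr (U * ((dop (HahnSeries.single 0 N + HahnSeries.single 1 U))^[n] 1).coeff (-2)) := by
    rw [hZ]
    simp only [Finset.mul_sum, map_sum]
    refine Finset.sum_congr rfl fun i _ => Finset.sum_congr rfl fun p _ => ?_
    rw [← mul_assoc, ← mul_assoc, mul_assoc, htr]
    simp only [mul_assoc]
  rw [hs]
  have h2 := two_smul_trace_mul_coeff_iterate_dop_one htr N U k
  rw [← hn] at h2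
  rw [smul_neg, smul_comm, ← h2, smul_smul]
  norm_num

end

end Trace

end

section

variable {A : Type*} [Fintype A] [DecidableEq A]

/-! ### The conformal structure -/

namespace FrobeniusGerm

variable (F : FrobeniusGerm A)

theorem mul_metric_adjoint (b : A) :
    F.mul b * constMat F.η = constMat F.η * (F.mul b)ᵀ := by
  refine Matrix.ext fun a c => ?_
  rw [Matrix.mul_apply, Matrix.mul_apply]
  have h := F.mul_metric a b c
  simp only [F.mul_comm a b] at h
  refine h.trans (Finset.sum_congr rfl fun d _ => ?_)
  rw [_root_.mul_comm]
  rfl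

theorem 𝒰_metric_adjoint : F.𝒰 * constMat F.η = constMat F.η * F.𝒰ᵀ := by
  simp only [𝒰, Finset.sum_mul, Matrix.transpose_sum, Finset.mul_sum, Matrix.transpose_smul,
    Matrix.smul_mul, Matrix.mul_smul, F.mul_metric_adjoint]

/-- The constant 1 - r/2 is half of the factor 2 - r in the Lie derivative of η, which makes μ skew.
-/
theorem μ_metric_adjoint : F.μ * F.η = -(F.η * F.μᵀ) := by
  have h : F.Elin * F.η + F.η * F.Elinᵀ = (2 - (F.r : ℂ)) • F.η := by
    refine Matrix.ext fun a b => ?_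
    rw [Matrix.add_apply, Matrix.mul_apply, Matrix.mul_apply, Matrix.smul_apply, smul_eq_mul,
      ← F.euler_metric]
    congr 1
    exact Finset.sum_congr rfl fun c _ => by rw [Matrix.transpose_apply, _root_.mul_comm]
  rw [μ, Matrix.sub_mul, Matrix.transpose_sub, Matrix.mul_sub, ← sub_eq_zero, Matrix.smul_mul,
    Matrix.one_mul, Matrix.transpose_smul, Matrix.transpose_one, Matrix.mul_smul, Matrix.mul_one,
    eq_sub_of_add_eq h]
  module

theorem mul_mul_𝒰 (a : A) : F.mul a * F.𝒰 = F.𝒰 * F.mul a := by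
  simp only [𝒰, Finset.sum_mul, Finset.mul_sum, Matrix.smul_mul, Matrix.mul_smul,
    F.mul_mul_comm a]

theorem pderiv_eul (a c : A) :
    MvPowerSeries.pderiv (R := ℂ) a (F.eul c) = MvPowerSeries.C (F.Elin a c) := by
  rw [eul, map_add, map_sum]
  have h : ∀ b, MvPowerSeries.pderiv (R := ℂ) a
      (MvPowerSeries.C (F.Elin b c) * MvPowerSeries.X b : Base A) =
      if b = a then MvPowerSeries.C (F.Elin b c) else 0 := by
    intro b
    rw [Derivation.leibniz, MvPowerSeries.pderiv_X, MvPowerSeries.pderiv_C]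
    by_cases hb : b = a
    · subst hb; simp
    · simp [hb]
  simp [h, MvPowerSeries.pderiv_C]

/-- The product rule for E in coordinates, with flatness used to turn derivatives of 𝒜_c along a
into derivatives of 𝒜_a along E. It expresses the compatibility of δ_z with ∇^z. -/
theorem map_pderiv_𝒰 (a : A) : F.𝒰.map (MvPowerSeries.pderiv (R := ℂ) a) =
    F.mul a - (F.mul a * constMat F.μ - constMat F.μ * F.mul a) := by
  have hμ : F.mul a * constMat F.μ - constMat F.μ * F.mul a =
      -(F.mul a * constMat F.Elin - constMat F.Elin * F.mul a) := by
    rw [μ, constMat_sub, constMat_smul, constMat_one, Matrix.mul_sub, Matrix.sub_mul,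
      Matrix.mul_smul, Matrix.smul_mul, Matrix.mul_one, Matrix.one_mul]
    abel
  rw [hμ, sub_neg_eq_add]
  refine Matrix.ext fun b f => ?_
  have h := F.euler a b f
  have e1 : (F.mul a * constMat (τ := A) F.Elin) b f =
      ∑ d, F.mul a b d * MvPowerSeries.C (F.Elin d f) := rfl
  have e2 : (constMat (τ := A) F.Elin * F.mul a) b f =
      ∑ d, MvPowerSeries.C (F.Elin b d) * F.mul a d f := rfl
  rw [Matrix.add_apply, Matrix.sub_apply, e1, e2, Matrix.map_apply, 𝒰, Matrix.sum_apply, map_sum]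
  simp only [Matrix.smul_apply, smul_eq_mul, Derivation.leibniz, pderiv_eul,
    Finset.sum_add_distrib]
  simp only [F.mul_flat a _ b f]
  rw [sub_eq_iff_eq_add] at h
  change ∑ d, F.eul d * _ = _ at h
  rw [h]
  have e3 : ∑ c, F.mul c b f * MvPowerSeries.C (F.Elin a c) =
      ∑ d, MvPowerSeries.C (F.Elin a d) * F.mul d b f :=
    Finset.sum_congr rfl fun d _ => _root_.mul_comm _ _
  rw [e3]
  abel

end FrobeniusGerm

variable {F : FrobeniusGerm A} {θ : ℕ → Matrix A A (Base A)}

theorem mk_Rcoef_mul (h : IsFundamental F θ) :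
    PowerSeries.mk (Rcoef F θ) * PowerSeries.mk θ =
      PowerSeries.mk θ * (PowerSeries.C (constMat (F.μ + (1 / 2 : ℂ) • (1 : Matrix A A ℂ))) +
        PowerSeries.X * PowerSeries.C F.𝒰) - PowerSeries.mk fun m => m • θ m := by
  have h1 : PowerSeries.mk (Rcoef F θ) = (PowerSeries.mk θ *
      (PowerSeries.C (constMat (F.μ + (1 / 2 : ℂ) • (1 : Matrix A A ℂ))) +
        PowerSeries.X * PowerSeries.C F.𝒰) - PowerSeries.mk fun m => m • θ m) *
      thetaInvSeries θ := by
    ext n : 1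
    rw [PowerSeries.coeff_mk]
    rfl
  rw [h1, mul_assoc, thetaInvSeries_mul_mk h, mul_one]

theorem Rcoef_zero (h : IsFundamental F θ) :
    Rcoef F θ 0 = constMat (F.μ + (1 / 2 : ℂ) • (1 : Matrix A A ℂ)) := by
  have := congrArg (PowerSeries.coeff 0) (mk_Rcoef_mul h)
  simpa [PowerSeries.coeff_mul, h.1] using this

theorem psDeriv_C (a : A) (T : Matrix A A (Base A)) :
    psDeriv a (PowerSeries.C T) = PowerSeries.C (T.map (MvPowerSeries.pderiv (R := ℂ) a)) := by
  ext n : 1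
  rw [coeff_psDeriv, PowerSeries.coeff_C, PowerSeries.coeff_C]
  split_ifs
  · rfl
  · exact Matrix.ext fun _ _ => map_zero (MvPowerSeries.pderiv ℂ a)

theorem psDeriv_X_mul (a : A) (P : PowerSeries (Matrix A A (Base A))) :
    psDeriv a (PowerSeries.X * P) = PowerSeries.X * psDeriv a P := by
  ext n : 1
  rw [coeff_psDeriv]
  rcases n with _ | n
  · rw [PowerSeries.coeff_zero_X_mul, PowerSeries.coeff_zero_X_mul]
    exact Matrix.ext fun _ _ => map_zero (MvPowerSeries.pderiv ℂ a)
  · rw [PowerSeries.coeff_succ_X_mul, PowerSeries.coeff_succ_X_mul, coeff_psDeriv]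

/-- The endomorphisms `R_n` are constant. -/
theorem map_pderiv_Rcoef (h : IsFundamental F θ) (n : ℕ) (a : A) :
    (Rcoef F θ n).map (MvPowerSeries.pderiv (R := ℂ) a) = 0 := by
  set N := constMat (τ := A) (F.μ + (1 / 2 : ℂ) • (1 : Matrix A A ℂ)) with hN
  set T := PowerSeries.mk θ with hT
  set E := PowerSeries.mk (fun m => m • θ m) with hE
  have hNd : N.map (MvPowerSeries.pderiv (R := ℂ) a) = 0 :=
    Matrix.ext fun _ _ => MvPowerSeries.pderiv_C
  have hEd : psDeriv a E = PowerSeries.X * ((T + E) * PowerSeries.C (F.mul a)) := by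
    ext n : 1
    rw [coeff_psDeriv, hE, PowerSeries.coeff_mk]
    rcases n with _ | n
    · rw [zero_smul, PowerSeries.coeff_zero_X_mul]
      exact Matrix.ext fun _ _ => map_zero (MvPowerSeries.pderiv ℂ a)
    · rw [PowerSeries.coeff_succ_X_mul, PowerSeries.coeff_mul_C, map_add, hT,
        PowerSeries.coeff_mk, PowerSeries.coeff_mk]
      have : ((n + 1) • θ (n + 1)).map (MvPowerSeries.pderiv ℂ a) =
          (n + 1) • (θ (n + 1)).map (MvPowerSeries.pderiv ℂ a) :=
        Matrix.ext fun _ _ => map_nsmul (MvPowerSeries.pderiv ℂ a) _ _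
      rw [this, h.2, add_mul, add_smul, one_smul, smul_mul_assoc, add_comm]
  have h1 := congrArg (psDeriv a) (eq_sub_iff_add_eq.mp (mk_Rcoef_mul h))
  have h0 := eq_sub_iff_add_eq.mp (mk_Rcoef_mul h)
  rw [← hN, ← hT, ← hE] at h0 h1
  rw [psDeriv_add, psDeriv_mul, psDeriv_theta h, psDeriv_mul, psDeriv_theta h, psDeriv_add,
    psDeriv_C, psDeriv_X_mul, psDeriv_C, hNd, map_zero, zero_add, F.map_pderiv_𝒰, ← hT, hEd] at h1
  have hX : ∀ P : PowerSeries (Matrix A A (Base A)), P * PowerSeries.X = PowerSeries.X * P :=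
    fun P => (PowerSeries.commute_X P).eq
  have hμ : PowerSeries.C (F.mul a * constMat F.μ - constMat F.μ * F.mul a) =
      PowerSeries.C (F.mul a) * PowerSeries.C N - PowerSeries.C N * PowerSeries.C (F.mul a) := by
    rw [← map_mul, ← map_mul, ← map_sub, hN, constMat_add, constMat_smul, constMat_one,
      Matrix.mul_add, Matrix.add_mul, Matrix.mul_smul, Matrix.smul_mul, Matrix.mul_one,
      Matrix.one_mul]
    congr 1
    abel
  have hU : PowerSeries.C (F.mul a) * PowerSeries.C F.𝒰 =
      PowerSeries.C F.𝒰 * PowerSeries.C (F.mul a) := by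
    rw [← map_mul, F.mul_mul_𝒰, map_mul]
  -- Differentiating RΘ = Θ(N + z𝒰) - zΘ' along u^a, all terms cancel except (∂_a R)Θ: the
  -- derivative of 𝒰 cancels the commutator with N and the extra z produced by zΘ'. Invertibility of
  -- Θ then gives ∂_a R = 0.
  have h2 : psDeriv a (PowerSeries.mk (Rcoef F θ)) * T = 0 := by
    have h3 : PowerSeries.mk (Rcoef F θ) *
        (PowerSeries.X * (T * PowerSeries.C (F.mul a))) =
        PowerSeries.X * ((T * (PowerSeries.C N + PowerSeries.X * PowerSeries.C F.𝒰) - E) *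
          PowerSeries.C (F.mul a)) := by
      rw [← mul_assoc, hX, mul_assoc, ← mul_assoc _ T, eq_sub_iff_add_eq.mpr h0]
    rw [h3, map_sub, hμ] at h1
    rw [← sub_eq_zero] at h1
    rw [← h1]
    have h4 : T * (PowerSeries.X * (PowerSeries.C (F.mul a) -
        (PowerSeries.C (F.mul a) * PowerSeries.C N - PowerSeries.C N * PowerSeries.C (F.mul a)))) =
        PowerSeries.X * (T * (PowerSeries.C (F.mul a) -
        (PowerSeries.C (F.mul a) * PowerSeries.C N -
          PowerSeries.C N * PowerSeries.C (F.mul a)))) := by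
      rw [← mul_assoc, hX, mul_assoc]
    have h5 : T * PowerSeries.C (F.mul a) * (PowerSeries.X * PowerSeries.C F.𝒰) =
        T * (PowerSeries.X * PowerSeries.C F.𝒰) * PowerSeries.C (F.mul a) := by
      rw [mul_assoc, mul_assoc, ← mul_assoc _ PowerSeries.X, hX, mul_assoc, hU, mul_assoc]
    have h6 : PowerSeries.X * (T * PowerSeries.C (F.mul a)) *
        (PowerSeries.C N + PowerSeries.X * PowerSeries.C F.𝒰) =
        PowerSeries.X * (T * PowerSeries.C (F.mul a) * PowerSeries.C N +
          T * (PowerSeries.X * PowerSeries.C F.𝒰) * PowerSeries.C (F.mul a)) := by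
      rw [mul_assoc, mul_add (T * _), h5]
    rw [h4, h6]
    noncomm_ring
  have h7 : psDeriv a (PowerSeries.mk (Rcoef F θ)) = 0 := by
    rw [← mul_one (psDeriv a _), ← mk_mul_thetaInvSeries h, ← mul_assoc, h2, zero_mul]
  have h8 := congrArg (PowerSeries.coeff n) h7
  rwa [coeff_psDeriv, PowerSeries.coeff_mk, map_zero] at h8

/-- For n > 0 this is conformality. At n = 0 it holds because μ_s commutes with R_0 = μ + 1/2, so
the grading covers every coefficient. -/
theorem exists_grading (h : IsFundamental F θ) (hc : IsConformal F θ) :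
    ∃ S : Matrix A A ℂ, ∀ n, constMat S * Rcoef F θ n - Rcoef F θ n * constMat S =
      -((n : ℂ) • Rcoef F θ n) := by
  obtain ⟨S, N, hμ, hSN, -, -, hS⟩ := hc
  refine ⟨S, fun n => ?_⟩
  rcases n with _ | n
  · rw [Rcoef_zero h, ← constMat_mul, ← constMat_mul, ← constMat_sub, Nat.cast_zero, zero_smul,
      neg_zero, hμ]
    have : S * (S + N + (1 / 2 : ℂ) • 1) - (S + N + (1 / 2 : ℂ) • 1) * S = 0 := by
      rw [mul_add, mul_add, add_mul, add_mul, hSN.eq, mul_smul_comm, smul_mul_assoc, mul_one,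
        one_mul, sub_self]
    rw [this]
    exact Matrix.ext fun _ _ => map_zero MvPowerSeries.C
  · exact hS _ n.succ_pos

end

section

variable {A : Type*} [Fintype A] [DecidableEq A]

/-! ### The gauge transformation on the jet space -/

/-- Pullback of endomorphisms of the cotangent bundle as a ring homomorphism. -/
def pullHom : Matrix A A (Base A) →+* Matrix A A (Jet A) :=
  ((pull : Base A →ₐ[ℂ] Jet A) : Base A →+* Jet A).mapMatrix

theorem pullHom_apply (T : Matrix A A (Base A)) : pullHom T = pullMat T := rfl

/-- The Laurent series in `z` whose coefficients are the pullbacks of the given endomorphisms. -/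
def pullSeries (T : ℕ → Matrix A A (Base A)) : HahnSeries ℤ (Matrix A A (Jet A)) :=
  HahnSeries.ofPowerSeries ℤ _ (PowerSeries.mk fun n => pullMat (T n))

theorem coeff_pullSeries (T : ℕ → Matrix A A (Base A)) (n : ℕ) :
    (pullSeries T).coeff (n : ℤ) = pullMat (T n) :=
  coeff_ofPowerSeries_mk _ n

theorem lowerBound_pullSeries (T : ℕ → Matrix A A (Base A)) : LowerBound 0 (pullSeries T) :=
  lowerBound_ofPowerSeries _

theorem mk_pullMat (T : ℕ → Matrix A A (Base A)) :
    PowerSeries.mk (fun n => pullMat (T n)) = PowerSeries.map pullHom (PowerSeries.mk T) := by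
  ext n : 1
  rw [PowerSeries.coeff_map, PowerSeries.coeff_mk, PowerSeries.coeff_mk, pullHom_apply]

variable {F : FrobeniusGerm A} {θ : ℕ → Matrix A A (Base A)}

theorem mk_thetaInv : PowerSeries.mk (thetaInv θ) = thetaInvSeries θ := by
  ext n : 1
  rw [PowerSeries.coeff_mk, thetaInv_eq]

theorem mk_pull_theta_mul (h : IsFundamental F θ) :
    PowerSeries.mk (fun n => pullMat (θ n)) * PowerSeries.mk (fun n => pullMat (thetaInv θ n)) =
      1 := by
  rw [mk_pullMat, mk_pullMat, ← map_mul, mk_thetaInv, mk_mul_thetaInvSeries h, map_one]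

theorem mk_pull_thetaInv_mul (h : IsFundamental F θ) :
    PowerSeries.mk (fun n => pullMat (thetaInv θ n)) * PowerSeries.mk (fun n => pullMat (θ n)) =
      1 := by
  rw [mk_pullMat, mk_pullMat, ← map_mul, mk_thetaInv, thetaInvSeries_mul_mk h, map_one]

theorem mk_pull_Rcoef_mul (h : IsFundamental F θ) :
    PowerSeries.mk (fun n => pullMat (Rcoef F θ n)) * PowerSeries.mk (fun n => pullMat (θ n)) =
      PowerSeries.mk (fun n => pullMat (θ n)) *
        (PowerSeries.C (constMat (F.μ + (1 / 2 : ℂ) • (1 : Matrix A A ℂ))) +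
          PowerSeries.X * PowerSeries.C (pullMat F.𝒰)) -
        PowerSeries.mk fun m => m • pullMat (θ m) := by
  have h1 : PowerSeries.mk (fun m => m • pullMat (θ m)) =
      PowerSeries.map pullHom (PowerSeries.mk fun m => m • θ m) := by
    rw [← mk_pullMat]
    simp only [← pullHom_apply, map_nsmul]
  rw [h1, mk_pullMat, mk_pullMat, ← map_mul, mk_Rcoef_mul h, map_sub, map_mul, map_add, map_mul,
    PowerSeries.map_C, PowerSeries.map_C, PowerSeries.map_X, pullHom_apply, pullHom_apply,
    pullMat_constMat]

variable (F) in
/-- The series `μ + 1/2 + z 𝒰`. -/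
def rho : HahnSeries ℤ (Matrix A A (Jet A)) :=
  HahnSeries.single 0 (constMat (F.μ + (1 / 2 : ℂ) • (1 : Matrix A A ℂ))) +
    HahnSeries.single 1 (pullMat F.𝒰)

theorem lowerBound_rho : LowerBound 0 (rho F) := fun m hm => by
  rw [rho, HahnSeries.coeff_add, HahnSeries.coeff_single_of_ne (by omega),
    HahnSeries.coeff_single_of_ne (by omega), add_zero]

theorem pull_theta_mul_thetaInv (h : IsFundamental F θ) :
    pullSeries θ * pullSeries (thetaInv θ) = 1 := by
  rw [pullSeries, pullSeries, ← map_mul, mk_pull_theta_mul h, map_one]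

theorem pull_thetaInv_mul_theta (h : IsFundamental F θ) :
    pullSeries (thetaInv θ) * pullSeries θ = 1 := by
  rw [pullSeries, pullSeries, ← map_mul, mk_pull_thetaInv_mul h, map_one]

theorem euler_pull_theta (h : IsFundamental F θ) :
    euler (pullSeries θ) + pullSeries (Rcoef F θ) * pullSeries θ = pullSeries θ * rho F := by
  rw [pullSeries, pullSeries, euler_ofPowerSeries, ← map_mul, mk_pull_Rcoef_mul h, map_sub,
    add_sub_cancel, map_mul, map_add, map_mul, HahnSeries.ofPowerSeries_C,
    HahnSeries.ofPowerSeries_C, HahnSeries.ofPowerSeries_X, rho]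
  congr 2
  rw [HahnSeries.C_apply, HahnSeries.single_mul_single, add_zero, one_mul]

variable (F) in
/-- The adjoint of an endomorphism of the pulled back cotangent bundle. -/
def adjoint : Matrix A A (Jet A) →ₗ[ℂ] Matrix A A (Jet A) where
  toFun T := constMat F.η * Tᵀ * constMat F.η⁻¹
  map_add' S T := by rw [Matrix.transpose_add, mul_add, add_mul]
  map_smul' c T := by
    rw [Matrix.transpose_smul, mul_smul_comm, smul_mul_assoc, RingHom.id_apply]

theorem adjoint_apply (T : Matrix A A (Jet A)) :
    adjoint F T = constMat F.η * Tᵀ * constMat F.η⁻¹ := rfl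

theorem adjoint_mul (S T : Matrix A A (Jet A)) :
    adjoint F (S * T) = adjoint F T * adjoint F S := by
  rw [adjoint_apply, adjoint_apply, adjoint_apply, Matrix.transpose_mul, mul_assoc _ (constMat F.η⁻¹),
    ← mul_assoc (constMat F.η⁻¹), ← mul_assoc (constMat F.η⁻¹), F.constMat_inv_mul_η, one_mul]
  simp only [mul_assoc]

theorem adjoint_one : adjoint F 1 = 1 := by
  rw [adjoint_apply, Matrix.transpose_one, mul_one, F.constMat_η_mul_inv]

theorem adjoint_adjoint (T : Matrix A A (Jet A)) : adjoint F (adjoint F T) = T := by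
  rw [adjoint_apply, adjoint_apply, Matrix.transpose_mul, Matrix.transpose_mul,
    constMat_transpose, constMat_transpose, F.η_transpose, F.η_inv_transpose,
    Matrix.transpose_transpose, ← mul_assoc, ← mul_assoc, F.constMat_η_mul_inv, one_mul, mul_assoc,
    F.constMat_η_mul_inv, mul_one]

theorem adjoint_eq_of_mul {S T : Matrix A A (Jet A)}
    (h : constMat F.η * Tᵀ = S * constMat F.η) : adjoint F T = S := by
  rw [adjoint_apply, h, mul_assoc, F.constMat_η_mul_inv, mul_one]

theorem adjoint_𝒰 : adjoint F (pullMat F.𝒰) = pullMat F.𝒰 := adjoint_eq_of_mul (by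
  rw [← pullMat_transpose, ← pullMat_constMat, ← pullMat_mul, ← F.𝒰_metric_adjoint, pullMat_mul])

theorem adjoint_μ_add_half :
    adjoint F (constMat (F.μ + (1 / 2 : ℂ) • (1 : Matrix A A ℂ))) =
      1 - constMat (F.μ + (1 / 2 : ℂ) • (1 : Matrix A A ℂ)) := adjoint_eq_of_mul (by
  have h : F.η * (F.μ + (1 / 2 : ℂ) • (1 : Matrix A A ℂ))ᵀ =
      (1 - (F.μ + (1 / 2 : ℂ) • (1 : Matrix A A ℂ))) * F.η := by
    rw [sub_mul, add_mul, F.μ_metric_adjoint, Matrix.transpose_add, mul_add, Matrix.transpose_smul,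
      Matrix.transpose_one, smul_mul_assoc, one_mul, mul_smul_comm, mul_one]
    module
  rw [constMat_transpose, ← constMat_mul, h, constMat_mul, constMat_sub, constMat_one])

theorem dagger_rho : dagger (adjoint F) (rho F) = 1 - rho F := by
  rw [rho, dagger_add, dagger_single, dagger_single, adjoint_𝒰, adjoint_μ_add_half, zpow_zero,
    one_smul, zpow_one, neg_smul, one_smul, ← sub_sub]
  rw [HahnSeries.single_sub, HahnSeries.single_neg, HahnSeries.single_zero_one, ← sub_eq_add_neg]

theorem dagger_pull_theta (hθ : IsSymmetricFundamental F θ) :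
    dagger (adjoint F) (pullSeries θ) = pullSeries (thetaInv θ) := by
  ext m : 2
  rw [coeff_dagger]
  rcases lt_or_ge m 0 with h | h
  · rw [lowerBound_pullSeries _ m h, lowerBound_pullSeries _ m h, map_zero, smul_zero]
  · obtain ⟨n, rfl⟩ := Int.eq_ofNat_of_zero_le h
    rw [coeff_pullSeries, coeff_pullSeries, thetaInv_eq_adjoint hθ, pullMat_smul, pullMat_mul,
      pullMat_mul, pullMat_constMat, pullMat_constMat, pullMat_transpose, adjoint_apply,
      zpow_natCast]

/-- The relation holds for μ + 1/2 + z𝒰 because μ is skew and 𝒰 is self-adjoint. It is preserved by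
the gauge transformation because Θ† = Θ⁻¹. -/
theorem dagger_pull_Rcoef (hθ : IsSymmetricFundamental F θ) :
    dagger (adjoint F) (pullSeries (Rcoef F θ)) = 1 - pullSeries (Rcoef F θ) := by
  set Θ := pullSeries θ with hΘ
  set Φ := pullSeries (thetaInv θ) with hΦ
  have h1 := pull_theta_mul_thetaInv hθ.1
  rw [← hΘ, ← hΦ] at h1
  have hR : pullSeries (Rcoef F θ) = Θ * rho F * Φ - euler Θ * Φ := by
    rw [← sub_mul, ← euler_pull_theta hθ.1, add_sub_cancel_left, mul_assoc, h1, mul_one]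
  have hd : dagger (adjoint F) Θ = Φ := dagger_pull_theta hθ
  have hd' : dagger (adjoint F) Φ = Θ := by rw [← hd, dagger_dagger adjoint_adjoint]
  have he : euler Θ * Φ = -(Θ * euler Φ) := by
    have := euler_mul Θ Φ
    rw [h1, euler_one] at this
    exact eq_neg_of_add_eq_zero_left this.symm
  rw [hR, dagger_sub, dagger_mul adjoint_mul, dagger_mul adjoint_mul, dagger_mul adjoint_mul,
    dagger_euler, hd, hd', dagger_rho, he, sub_mul, mul_sub Θ, one_mul, h1, mul_assoc]
  abel

/-! ### The kernel of the operator `z δ̃_z^n` -/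

theorem deltaTilde_eq (g : HahnSeries ℤ (Matrix A A (Jet A))) (m : ℤ) :
    deltaTilde F θ (fun i => g.coeff i) m = (dop (pullSeries (Rcoef F θ)) g).coeff m := by
  rw [coeff_dop, deltaTilde, coeff_mul_eq_finsum]
  congr 1
  classical
  have hinj : Function.Injective (Nat.cast : ℕ → ℤ) := Nat.cast_injective
  have h1 := finsum_mem_range hinj (f := fun i : ℤ =>
    (pullSeries (Rcoef F θ)).coeff i * g.coeff (m + 1 - i))
  simp only [coeff_pullSeries] at h1
  rw [← h1]
  refine finsum_congr fun i => ?_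
  rw [finsum_eq_if]
  split_ifs with hi
  · rfl
  · have : i < 0 := by
      by_contra h0
      exact hi ⟨i.toNat, by omega⟩
    rw [lowerBound_pullSeries _ i this, zero_mul]

variable (F θ) in
/-- The coefficient of `z^m` in `δ̃_z^n z^p`. -/
abbrev tildeCoeff (n : ℕ) (p m : ℤ) : Matrix A A (Jet A) :=
  monoCoeff (pullSeries (Rcoef F θ)) n p m

theorem kernelMat_eq (n : ℕ) (p m : ℤ) : kernelMat F θ n p m = tildeCoeff F θ n p (m - 1) := by
  have h : ∀ n, (deltaTilde F θ)^[n] (fun i => if i = p then 1 else 0) =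
      fun i => ((dop (pullSeries (Rcoef F θ)))^[n] (HahnSeries.single p 1)).coeff i := by
    intro n
    induction n with
    | zero =>
      funext i
      rw [Function.iterate_zero, Function.iterate_zero, id, id, HahnSeries.coeff_single]
      split_ifs <;> rfl
    | succ n ih =>
      rw [Function.iterate_succ_apply', ih]
      funext i
      rw [deltaTilde_eq, ← Function.iterate_succ_apply' (dop _)]
  rw [kernelMat, h]
  rfl

theorem tildeCoeff_of_lt {n : ℕ} {p m : ℤ} (h : m < p - n) : tildeCoeff F θ n p m = 0 :=
  monoCoeff_of_lt (lowerBound_pullSeries _) h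

variable (F θ) in
/-- The matrix `(-1)^p η^{ab} K_b^c`, where `K` is the coefficient of `z^{-1-p}` in
`z δ̃_z^n z^q`. -/
def kernelForm (n : ℕ) (p q : ℤ) : Matrix A A (Jet A) :=
  (-1 : ℂ) ^ p • (constMat F.η⁻¹ * tildeCoeff F θ n q (-2 - p))

theorem kernelForm_of_lt {n : ℕ} {p q : ℤ} (h : n < p + q + 2) : kernelForm F θ n p q = 0 := by
  rw [kernelForm, tildeCoeff_of_lt (by omega), mul_zero, smul_zero]

/-- Symmetry of δ̃_z for the residue pairing, tested on the monomials z^q and z^p. -/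
theorem kernelForm_transpose (hθ : IsSymmetricFundamental F θ) (n : ℕ) (p q : ℤ) :
    (kernelForm F θ n p q)ᵀ = kernelForm F θ n q p := by
  have h := coeff_dagger_mul_iterate_dop adjoint_mul adjoint_one (dagger_pull_Rcoef hθ)
    (HahnSeries.single q 1) (HahnSeries.single p 1) n
  rw [dagger_single, adjoint_one, HahnSeries.coeff_single_mul, HahnSeries.coeff_mul_single,
    smul_mul_assoc, one_mul, mul_one, coeff_dagger] at h
  change (-1 : ℂ) ^ q • tildeCoeff F θ n p (-2 - q) =
    (-1 : ℂ) ^ (-2 - p) • adjoint F (tildeCoeff F θ n q (-2 - p)) at h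
  have hs : (-1 : ℂ) ^ (-2 - p) = (-1 : ℂ) ^ p := by
    rw [zpow_sub₀ (by norm_num), show (-2 : ℤ) = -((2 : ℕ) : ℤ) by norm_num, zpow_neg, zpow_natCast]
    rcases Int.even_or_odd p with hp | hp
    · rw [hp.neg_one_zpow]; norm_num
    · rw [hp.neg_one_zpow]; norm_num
  rw [kernelForm, kernelForm, ← mul_smul_comm ((-1 : ℂ) ^ q), h, hs, adjoint_apply, mul_smul_comm,
    ← mul_assoc, ← mul_assoc, F.constMat_inv_mul_η, one_mul, Matrix.transpose_smul,
    Matrix.transpose_mul, constMat_transpose, F.η_inv_transpose]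

/-! ### Functions annihilated by the flat fields -/

theorem flatField_one (k : ℕ) (a : A) : flatField F θ k a 1 = 0 := by
  simp only [flatField, F.sigma_eq, vf_one, mul_zero, Finset.sum_const_zero]

variable (F θ) in
/-- The endomorphisms whose components are annihilated by the flat fields. -/
def flatMatrices : Subalgebra ℂ (Matrix A A (Jet A)) where
  carrier := {T | ∀ k a i j, flatField F θ k a (T i j) = 0}
  mul_mem' {S T} hS hT k a i j := by
    rw [Matrix.mul_apply, flatField_sum]
    refine Finset.sum_eq_zero fun b _ => ?_
    rw [flatField_mul, hS, hT, zero_mul, mul_zero, add_zero]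
  add_mem' {S T} hS hT k a i j := by rw [Matrix.add_apply, flatField_add, hS, hT, add_zero]
  algebraMap_mem' c k a i j := by
    rw [Algebra.algebraMap_eq_smul_one, Matrix.smul_apply, flatField_smul, Matrix.one_apply]
    split_ifs
    · rw [flatField_one, smul_zero]
    · rw [flatField_zero, smul_zero]

theorem pull_Rcoef_mem_flatMatrices (h : IsFundamental F θ) (n : ℕ) :
    pullMat (Rcoef F θ n) ∈ flatMatrices F θ := by
  intro k a i j
  refine Finset.sum_eq_zero fun p _ => Finset.sum_eq_zero fun b _ => ?_
  have h1 := congrFun (congrFun (map_sigma_pullMat (F := F) p.2 b (Rcoef F θ n)) i) j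
  rw [Matrix.map_apply] at h1
  rw [h1]
  simp [map_pderiv_Rcoef h, pullMat_zero]

/-- The coefficients are built from the constant matrices R_j by sums, products and scalars, so flat
derivations commute with multiplication by them. -/
theorem tildeCoeff_mem_flatMatrices (h : IsFundamental F θ) (n : ℕ) (p m : ℤ) :
    tildeCoeff F θ n p m ∈ flatMatrices F θ := by
  have hL := lowerBound_pullSeries (Rcoef F θ)
  induction n generalizing m with
  | zero =>
    rw [tildeCoeff, monoCoeff, Function.iterate_zero, id, HahnSeries.coeff_single]
    split_ifs
    · exact one_mem _
    · exact zero_mem _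
  | succ n ih =>
    rw [tildeCoeff, monoCoeff, Function.iterate_succ_apply', coeff_dop,
      coeff_mul_eq_sum (N := p - n) (s := (m + 1 - (p - n)).toNat + 1) hL
        (hL.iterate_dop (lowerBound_single p 1) n) (by omega)]
    refine add_mem (Subalgebra.smul_mem _ (ih _) _) (sum_mem fun j _ => mul_mem ?_ (ih _))
    rw [coeff_pullSeries]
    exact pull_Rcoef_mem_flatMatrices h j

end

section

open MvPowerSeries (smul_eq_C_mul)

variable {A : Type*} [Fintype A] [DecidableEq A]

/-! ### Vector-valued Laurent series as matrix-valued Laurent series -/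

/-- All columns of the coefficients of the matrix-valued series `G` are given by the
vector-valued series `g`. -/
def IsColumn (G : HahnSeries ℤ (Matrix A A (Jet A))) (g : ℤ → A → Jet A) : Prop :=
  ∀ m a b, G.coeff m a b = g m a

/-- Repeating a vector in every column turns the matrix action on vector-valued series into left
multiplication in the ring of Laurent series. Any column recovers the vector; the index `F.e` is
used later as a convenient choice. -/
theorem exists_isColumn {N : ℤ} {g : ℤ → A → Jet A} (hg : ∀ m, m < N → ∀ a, g m a = 0) :
    ∃ G : HahnSeries ℤ (Matrix A A (Jet A)), LowerBound N G ∧ IsColumn G g := by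
  refine ⟨HahnSeries.ofSuppBddBelow (fun m => Matrix.of fun a _ => g m a) ⟨N, fun m hm => ?_⟩,
    fun m hm => ?_, fun m a b => rfl⟩
  · by_contra h
    exact hm (Matrix.ext fun a b => hg m (not_le.mp h) a)
  · exact Matrix.ext fun a b => hg m hm a

variable {F : FrobeniusGerm A} {θ : ℕ → Matrix A A (Base A)}

theorem IsColumn.delta {G : HahnSeries ℤ (Matrix A A (Jet A))} {g : ℤ → A → Jet A}
    (h : IsColumn G g) : IsColumn (dop (rho F) G) (F.delta g) := fun m a b => by
  rw [rho, coeff_dop_polynomial, FrobeniusGerm.delta, Matrix.add_apply, Matrix.add_apply,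
    Matrix.smul_apply, Matrix.mul_apply, Matrix.mul_apply, h]
  congr 1
  · congr 1
    refine Finset.sum_congr rfl fun c _ => ?_
    rw [h, smul_eq_C_mul]
    rfl
  · exact Finset.sum_congr rfl fun c _ => by rw [h]

theorem IsColumn.iterate_delta {G : HahnSeries ℤ (Matrix A A (Jet A))} {g : ℤ → A → Jet A}
    (h : IsColumn G g) (n : ℕ) : IsColumn ((dop (rho F))^[n] G) (F.delta^[n] g) := by
  induction n with
  | zero => exact h
  | succ n ih =>
    rw [Function.iterate_succ_apply', Function.iterate_succ_apply']
    exact ih.delta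

variable (F θ) in
/-- The coefficients of `∂(z) f`. -/
def flatSeries (f : Jet A) (m : ℤ) (a : A) : Jet A :=
  if 0 ≤ m then flatField F θ m.toNat a f else 0

theorem flatSeries_of_neg {f : Jet A} {m : ℤ} (h : m < 0) (a : A) : flatSeries F θ f m a = 0 :=
  if_neg (by omega)

theorem flatSeries_natCast (f : Jet A) (k : ℕ) (a : A) :
    flatSeries F θ f k a = flatField F θ k a f := by
  rw [flatSeries, if_pos (by omega), Int.toNat_natCast]

theorem sigmaSeries_of_neg {f : Jet A} {m : ℤ} (h : m < 0) (a : A) : F.sigmaSeries f m a = 0 :=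
  if_neg (by omega)

theorem sigmaSeries_natCast (f : Jet A) (k : ℕ) (a : A) :
    F.sigmaSeries f k a = F.sigma k a f := by
  rw [FrobeniusGerm.sigmaSeries, if_pos (by omega), Int.toNat_natCast]

theorem IsColumn.flatSeries {G : HahnSeries ℤ (Matrix A A (Jet A))} {f : Jet A}
    (hG : LowerBound 0 G) (h : IsColumn G (F.sigmaSeries f)) :
    IsColumn (pullSeries θ * G) (flatSeries F θ f) := fun m a b => by
  rcases lt_or_ge m 0 with hm | hm
  · rw [((lowerBound_pullSeries θ).mul hG) m (by omega), flatSeries_of_neg hm]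
    rfl
  · obtain ⟨k, rfl⟩ := Int.eq_ofNat_of_zero_le hm
    rw [coeff_mul_eq_sum (N := 0) (s := k + 1) (lowerBound_pullSeries θ) hG (by push_cast; omega),
      flatSeries_natCast, flatField, Finset.Nat.sum_antidiagonal_eq_sum_range_succ_mk,
      Matrix.sum_apply]
    refine Finset.sum_congr rfl fun j hj => ?_
    rw [Finset.mem_range] at hj
    rw [Matrix.mul_apply, coeff_pullSeries]
    refine Finset.sum_congr rfl fun c _ => ?_
    rw [h, show (k : ℤ) - j = ((k - j : ℕ) : ℤ) by omega, sigmaSeries_natCast]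

/-! ### The pairing on vector-valued Laurent series -/

theorem csum_coeff_mul (T : Matrix A A (Jet A)) (P Q : HahnSeries ℤ (Matrix A A (Jet A))) (m : ℤ)
    (a b : A) : (csum fun i : ℤ => (T * (P.coeff i * Q.coeff (m - i))) a b) =
      (T * (P * Q).coeff m) a b := by
  have hf := finite_support_coeff_mul P Q m
  rw [csum_eq_sum hf.toFinset, coeff_mul_eq_finsum, finsum_eq_sum _ hf, Finset.mul_sum,
    Matrix.sum_apply]
  intro i hi
  rw [Set.Finite.mem_toFinset, Function.mem_support, not_not] at hi
  rw [hi, mul_zero]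
  rfl

theorem IsColumn.mul_left {Q : HahnSeries ℤ (Matrix A A (Jet A))} {g : ℤ → A → Jet A}
    (hQ : IsColumn Q g) (P : HahnSeries ℤ (Matrix A A (Jet A))) (c : A) :
    IsColumn (P * Q) fun m a => (P * Q).coeff m a c := fun m a b => by
  have hf := finite_support_coeff_mul P Q m
  simp only [coeff_mul_eq_finsum, finsum_eq_sum _ hf, Matrix.sum_apply, Matrix.mul_apply]
  exact Finset.sum_congr rfl fun i _ => Finset.sum_congr rfl fun d _ => by rw [hQ, hQ]

/-- The dagger supplies the substitution z ↦ -z, and the η in the adjoint cancels the leading η⁻¹.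
-/
theorem resPair_eq {P Q : HahnSeries ℤ (Matrix A A (Jet A))} {f g : ℤ → A → Jet A}
    (hP : IsColumn P f) (hQ : IsColumn Q g) (a b : A) :
    F.resPair f g = (constMat (τ := ℕ × A) F.η⁻¹ * (dagger (adjoint F) P * Q).coeff (-2)) a b := by
  rw [← csum_coeff_mul, FrobeniusGerm.resPair]
  refine congrArg csum (funext fun i => ?_)
  rw [coeff_dagger, smul_mul_assoc, mul_smul_comm, Matrix.smul_apply, adjoint_apply, ← mul_assoc,
    ← mul_assoc, ← mul_assoc, F.constMat_inv_mul_η, one_mul, mul_assoc, Matrix.mul_apply,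
    Finset.smul_sum]
  refine Finset.sum_congr rfl fun c _ => ?_
  rw [Matrix.mul_apply, Finset.mul_sum, Finset.smul_sum]
  refine Finset.sum_congr rfl fun d _ => ?_
  rw [Matrix.transpose_apply, hP, hQ, mul_smul]
  congr 1
  rw [smul_eq_C_mul]
  change _ = _ * (MvPowerSeries.C (F.η⁻¹ c d) * _)
  ring

/-- The components of the coefficient of `z^q` lie in the ideal of functions of weight at least
`-q - c`. -/
def Decay (c : ℤ) (f : ℤ → A → Jet A) : Prop := ∀ q a, Wt (-q - c).toNat (f q a)

theorem decay_of_neg {f : ℤ → A → Jet A} (hf : ∀ q, q < 0 → ∀ a, f q a = 0) (c : ℤ) (hc : 0 ≤ c) :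
    Decay c f := fun q a => by
  rcases lt_or_ge q 0 with h | h
  · rw [hf q h]; exact Wt.zero_right _
  · exact (Wt.zero_left _).mono (by omega)

variable (F θ) in
/-- The contributions to the residue `Res η(f(-z), z δ̃_z^n g(z))`. -/
def pairTerm (n : ℕ) (f g : ℤ → A → Jet A) (q : ℤ × ℤ) : Jet A :=
  ∑ a, ∑ c, kernelForm F θ n q.1 q.2 a c * (f q.1 a * g q.2 c)

variable (F θ) in
/-- The residue `Res η(f(-z), z δ̃_z^n g(z))`. -/
def pairing (n : ℕ) (f g : ℤ → A → Jet A) : Jet A := csum (pairTerm F θ n f g)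

/-- The kernel bounds q.1 + q.2 from above, and decay bounds each exponent from below once the
monomial is fixed. The contributing pairs lie in a finite box. -/
theorem cfin_pairTerm (n : ℕ) {c : ℤ} {f g : ℤ → A → Jet A} (hf : Decay c f) (hg : Decay c g) :
    CFin (pairTerm F θ n f g) := fun m => by
  refine Set.Finite.subset ((Set.finite_Icc (-(wt m : ℤ) - c) (n + wt m + c)).prod
    (Set.finite_Icc (-(wt m : ℤ) - c) (n + wt m + c))) fun q hq => ?_
  have h1 : q.1 + q.2 + 2 ≤ n := by
    by_contra h
    refine hq ?_
    simp [pairTerm, kernelForm_of_lt (F := F) (θ := θ) (not_le.mp h)]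
  have h2 : Wt ((-q.1 - c).toNat + (-q.2 - c).toNat) (pairTerm F θ n f g q) :=
    Wt.sum fun a _ => Wt.sum fun c' _ => ((hf q.1 a).mul (hg q.2 c')).mul_left _
  have h3 := h2 m hq
  rw [Set.mem_prod, Set.mem_Icc, Set.mem_Icc]
  omega

theorem pairing_comm (hθ : IsSymmetricFundamental F θ) (n : ℕ) (f g : ℤ → A → Jet A) :
    pairing F θ n f g = pairing F θ n g f := by
  rw [pairing, ← csum_equiv (Equiv.prodComm ℤ ℤ)]
  refine congrArg csum (funext fun q => ?_)
  rw [pairTerm, pairTerm, Finset.sum_comm]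
  refine Finset.sum_congr rfl fun c _ => Finset.sum_congr rfl fun a _ => ?_
  simp only [Equiv.prodComm_apply, Prod.fst_swap, Prod.snd_swap]
  rw [← kernelForm_transpose hθ, Matrix.transpose_apply, mul_comm (f _ _)]

theorem sum_kernelForm_mul {n : ℕ} {N M q : ℤ} {G : HahnSeries ℤ (Matrix A A (Jet A))}
    (hG : LowerBound N G) (hM : -2 - q + n < M) :
    ∑ p ∈ Finset.Ico N M, kernelForm F θ n q p * G.coeff p =
      (-1 : ℂ) ^ q • (constMat F.η⁻¹ *
        ((dop (pullSeries (Rcoef F θ)))^[n] G).coeff (-2 - q)) := by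
  rw [coeff_iterate_dop (lowerBound_pullSeries _) hG n hM, Finset.mul_sum, Finset.smul_sum]
  refine Finset.sum_congr rfl fun p _ => ?_
  rw [kernelForm, smul_mul_assoc, mul_assoc]
  rfl

/-- Summing first over the second exponent reassembles the n-th iterate of δ̃_z on g from its values
on monomials. -/
theorem pairing_eq_resPair (n : ℕ) {c N : ℤ} {f g : ℤ → A → Jet A}
    {G : HahnSeries ℤ (Matrix A A (Jet A))} (hf : Decay c f) (hg : Decay c g)
    (hN : LowerBound N G) (hG : IsColumn G g) :
    pairing F θ n f g = F.resPair f
      fun m b => ((dop (pullSeries (Rcoef F θ)))^[n] G).coeff m b F.e := by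
  rw [pairing, csum_prod (cfin_pairTerm n hf hg), FrobeniusGerm.resPair]
  refine congrArg csum (funext fun q => ?_)
  rw [csum_eq_sum (Finset.Ico N (-2 - q + n + 1))]
  · have h := sum_kernelForm_mul (F := F) (θ := θ) (q := q) (n := n) hN (lt_add_one _)
    have h1 : ∀ a, ∑ c, (∑ p ∈ Finset.Ico N (-2 - q + n + 1),
        kernelForm F θ n q p a c * (f q a * g p c)) = f q a *
          ((-1 : ℂ) ^ q • (constMat (τ := ℕ × A) F.η⁻¹ *
            ((dop (pullSeries (Rcoef F θ)))^[n] G).coeff (-2 - q))) a F.e := by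
      intro a
      rw [← h, Matrix.sum_apply, Finset.sum_comm, Finset.mul_sum]
      refine Finset.sum_congr rfl fun p _ => ?_
      rw [Matrix.mul_apply, Finset.mul_sum]
      refine Finset.sum_congr rfl fun c _ => ?_
      rw [hG]
      ring
    have h2 : ∑ p ∈ Finset.Ico N (-2 - q + n + 1), pairTerm F θ n f g (q, p) =
        ∑ a, ∑ c, (∑ p ∈ Finset.Ico N (-2 - q + n + 1),
          kernelForm F θ n q p a c * (f q a * g p c)) := by
      simp only [pairTerm]
      rw [Finset.sum_comm]
      exact Finset.sum_congr rfl fun a _ => Finset.sum_comm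
    rw [h2]
    refine Finset.sum_congr rfl fun a _ => ?_
    rw [h1, Matrix.smul_apply, Matrix.mul_apply, Finset.smul_sum, Finset.mul_sum]
    refine Finset.sum_congr rfl fun d _ => ?_
    rw [mul_smul, mul_smul_comm]
    congr 1
    rw [smul_eq_C_mul]
    change _ * (MvPowerSeries.C (F.η⁻¹ a d) * _) = _
    ring
  · intro p hp
    rw [Finset.mem_Ico, not_and_or, not_le, not_lt] at hp
    refine Finset.sum_eq_zero fun a _ => Finset.sum_eq_zero fun c _ => ?_
    rcases hp with hp | hp
    · rw [← hG p c F.e, hN p hp, Matrix.zero_apply, mul_zero, mul_zero]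
    · rw [kernelForm_of_lt (by simp only; omega), Matrix.zero_apply, zero_mul]

theorem decay_flatSeries (f : Jet A) : Decay 0 (flatSeries F θ f) :=
  decay_of_neg (fun _ hq _ => flatSeries_of_neg hq _) _ le_rfl

/-- The pairing of the differentials of two functions is intrinsic. -/
theorem pairing_flatSeries (hθ : IsSymmetricFundamental F θ) (n : ℕ) (f g : Jet A) :
    pairing F θ n (flatSeries F θ f) (flatSeries F θ g) =
      F.resPair (F.sigmaSeries f) (F.delta^[n] (F.sigmaSeries g)) := by
  obtain ⟨P, hP0, hP⟩ := exists_isColumn (N := 0) (g := F.sigmaSeries f)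
    fun m hm a => sigmaSeries_of_neg hm a
  obtain ⟨Q, hQ0, hQ⟩ := exists_isColumn (N := 0) (g := F.sigmaSeries g)
    fun m hm a => sigmaSeries_of_neg hm a
  have hΘQ : LowerBound 0 (pullSeries θ * Q) := (lowerBound_pullSeries θ).mul hQ0
  rw [pairing_eq_resPair n (decay_flatSeries f) (decay_flatSeries g) hΘQ (hQ.flatSeries hQ0),
    iterate_dop_mul (euler_pull_theta hθ.1), resPair_eq hP (hQ.iterate_delta n) F.e F.e,
    resPair_eq (hP.flatSeries (θ := θ) hP0) ((hQ.iterate_delta n).mul_left _ _) F.e F.e,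
    dagger_mul adjoint_mul, dagger_pull_theta hθ, mul_assoc, ← mul_assoc (pullSeries (thetaInv θ)),
    pull_thetaInv_mul_theta hθ.1, one_mul]

end

section

open MvPowerSeries (smul_eq_C_mul)

variable {A : Type*} [Fintype A] [DecidableEq A]
variable {F : FrobeniusGerm A} {θ : ℕ → Matrix A A (Base A)}

/-! ### The first-order part of the Virasoro operators -/

variable (F θ) in
/-- The coefficients of the expectation of the free field in genus zero. -/
def genusZeroSeries (q : ℤ) (a : A) : Jet A :=
  (-1 : ℂ) ^ q • ∑ b, F.η a b • flatGen F θ (-q - 1) b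

theorem decay_genusZeroSeries (h : IsFundamental F θ) : Decay 2 (genusZeroSeries F θ) :=
  fun q _ => (Wt.sum fun b _ => ((tame_flatGen h (-q - 1) b).mono (by omega)).smul _).smul _

theorem sum_inv_η_genusZeroSeries (q : ℤ) (d : A) :
    ∑ c, ((-1 : ℂ) ^ q * F.η⁻¹ c d) • genusZeroSeries F θ q c = flatGen F θ (-q - 1) d := by
  have h1 : ∀ c, ((-1 : ℂ) ^ q * F.η⁻¹ c d) • genusZeroSeries F θ q c =
      ∑ b, (F.η⁻¹ d c * F.η c b) • flatGen F θ (-q - 1) b := by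
    intro c
    rw [genusZeroSeries, smul_smul, mul_right_comm, ← mul_zpow, neg_one_mul, neg_neg, one_zpow,
      one_mul, Finset.smul_sum]
    refine Finset.sum_congr rfl fun b _ => ?_
    rw [smul_smul, ← Matrix.transpose_apply F.η⁻¹, F.η_inv_transpose]
  simp only [h1]
  rw [Finset.sum_comm]
  simp only [← Finset.sum_smul, ← Matrix.mul_apply, F.inv_mul_η, Matrix.one_apply]
  simp

theorem exists_iterate_delta (n : ℕ) (f : Jet A) :
    ∃ Q : HahnSeries ℤ (Matrix A A (Jet A)), LowerBound 0 Q ∧ IsColumn Q (F.sigmaSeries f) ∧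
      LowerBound (-n) ((dop (rho F))^[n] Q) ∧
      IsColumn ((dop (rho F))^[n] Q) (F.delta^[n] (F.sigmaSeries f)) := by
  obtain ⟨Q, hQ0, hQ⟩ := exists_isColumn (N := 0) (g := F.sigmaSeries f)
    fun m hm a => sigmaSeries_of_neg hm a
  refine ⟨Q, hQ0, hQ, ?_, hQ.iterate_delta n⟩
  simpa using lowerBound_rho.iterate_dop hQ0 n

/-- The signs and η in the expectation of the free field cancel against those of the pairing,
leaving 𝐭(z) paired with δ̃_z^n Θσ f = Θ δ_z^n σ f. Moving Θ onto 𝐭(z) yields 𝐬(z). -/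
theorem pairing_genusZeroSeries (hθ : IsSymmetricFundamental F θ) (n : ℕ) (f : Jet A) :
    pairing F θ n (genusZeroSeries F θ) (flatSeries F θ f) =
      csum fun j : ℤ => ∑ a, sVec F θ j a * F.delta^[n] (F.sigmaSeries f) (j - 1) a := by
  obtain ⟨Q, hQ0, hQ, hY0, hY⟩ := exists_iterate_delta (F := F) n f
  set Y := (dop (rho F))^[n] Q
  set y := F.delta^[n] (F.sigmaSeries f)
  let h : ℤ × ℕ → Jet A := fun p => ∑ a, (flatGen F θ p.1 ᵥ* pullMat (θ p.2)) a * y (p.1 - 1 - p.2) a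
  have hy : ∀ m, m < -(n : ℤ) → ∀ a, y m a = 0 := fun m hm a => by
    rw [← hY m a a, hY0 m hm, Matrix.zero_apply]
  have hh : CFin h := fun m => by
    refine Set.Finite.subset ((Set.finite_Icc (1 - n : ℤ) (wt m + 1)).prod
      (Set.finite_Iic (wt m + n))) fun p hp => ?_
    have h1 : -(n : ℤ) ≤ p.1 - 1 - p.2 := by
      by_contra hn
      refine hp ?_
      simp [h, hy _ (not_le.mp hn)]
    have h2 : Wt (p.1 - 1).toNat (h p) := Wt.sum fun a _ =>
      (wt_vecMul (fun b => tame_flatGen hθ.1 p.1 b) _ a).mul_right _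
    have h3 := h2 m hp
    rw [Set.mem_prod, Set.mem_Icc, Set.mem_Iic]
    omega
  have hdec : Decay 2 (flatSeries F θ f) :=
    decay_of_neg (fun _ hq _ => flatSeries_of_neg hq _) _ (by norm_num)
  rw [pairing_eq_resPair n (decay_genusZeroSeries hθ.1) hdec
    ((lowerBound_pullSeries θ).mul hQ0) (hQ.flatSeries hQ0), iterate_dop_mul (euler_pull_theta hθ.1),
    FrobeniusGerm.resPair, ← csum_equiv (Equiv.subLeft (-1 : ℤ))]
  have h1 : ∀ i : ℤ, ∑ c, ∑ d, ((-1 : ℂ) ^ (Equiv.subLeft (-1 : ℤ) i) * F.η⁻¹ c d) •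
      (genusZeroSeries F θ (Equiv.subLeft (-1 : ℤ) i) c *
        (pullSeries θ * Y).coeff (-2 - Equiv.subLeft (-1 : ℤ) i) d F.e) =
      csum fun m : ℕ => h (i, m) := by
    intro i
    rw [Finset.sum_comm]
    simp only [← smul_mul_assoc, ← Finset.sum_mul, sum_inv_η_genusZeroSeries, Equiv.subLeft_apply]
    rw [show -(-1 - i) - 1 = i by ring, show -2 - (-1 - i) = i - 1 by ring,
      coeff_mul_eq_sum (s := (i + n).toNat) (lowerBound_pullSeries θ) hY0 (by omega),
      csum_eq_sum (Finset.range (i + n).toNat)]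
    · simp only [Matrix.sum_apply, Finset.mul_sum]
      rw [Finset.sum_comm]
      refine Finset.sum_congr rfl fun m _ => ?_
      simp only [h, Matrix.vecMul, dotProduct, Finset.sum_mul, coeff_pullSeries, Matrix.mul_apply,
        Finset.mul_sum]
      rw [Finset.sum_comm]
      exact Finset.sum_congr rfl fun a _ => Finset.sum_congr rfl fun d _ => by rw [hY, mul_assoc]
    · intro m hm
      rw [Finset.mem_range] at hm
      simp only [h]
      exact Finset.sum_eq_zero fun a _ => by rw [hy _ (by omega), mul_zero]
  refine (congrArg csum (funext h1)).trans ?_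
  rw [← csum_prod hh]
  -- With i = j + m the vector y is evaluated at j - 1, independently of m, and the inner sum over m
  -- is 𝐬_j.
  let e : ℤ × ℕ ≃ ℤ × ℕ :=
    { toFun := fun p => (p.1 + p.2, p.2)
      invFun := fun p => (p.1 - p.2, p.2)
      left_inv := fun p => by simp
      right_inv := fun p => by simp }
  rw [← csum_equiv e, csum_prod (hh.comp_injective e.injective)]
  refine congrArg csum (funext fun j => ?_)
  have h2 : ∀ m : ℕ, h (e (j, m)) =
      ∑ a, (flatGen F θ (j + m) ᵥ* pullMat (θ m)) a * y (j - 1) a := by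
    intro m
    simp only [h, e, Equiv.coe_fn_mk]
    rw [show j + (m : ℤ) - 1 - m = j - 1 by ring]
  simp only [h2]
  have hc := fun a : A => (tame_flatGen hθ.1).cfin (fun n => pullMat (θ n)) j a
  refine (csum_sum fun a _ => (hc a).mul_right _).trans ?_
  refine Finset.sum_congr rfl fun a _ => ?_
  rw [csum_mul_right (hc a), sVec_eq_conv]
  rfl

/-! ### The second-order part of the Virasoro operators -/

theorem map_sigma_theta_zero (h : IsFundamental F θ) (k : ℕ) (a : A) :
    (pullMat (θ 0)).map (F.sigma k a) = 0 := by
  rw [map_sigma_pullMat, h.1]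
  simp [map_one_pderiv, pullMat_zero]

theorem map_sigma_theta_succ (h : IsFundamental F θ) (k : ℕ) (a : A) (n : ℕ) :
    (pullMat (θ (n + 1))).map (F.sigma k a) =
      if k = 0 then pullMat (θ n) * F.𝒲 a else 0 := by
  rw [map_sigma_pullMat]
  simp only [h.2, pullMat_mul, FrobeniusGerm.𝒲, Finset.mul_sum, Matrix.mul_smul]

variable (F) in
/-- The covariant derivative of the vector-valued series `y` along `σ_{j,c}`. -/
def covDeriv (j : ℕ) (c : A) (y : ℤ → A → Jet A) (m : ℤ) (d : A) : Jet A :=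
  F.sigma j c (y m d) + if j = 0 then ∑ f, F.𝒲 c d f * y (m - 1) f else 0

/-- Θ intertwines the trivial connection with ∇^z: the derivative of Θ along σ_{j,c} is zΘ𝒲_c for j
= 0 and zero otherwise, which is exactly the connection term of `covDeriv`. -/
theorem sigma_theta_mul (h : IsFundamental F θ) {N : ℤ} {Y Z : HahnSeries ℤ (Matrix A A (Jet A))}
    {y : ℤ → A → Jet A} {j : ℕ} {c : A} (hY0 : LowerBound N Y) (hY : IsColumn Y y)
    (hZ0 : LowerBound N Z) (hZ : IsColumn Z (covDeriv F j c y)) (m : ℤ) (b e : A) :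
    F.sigma j c ((pullSeries θ * Y).coeff m b e) = (pullSeries θ * Z).coeff m b e := by
  set s := (m - N).toNat + 1 with hs
  have hΘ := lowerBound_pullSeries θ
  have hvf := F.cfin_sigma j c
  rw [coeff_mul_eq_sum (s := s + 1) hΘ hY0 (by omega),
    coeff_mul_eq_sum (s := s) hΘ hZ0 (by omega), Matrix.sum_apply, Matrix.sum_apply]
  simp only [coeff_pullSeries, Matrix.mul_apply, hY _ _ e, hZ _ _ e]
  rw [F.sigma_eq]
  simp only [vf_sum hvf, vf_mul hvf]
  rw [← F.sigma_eq]
  have hY' : ∀ i : ℤ, i < N → ∀ a, y i a = 0 := fun i hi a => by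
    rw [← hY i a a, hY0 i hi, Matrix.zero_apply]
  simp only [Finset.sum_add_distrib, covDeriv, mul_add]
  rw [add_comm]
  congr 1
  · rw [Finset.sum_range_succ, add_eq_left]
    refine Finset.sum_eq_zero fun a _ => ?_
    rw [hY' _ (by omega), F.sigma_eq, vf_zero, mul_zero]
  · rw [Finset.sum_range_succ']
    have h0 : ∀ a, F.sigma j c (pullMat (θ 0) b a) = 0 := fun a =>
      congrFun (congrFun (map_sigma_theta_zero h j c) b) a
    simp only [h0, zero_mul, Finset.sum_const_zero, add_zero]
    refine Finset.sum_congr rfl fun l _ => ?_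
    have h1 : ∀ a, F.sigma j c (pullMat (θ (l + 1)) b a) =
        (if j = 0 then pullMat (θ l) * F.𝒲 c else 0 : Matrix A A (Jet A)) b a := fun a =>
      congrFun (congrFun (map_sigma_theta_succ h j c l) b) a
    simp only [h1]
    split_ifs
    · simp only [Matrix.mul_apply, Finset.sum_mul, Finset.mul_sum]
      rw [Finset.sum_comm]
      refine Finset.sum_congr rfl fun d _ => Finset.sum_congr rfl fun f _ => ?_
      rw [mul_assoc, Nat.cast_add_one, sub_sub]
    · simp

variable (F θ) in
/-- The second-order part of `Res η(∂(-z), z δ̃_z^n ∂(z))`. -/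
def secondOrder (n : ℕ) (f : Jet A) : Jet A :=
  ∑ i ∈ Finset.range n, ∑ p ∈ Finset.range n, ∑ a, ∑ c,
    kernelForm F θ n i p a c * flatField F θ i a (flatField F θ p c f)

theorem flatField_kernelForm_mul (h : IsFundamental F θ) (n : ℕ) (p q : ℤ) (i j : A) (k : ℕ)
    (a : A) (f : Jet A) : flatField F θ k a (kernelForm F θ n p q i j * f) =
      kernelForm F θ n p q i j * flatField F θ k a f := by
  have h1 : kernelForm F θ n p q ∈ flatMatrices F θ := by
    refine Subalgebra.smul_mem _ (mul_mem ?_ (tildeCoeff_mem_flatMatrices h _ _ _)) _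
    intro k a i j
    simp only [flatField, F.sigma_eq]
    refine Finset.sum_eq_zero fun _ _ => Finset.sum_eq_zero fun _ _ => ?_
    rw [constMat, Matrix.map_apply, vf_C, mul_zero]
  rw [flatField_mul, h1 k a i j, zero_mul, zero_add]

end

section

open MvPowerSeries (smul_eq_C_mul)

variable {A : Type*} [Fintype A] [DecidableEq A]
variable {F : FrobeniusGerm A} {θ : ℕ → Matrix A A (Base A)}

theorem Ico_zero_natCast (n : ℕ) :
    Finset.Ico (0 : ℤ) n = (Finset.range n).map Nat.castEmbedding := by
  ext x
  simp only [Finset.mem_Ico, Finset.mem_map, Nat.castEmbedding_apply, Finset.mem_range]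
  constructor
  · intro hx; exact ⟨x.toNat, by omega, by omega⟩
  · rintro ⟨y, hy, rfl⟩; omega

theorem secondOrder_eq_sum_flatField (hθ : IsSymmetricFundamental F θ) (n : ℕ) (f : Jet A)
    {G : HahnSeries ℤ (Matrix A A (Jet A))} (hG0 : LowerBound 0 G)
    (hG : IsColumn G (flatSeries F θ f)) :
    secondOrder F θ n f = ∑ i ∈ Finset.range n, ∑ a, flatField F θ i a
      (((-1 : ℂ) ^ i • (constMat (τ := ℕ × A) F.η⁻¹ *
        ((dop (pullSeries (Rcoef F θ)))^[n] G).coeff (-2 - i))) a F.e) := by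
  refine Finset.sum_congr rfl fun i _ => ?_
  rw [Finset.sum_comm]
  refine Finset.sum_congr rfl fun a _ => ?_
  have h := sum_kernelForm_mul (F := F) (θ := θ) (q := i) (n := n) (M := n) hG0 (by omega)
  rw [zpow_natCast] at h
  rw [← h, Ico_zero_natCast, Finset.sum_map, Matrix.sum_apply, flatField_sum]
  refine Finset.sum_congr rfl fun p _ => ?_
  rw [Matrix.mul_apply, flatField_sum]
  refine Finset.sum_congr rfl fun c _ => ?_
  rw [flatField_kernelForm_mul hθ.1, Nat.castEmbedding_apply, hG, flatSeries_natCast]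

/-- The factor Θ(-z) of the outer field, carried across η⁻¹, becomes Θ(z)⁻¹ by the symmetry of Θ. -/
theorem sum_inv_η_theta_mul (hθ : IsSymmetricFundamental F θ) (l : ℕ)
    (T : Matrix A A (Jet A)) (c e : A) :
    ∑ a, pullMat (θ l) a c * (((-1 : ℂ) ^ l • (constMat (τ := ℕ × A) F.η⁻¹ * T)) a e) =
      (constMat (τ := ℕ × A) F.η⁻¹ * (pullMat (thetaInv θ l) * T)) c e := by
  have h : constMat (τ := ℕ × A) F.η⁻¹ * pullMat (thetaInv θ l) =
      (-1 : ℂ) ^ l • ((pullMat (θ l))ᵀ * constMat F.η⁻¹) := by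
    rw [thetaInv_eq_adjoint hθ, pullMat_smul, pullMat_mul, pullMat_mul, pullMat_constMat,
      pullMat_constMat, mul_smul_comm, ← mul_assoc, ← mul_assoc, F.constMat_inv_mul_η, one_mul,
      pullMat_transpose]
  rw [← mul_assoc, h, smul_mul_assoc, mul_assoc, Matrix.smul_apply, Matrix.mul_apply,
    Finset.smul_sum]
  refine Finset.sum_congr rfl fun a _ => ?_
  rw [Matrix.smul_apply, mul_smul_comm, Matrix.transpose_apply]

/-- The second-order part of the Virasoro operators is intrinsic. -/
theorem secondOrder_eq (hθ : IsSymmetricFundamental F θ) (n : ℕ) (f : Jet A) :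
    secondOrder F θ n f = ∑ c, ∑ d, F.η⁻¹ c d • F.covSigma c
      (fun m => F.delta^[n] (F.sigmaSeries f) (m - 1)) (-1) d := by
  obtain ⟨Q, hQ0, hQ, hY0, hY⟩ := exists_iterate_delta (F := F) n f
  have hgauge := iterate_dop_mul (euler_pull_theta hθ.1) Q n
  set Y := (dop (rho F))^[n] Q
  set y := F.delta^[n] (F.sigmaSeries f)
  have hy : ∀ m, m < -(n : ℤ) → ∀ a, y m a = 0 := fun m hm a => by
    rw [← hY m a a, hY0 m hm, Matrix.zero_apply]
  have hZ : ∀ (j : ℕ) (c : A), ∃ Z : HahnSeries ℤ (Matrix A A (Jet A)),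
      LowerBound (-(n : ℤ)) Z ∧ IsColumn Z (covDeriv F j c y) := by
    intro j c
    refine exists_isColumn fun m hm a => ?_
    rw [covDeriv, hy m hm, F.sigma_eq, vf_zero, zero_add]
    simp [hy (m - 1) (by omega)]
  choose Z hZ0 hZ using hZ
  have hΘ := lowerBound_pullSeries θ
  have h1 : ∀ i : ℕ, ∑ a, flatField F θ i a (((-1 : ℂ) ^ i • (constMat (τ := ℕ × A) F.η⁻¹ *
        (pullSeries θ * Y).coeff (-2 - i))) a F.e) =
      ∑ p ∈ Finset.HasAntidiagonal.antidiagonal i, ∑ c, (-1 : ℂ) ^ p.2 •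
        (constMat (τ := ℕ × A) F.η⁻¹ * (pullMat (thetaInv θ p.1) *
          (pullSeries θ * Z p.2 c).coeff (-2 - i))) c F.e := by
    intro i
    simp only [flatField]
    rw [Finset.sum_comm]
    refine Finset.sum_congr rfl fun p hp => ?_
    rw [Finset.sum_comm]
    refine Finset.sum_congr rfl fun c _ => ?_
    rw [← sum_inv_η_theta_mul hθ, Finset.smul_sum]
    refine Finset.sum_congr rfl fun a _ => ?_
    rw [← mul_smul_comm ((-1 : ℂ) ^ p.2)]
    congr 1
    have hvf := F.cfin_sigma p.2 c
    rw [Matrix.smul_apply, Matrix.smul_apply, Matrix.mul_apply, Matrix.mul_apply, F.sigma_eq,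
      vf_smul, vf_sum hvf, smul_smul, ← pow_add, add_comm p.2,
      Finset.HasAntidiagonal.mem_antidiagonal.mp hp]
    congr 1
    refine Finset.sum_congr rfl fun b _ => ?_
    rw [vf_mul hvf, constMat, Matrix.map_apply, vf_C, zero_mul, zero_add, ← F.sigma_eq,
      sigma_theta_mul hθ.1 hY0 hY (hZ0 p.2 c) (hZ p.2 c)]
  rw [secondOrder_eq_sum_flatField hθ n f (hΘ.mul hQ0) (hQ.flatSeries hQ0), hgauge]
  simp only [h1]
  -- Grouping by the index j of the inner σ_j leaves, for each j, a sum over the coefficients of Θ⁻¹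
  -- alone.
  rw [← sum_range_sum_Ico n fun l j i => ∑ c, (-1 : ℂ) ^ j •
        (constMat (τ := ℕ × A) F.η⁻¹ * (pullMat (thetaInv θ l) *
          (pullSeries θ * Z j c).coeff (-2 - i))) c F.e]
  have h2 : ∀ j ∈ Finset.range n, ∑ i ∈ Finset.Ico j n, ∑ c, (-1 : ℂ) ^ j •
        (constMat (τ := ℕ × A) F.η⁻¹ * (pullMat (thetaInv θ (i - j)) *
          (pullSeries θ * Z j c).coeff (-2 - i))) c F.e =
      ∑ c, ∑ d, F.η⁻¹ c d • (-1 : ℂ) ^ j • covDeriv F j c y (-2 - j) d := by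
    intro j hj
    rw [Finset.mem_range] at hj
    rw [Finset.sum_comm]
    refine Finset.sum_congr rfl fun c _ => ?_
    rw [← Finset.smul_sum, ← Matrix.sum_apply, ← Finset.mul_sum, Finset.sum_Ico_eq_sum_range]
    -- That sum is a coefficient of Θ⁻¹(ΘZ) = Z; the cutoff n - j is where the lower bound of ΘZ
    -- makes further terms vanish.
    have h3 : ∑ l ∈ Finset.range (n - j), pullMat (thetaInv θ (j + l - j)) *
        (pullSeries θ * Z j c).coeff (-2 - ((j + l : ℕ) : ℤ)) = (Z j c).coeff (-2 - j) := by
      have h4 := coeff_mul_eq_sum (m := -2 - (j : ℤ)) (s := n - j)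
        (lowerBound_pullSeries (thetaInv θ)) (hΘ.mul (hZ0 j c)) (by omega)
      rw [← mul_assoc, pull_thetaInv_mul_theta hθ.1, one_mul] at h4
      rw [h4]
      refine Finset.sum_congr rfl fun l _ => ?_
      rw [coeff_pullSeries, add_tsub_cancel_left, Nat.cast_add, sub_sub]
    rw [h3, Matrix.mul_apply, Finset.smul_sum]
    refine Finset.sum_congr rfl fun d _ => ?_
    rw [hZ, smul_comm (F.η⁻¹ c d)]
    congr 1
    exact (smul_eq_C_mul _ _).symm
  rw [Finset.sum_congr rfl h2, Finset.sum_comm]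
  refine Finset.sum_congr rfl fun c _ => ?_
  rw [Finset.sum_comm]
  refine Finset.sum_congr rfl fun d _ => ?_
  rw [← Finset.smul_sum]
  congr 1
  rw [FrobeniusGerm.covSigma, csum_eq_sum (Finset.range n)]
  · simp only [covDeriv, smul_add, Finset.sum_add_distrib]
    congr 1
    · refine Finset.sum_congr rfl fun i _ => ?_
      rw [show (-1 : ℤ) - i - 1 = -2 - i by ring]
    -- Only j = 0 carries a connection term. For n = 0 the range is empty, but then y has no
    -- coefficient at z^{-3}.
    · rcases Nat.eq_zero_or_pos n with hn | hn
      · rw [hn, Finset.range_zero, Finset.sum_empty]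
        exact (Finset.sum_eq_zero fun f _ => by rw [hy _ (by omega), mul_zero]).symm
      · rw [Finset.sum_eq_single_of_mem 0 (Finset.mem_range.mpr hn)
          fun j _ hj => by rw [if_neg hj, smul_zero]]
        simp only [if_true, pow_zero, one_smul]
        norm_num
  · intro i hi
    rw [Finset.mem_range] at hi
    rw [hy _ (by omega), F.sigma_eq, vf_zero, smul_zero]

/-! ### The contribution of genus zero to genus one -/

/-- The complementary half of the vanishing coefficient of ΘΘ⁻¹, which is the form in which the
kernel occurs in the genus zero two-point functions. -/
theorem bezout_eq_sum {Q : Type*} [Ring Q] [Algebra ℂ Q] {θ φ : ℕ → Q} (hθ : θ 0 = 1)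
    (hθφ : PowerSeries.mk θ * PowerSeries.mk φ = 1) (p i : ℕ) :
    bezout θ φ p i =
      ∑ a ∈ Finset.HasAntidiagonal.antidiagonal p, θ a.1 * φ (a.2 + i + 1) := by
  induction p generalizing i with
  | zero => rw [bezout_zero_left hθ hθφ]; simp [hθ]
  | succ p ih =>
    rw [← sub_add_cancel (bezout θ φ (p + 1) i), ← bezout_succ, ih,
      Finset.Nat.sum_antidiagonal_succ', add_comm]
    congr 1
    · rw [zero_add]
    · exact Finset.sum_congr rfl fun a _ => by rw [add_right_comm a.2 1 i, add_assoc a.2 i 1]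

/-- In the contraction of the kernel with the two-point matrix, η⁻¹ meets η and the two signs (-1)^i
cancel. -/
theorem secondOrder_genusZero (hθ : IsSymmetricFundamental F θ) (n : ℕ) :
    secondOrder F θ n (genusZero F θ) = ∑ i ∈ Finset.range n, ∑ p ∈ Finset.range n,
      (tildeCoeff F θ n p (-2 - i) *
        bezout (fun m => pullMat (θ m)) (fun m => pullMat (thetaInv θ m)) p i).trace := by
  refine Finset.sum_congr rfl fun i _ => Finset.sum_congr rfl fun p _ => ?_
  have hv : twoPoint F θ p i = (-1 : ℂ) ^ i •
      (bezout (fun m => pullMat (θ m)) (fun m => pullMat (thetaInv θ m)) p i * constMat F.η) := by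
    have h0 : pullMat (θ 0) = 1 := by rw [hθ.1.1, pullMat_one]
    rw [bezout_eq_sum (θ := fun m => pullMat (θ m)) (φ := fun m => pullMat (thetaInv θ m)) h0
      (mk_pull_theta_mul hθ.1) p i, twoPoint, smul_mul_assoc]
  simp only [flatField_flatField_genusZero hθ]
  have h1 : ∑ a, ∑ c, kernelForm F θ n i p a c * twoPoint F θ i p a c =
      (kernelForm F θ n i p * twoPoint F θ p i).trace := by
    rw [← twoPoint_transpose hθ i p, Matrix.trace]
    exact Finset.sum_congr rfl fun a _ => by rw [Matrix.diag_apply, Matrix.mul_apply]; rfl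
  rw [h1, hv, kernelForm, zpow_natCast, smul_mul_smul_comm, ← mul_pow, neg_one_mul, neg_neg,
    one_pow, one_smul, Matrix.trace_mul_comm, mul_assoc, ← mul_assoc (constMat F.η),
    F.constMat_η_mul_inv, one_mul, Matrix.trace_mul_comm]

end

section

open MvPowerSeries (smul_eq_C_mul)

variable {A : Type*} [Fintype A] [DecidableEq A]
variable {F : FrobeniusGerm A} {θ : ℕ → Matrix A A (Base A)}

/-! ### Expansion of the Virasoro constraints -/

variable (F θ) in
/-- The sequence `ℱ_g`, `g ≥ 0`. -/
def potential (Fg : ℕ → Jet A) (g : ℕ) : Jet A := if g = 0 then genusZero F θ else Fg g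

variable (F θ) in
/-- The coefficients of `z^q ħ^g` in `exp(-S) ∘ Φ(z) ∘ exp(S) 1`. -/
def freeSeries (Fg : ℕ → Jet A) (g : ℕ) : ℤ → A → Jet A :=
  if g = 0 then genusZeroSeries F θ else flatSeries F θ (Fg g)

theorem decay_freeSeries (h : IsFundamental F θ) (Fg : ℕ → Jet A) (g : ℕ) :
    Decay 2 (freeSeries F θ Fg g) := by
  rw [freeSeries]
  split_ifs
  · exact decay_genusZeroSeries h
  · exact decay_of_neg (fun _ hq _ => flatSeries_of_neg hq _) _ (by norm_num)

theorem freeSeries_natCast (hθ : IsSymmetricFundamental F θ) (Fg : ℕ → Jet A) (g k : ℕ) (a : A) :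
    freeSeries F θ Fg g k a = flatField F θ k a (potential F θ Fg g) := by
  rw [freeSeries, potential]
  split_ifs
  · rw [flatField_genusZero hθ, genusZeroSeries, zpow_natCast]
  · rw [flatSeries_natCast]

theorem freeSeries_negSucc (Fg : ℕ → Jet A) (g i : ℕ) (a : A) :
    freeSeries F θ Fg g (Int.negSucc i) a =
      if g = 0 then (-1 : ℂ) ^ (i + 1) • ∑ b, F.η a b • flatGen F θ i b else 0 := by
  rw [freeSeries]
  split_ifs
  · rw [genusZeroSeries, zpow_negSucc, ← inv_pow, show (-1 : ℂ)⁻¹ = -1 by norm_num,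
      show -(Int.negSucc i) - 1 = (i : ℤ) by rw [Int.neg_negSucc]; push_cast; ring]
  · exact flatSeries_of_neg (Int.negSucc_lt_zero i) a

variable (F θ) in
/-- The coefficient of `z^q` in `exp(-S) ∘ Φ(z) ∘ exp(S) 1`. -/
def freeHbar (Fg : ℕ → Jet A) (q : ℤ) (a : A) : Hbar A :=
  HahnSeries.ofPowerSeries ℤ (Jet A) (PowerSeries.mk fun g => freeSeries F θ Fg g q a)

theorem hbar_mul_flatFieldHbar_totalPotential (hθ : IsSymmetricFundamental F θ) (Fg : ℕ → Jet A)
    (k : ℕ) (a : A) :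
    hbar * flatFieldHbar F θ k a (totalPotential F θ Fg) = freeHbar F θ Fg k a := by
  ext m : 2
  rw [hbar, HahnSeries.coeff_single_mul, one_mul, flatFieldHbar, HahnSeries.map_coeff]
  change flatField F θ k a _ = _
  rw [totalPotential, HahnSeries.coeff_single_mul, one_mul, freeHbar, sub_neg_eq_add,
    sub_add_cancel, coeff_ofPowerSeries, coeff_ofPowerSeries]
  split_ifs
  · rw [PowerSeries.coeff_mk, PowerSeries.coeff_mk, freeSeries_natCast hθ]
    rfl
  · exact flatField_zero F θ k a

theorem freeMul_eq (Fg : ℕ → Jet A) (i : ℕ) (a : A) :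
    freeMul F θ i a = freeHbar F θ Fg (Int.negSucc i) a := by
  rw [freeHbar]
  simp only [freeSeries_negSucc]
  rw [freeMul, ← HahnSeries.ofPowerSeries_C]
  congr 1
  ext g : 1
  rw [PowerSeries.coeff_C, PowerSeries.coeff_mk]

theorem conjField_one (S : Hbar A) (k : ℕ) (a : A) :
    conjField F θ S k a 1 = flatFieldHbar F θ k a S := by
  have h : flatFieldHbar F θ k a 1 = 0 := by
    ext m : 2
    rw [flatFieldHbar, HahnSeries.map_coeff, HahnSeries.coeff_one]
    change flatField F θ k a _ = 0
    split_ifs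
    · exact flatField_one k a
    · exact flatField_zero F θ k a
  rw [conjField, h, zero_add, mul_one]

/-- The second derivatives occurring in the conjugated Virasoro operators. -/
def secondSeries (F : FrobeniusGerm A) (θ : ℕ → Matrix A A (Base A)) (f : Jet A) (p q : ℤ)
    (a c : A) : Jet A :=
  if 0 ≤ p then flatField F θ p.toNat a (flatSeries F θ f q c) else 0

theorem secondSeries_natCast (f : Jet A) (i p : ℕ) (a c : A) :
    secondSeries F θ f i p a c = flatField F θ i a (flatField F θ p c f) := by
  rw [secondSeries, if_pos (by omega), Int.toNat_natCast, flatSeries_natCast]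

theorem secondSeries_of_neg {f : Jet A} {p q : ℤ} (h : p < 0 ∨ q < 0) (a c : A) :
    secondSeries F θ f p q a c = 0 := by
  rcases h with h | h
  · exact if_neg (by omega)
  · rw [secondSeries, flatSeries_of_neg h, flatField_zero, ite_self]

/-- Acting on 1, every conjugated field contributes its expectation, so normal ordering leaves a
product. Two derivations contribute in addition ħ²∂∂S, and the coefficient of ħ^{g+1} in this comes
from F_g because S starts at ħ⁻¹. -/
theorem coeff_normalProd (hθ : IsSymmetricFundamental F θ) (Fg : ℕ → Jet A) (p q : ℤ) (a c : A)
    (g : ℕ) :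
    (normalProd F θ (conjField F θ (totalPotential F θ Fg)) p a q c 1).coeff ((g + 1 : ℕ) : ℤ) =
      ∑ x ∈ Finset.HasAntidiagonal.antidiagonal (g + 1),
        freeSeries F θ Fg x.1 p a * freeSeries F θ Fg x.2 q c +
      secondSeries F θ (potential F θ Fg g) p q a c := by
  have h1 : ∑ x ∈ Finset.HasAntidiagonal.antidiagonal (g + 1),
        freeSeries F θ Fg x.1 p a * freeSeries F θ Fg x.2 q c =
      (freeHbar F θ Fg p a * freeHbar F θ Fg q c).coeff ((g + 1 : ℕ) : ℤ) := by
    rw [freeHbar, freeHbar, ← map_mul, HahnSeries.ofPowerSeries_apply_coeff, PowerSeries.coeff_mul]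
    simp only [PowerSeries.coeff_mk]
  have hS := hbar_mul_flatFieldHbar_totalPotential hθ Fg
  rw [h1]
  rcases p with i | i <;> rcases q with j | j
  · simp only [normalProd]
    rw [conjField_one, conjField, mul_add, HahnSeries.coeff_add, add_comm]
    congr 1
    · have : hbar ^ 2 * (flatFieldHbar F θ i a (totalPotential F θ Fg) *
          flatFieldHbar F θ j c (totalPotential F θ Fg)) =
          (hbar * flatFieldHbar F θ i a (totalPotential F θ Fg)) *
          (hbar * flatFieldHbar F θ j c (totalPotential F θ Fg)) := by ring
      rw [this, hS, hS]
      rfl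
    · rw [Int.ofNat_eq_natCast, Int.ofNat_eq_natCast, secondSeries_natCast, hbar,
        HahnSeries.single_pow, one_pow, HahnSeries.coeff_single_mul, one_mul, flatFieldHbar,
        HahnSeries.map_coeff, flatFieldHbar, HahnSeries.map_coeff]
      change flatField F θ i a (flatField F θ j c _) = _
      rw [totalPotential, HahnSeries.coeff_single_mul, one_mul,
        show ((g + 1 : ℕ) : ℤ) - 2 • (1 : ℤ) - -1 = (g : ℤ) by push_cast; ring,
        HahnSeries.ofPowerSeries_apply_coeff, PowerSeries.coeff_mk]
      rfl
  · simp only [normalProd]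
    rw [secondSeries_of_neg (Or.inr (Int.negSucc_lt_zero j)), add_zero, conjField_one,
      mul_right_comm, hS, freeMul_eq Fg]
    rfl
  · simp only [normalProd]
    rw [secondSeries_of_neg (Or.inl (Int.negSucc_lt_zero i)), add_zero, conjField_one,
      mul_comm hbar, mul_assoc, hS, freeMul_eq Fg]
    rfl
  · simp only [normalProd]
    rw [secondSeries_of_neg (Or.inl (Int.negSucc_lt_zero i)), add_zero, mul_one, freeMul_eq Fg,
      freeMul_eq Fg]

theorem csum_secondSeries (n : ℕ) (f : Jet A) :
    CFin (fun q : ℤ × ℤ => ∑ a, ∑ c,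
      kernelForm F θ n q.1 q.2 a c * secondSeries F θ f q.1 q.2 a c) ∧
    (csum fun q : ℤ × ℤ => ∑ a, ∑ c,
      kernelForm F θ n q.1 q.2 a c * secondSeries F θ f q.1 q.2 a c) = secondOrder F θ n f := by
  have h : ∀ q : ℤ × ℤ, q ∉ (Finset.Ico (0 : ℤ) n) ×ˢ (Finset.Ico (0 : ℤ) n) → ∑ a, ∑ c,
      kernelForm F θ n q.1 q.2 a c * secondSeries F θ f q.1 q.2 a c = 0 := by
    intro q hq
    refine Finset.sum_eq_zero fun a _ => Finset.sum_eq_zero fun c _ => ?_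
    by_cases hneg : q.1 < 0 ∨ q.2 < 0
    · rw [secondSeries_of_neg hneg, mul_zero]
    · rw [Finset.mem_product, Finset.mem_Ico, Finset.mem_Ico] at hq
      rw [kernelForm_of_lt (by omega), Matrix.zero_apply, zero_mul]
  refine ⟨CFin.of_support_subset _ h, ?_⟩
  rw [csum_eq_sum _ h, Finset.sum_product, Ico_zero_natCast, Finset.sum_map]
  refine Finset.sum_congr rfl fun i _ => ?_
  rw [Finset.sum_map]
  refine Finset.sum_congr rfl fun p _ => Finset.sum_congr rfl fun a _ =>
    Finset.sum_congr rfl fun c _ => ?_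
  rw [Nat.castEmbedding_apply, Nat.castEmbedding_apply, secondSeries_natCast]

/-- The prefactor 1/ħ of L_k matches ħ^{g+1} in the quadratic expression with the genus g + 1
constraint. The constant term of L_k sits at ħ⁰, which is genus one, hence the condition g = 0. -/
theorem constraint_succ (hθ : IsSymmetricFundamental F θ) (Fg : ℕ → Jet A) (k : ℤ) (g : ℕ) :
    constraint F θ Fg k (g + 1) =
      (1 / 2 : ℂ) • (∑ x ∈ Finset.HasAntidiagonal.antidiagonal (g + 1),
        pairing F θ (k + 1).toNat (freeSeries F θ Fg x.1) (freeSeries F θ Fg x.2) +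
        secondOrder F θ (k + 1).toNat (potential F θ Fg g)) -
      if k = 0 ∧ g = 0 then
        ((1 / 4 : ℂ) * (F.μ * F.μ - (1 / 4 : ℂ) • (1 : Matrix A A ℂ)).trace) • (1 : Jet A)
      else 0 := by
  set n := (k + 1).toNat with hn
  rw [constraint, virOp]
  congr 1
  · have h1 : ∀ q : ℤ × ℤ, ∑ a, ∑ b, ∑ c, ((1 / 2 : ℂ) * (-1 : ℂ) ^ q.1 * F.η⁻¹ a b) •
        (kernelMat F θ n q.2 (-1 - q.1) b c *
          (normalProd F θ (conjField F θ (totalPotential F θ Fg)) q.1 a q.2 c 1).coeff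
            (((g + 1 : ℕ) : ℤ) - 1 + 1)) =
        (1 / 2 : ℂ) • (∑ x ∈ Finset.HasAntidiagonal.antidiagonal (g + 1),
          pairTerm F θ n (freeSeries F θ Fg x.1) (freeSeries F θ Fg x.2) q +
          ∑ a, ∑ c, kernelForm F θ n q.1 q.2 a c *
            secondSeries F θ (potential F θ Fg g) q.1 q.2 a c) := by
      intro q
      have h2 : ∑ x ∈ Finset.HasAntidiagonal.antidiagonal (g + 1),
          pairTerm F θ n (freeSeries F θ Fg x.1) (freeSeries F θ Fg x.2) q =
          ∑ a, ∑ c, kernelForm F θ n q.1 q.2 a c *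
            ∑ x ∈ Finset.HasAntidiagonal.antidiagonal (g + 1),
              freeSeries F θ Fg x.1 q.1 a * freeSeries F θ Fg x.2 q.2 c := by
        simp only [pairTerm, Finset.mul_sum]
        rw [Finset.sum_comm]
        exact Finset.sum_congr rfl fun a _ => Finset.sum_comm
      rw [h2, ← Finset.sum_add_distrib, Finset.smul_sum, sub_add_cancel]
      refine Finset.sum_congr rfl fun a _ => ?_
      rw [Finset.sum_comm, ← Finset.sum_add_distrib, Finset.smul_sum]
      refine Finset.sum_congr rfl fun c _ => ?_
      rw [← mul_add, ← coeff_normalProd hθ, kernelForm, Matrix.smul_apply, Matrix.mul_apply,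
        Finset.smul_sum, Finset.sum_mul, Finset.smul_sum]
      refine Finset.sum_congr rfl fun b _ => ?_
      rw [kernelMat_eq, show -1 - q.1 - 1 = -2 - q.1 by ring, mul_assoc, mul_smul, mul_smul,
        smul_mul_assoc, mul_assoc, smul_eq_C_mul _ (F.η⁻¹ a b)]
      rfl
    refine (congrArg csum (funext h1)).trans ?_
    have hc : ∀ x ∈ Finset.HasAntidiagonal.antidiagonal (g + 1), CFin
        (pairTerm F θ n (freeSeries F θ Fg x.1) (freeSeries F θ Fg x.2)) := fun x _ =>
      cfin_pairTerm n (decay_freeSeries hθ.1 Fg _) (decay_freeSeries hθ.1 Fg _)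
    rw [csum_smul, csum_add (CFin.sum hc) (csum_secondSeries n _).1, csum_sum hc,
      (csum_secondSeries n _).2]
    rfl
  · rw [HahnSeries.coeff_one]
    push_cast
    rw [add_sub_cancel_right]
    by_cases hk : k = 0 <;> by_cases hg : g = 0 <;> simp [hk, hg]

end

/-! ### Intrinsic form of the constraints and the genus one trace -/

section

open MvPowerSeries (smul_eq_C_mul)

variable {A : Type*} [Fintype A] [DecidableEq A]
variable {F : FrobeniusGerm A} {θ : ℕ → Matrix A A (Base A)}

theorem freeSeries_zero (Fg : ℕ → Jet A) : freeSeries F θ Fg 0 = genusZeroSeries F θ := if_pos rfl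

theorem freeSeries_succ (Fg : ℕ → Jet A) (g : ℕ) :
    freeSeries F θ Fg (g + 1) = flatSeries F θ (Fg (g + 1)) := if_neg (Nat.succ_ne_zero g)

theorem secondOrder_eq_Delta (hθ : IsSymmetricFundamental F θ) (k : ℤ) (f : Jet A) :
    (1 / 2 : ℂ) • secondOrder F θ (k + 1).toNat f = F.Delta k f := by
  rw [secondOrder_eq hθ]
  rfl

/-- The Virasoro constraints in positive genus in terms of the operators on the jet space. -/
theorem constraint_succ_eq (hθ : IsSymmetricFundamental F θ) (Fg : ℕ → Jet A) (k : ℤ) (g : ℕ) :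
    constraint F θ Fg k (g + 1) = virField F θ k (Fg (g + 1)) +
      (1 / 2 : ℂ) • secondOrder F θ (k + 1).toNat (potential F θ Fg g) +
      (1 / 2 : ℂ) • ∑ i ∈ Finset.Icc 1 g, F.resPair (F.sigmaSeries (Fg i))
        (F.delta^[(k + 1).toNat] (F.sigmaSeries (Fg (g + 1 - i)))) -
      if k = 0 ∧ g = 0 then
        ((1 / 4 : ℂ) * (F.μ * F.μ - (1 / 4 : ℂ) • (1 : Matrix A A ℂ)).trace) • (1 : Jet A)
      else 0 := by
  have hsum : ∑ i ∈ Finset.Icc 1 g, F.resPair (F.sigmaSeries (Fg i))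
        (F.delta^[(k + 1).toNat] (F.sigmaSeries (Fg (g + 1 - i)))) =
      ∑ i ∈ Finset.range g, pairing F θ (k + 1).toNat (freeSeries F θ Fg (i + 1))
        (freeSeries F θ Fg (g + 1 - (i + 1))) := by
    rw [← Finset.Ico_add_one_right_eq_Icc, Finset.sum_Ico_eq_sum_range, Nat.add_sub_cancel]
    refine Finset.sum_congr rfl fun i hi => ?_
    rw [Finset.mem_range] at hi
    rw [show g + 1 - (i + 1) = (g - i - 1) + 1 by omega, freeSeries_succ, freeSeries_succ,
      pairing_flatSeries hθ, show g + 1 - (1 + i) = (g - i - 1) + 1 by omega, add_comm 1 i]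
  have hvir : pairing F θ (k + 1).toNat (freeSeries F θ Fg 0) (freeSeries F θ Fg (g + 1)) =
      virField F θ k (Fg (g + 1)) := by
    rw [freeSeries_zero, freeSeries_succ, pairing_genusZeroSeries hθ]
    rfl
  rw [constraint_succ hθ, Finset.Nat.sum_antidiagonal_eq_sum_range_succ_mk, Finset.sum_range_succ,
    Finset.sum_range_succ', ← hsum]
  simp only [Nat.sub_self, Nat.sub_zero]
  -- The two extreme terms of the quadratic sum are equal, and with the prefactor 1/2 they give ℒ_k
  -- F_{g+1} once.
  rw [pairing_comm hθ _ (freeSeries F θ Fg (g + 1)), hvir]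
  congr 1
  module

/-- The genus zero contribution to the Virasoro constraints in genus one. -/
theorem secondOrder_genusZero_eq_trace (hθ : IsSymmetricFundamental F θ) (k : ℤ) (hk : -1 ≤ k) :
    ((1 / 2 : ℂ) • secondOrder F θ (k + 1).toNat (genusZero F θ) -
      if k = 0 then
        ((1 / 4 : ℂ) * (F.μ * F.μ - (1 / 4 : ℂ) • (1 : Matrix A A ℂ)).trace) • (1 : Jet A)
      else 0) =
    -((1 / 4 : ℂ) • ∑ l ∈ Finset.range (k + 1).toNat,
      (constMat (F.μ - (1 / 2 : ℂ) • (1 : Matrix A A ℂ)) * pullMat F.𝒰 ^ l *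
        constMat (F.μ + (1 / 2 : ℂ) • (1 : Matrix A A ℂ)) *
        pullMat F.𝒰 ^ (k.toNat - l)).trace) := by
  have hM : constMat (F.μ - (1 / 2 : ℂ) • (1 : Matrix A A ℂ)) =
      constMat (τ := ℕ × A) (F.μ + (1 / 2 : ℂ) • (1 : Matrix A A ℂ)) - 1 := by
    rw [← constMat_one, ← constMat_sub]
    congr 1
    module
  rcases hk.eq_or_lt with rfl | hk
  -- For k = -1 the operator δ̃_z does not occur and all sums are empty.
  · simp [secondOrder]
  obtain ⟨κ, rfl⟩ := Int.eq_ofNat_of_zero_le (show 0 ≤ k by omega)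
  have hn : ((κ : ℤ) + 1).toNat = κ + 1 := by omega
  rw [hn, Int.toNat_natCast, secondOrder_genusZero hθ]
  rcases Nat.eq_zero_or_pos κ with rfl | hκ
  -- For k = 0 one application of δ̃_z to z⁰ does not reach z^{-2}, so the two-point contribution
  -- vanishes. The constant of L_0 alone accounts for (μ - 1/2)(μ + 1/2) = μ² - 1/4.
  · have h0 : tildeCoeff F θ (0 + 1) ((0 : ℕ) : ℤ) (-2 - ((0 : ℕ) : ℤ)) = 0 :=
      tildeCoeff_of_lt (by norm_num)
    rw [Finset.sum_range_one, Finset.sum_range_one, Finset.sum_range_one, h0, zero_mul,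
      Matrix.trace_zero, smul_zero, zero_sub, if_pos Nat.cast_zero, pow_zero, mul_one, mul_one,
      ← constMat_mul]
    congr 1
    have h1 : (F.μ - (1 / 2 : ℂ) • (1 : Matrix A A ℂ)) * (F.μ + (1 / 2 : ℂ) • 1) =
        F.μ * F.μ - (1 / 4 : ℂ) • 1 := by
      rw [sub_mul, mul_add, mul_add, smul_mul_assoc, smul_mul_assoc, mul_smul_comm, mul_smul_comm,
        one_mul, one_mul, mul_one]
      module
    have h2 : ∀ T : Matrix A A ℂ, (constMat (τ := ℕ × A) T).trace = T.trace • (1 : Jet A) := by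
      intro T
      rw [smul_eq_C_mul, mul_one, Matrix.trace, Matrix.trace, map_sum]
      rfl
    rw [h1, h2, smul_smul]
  · rw [if_neg (by omega), sub_zero]
    obtain ⟨S, hS⟩ := exists_grading hθ.1 hθ.2.1
    have h := trace_bezout (tr := Matrix.traceLinearMap A ℂ (Jet A))
      (θ := fun m => pullMat (θ m)) (φ := fun m => pullMat (thetaInv θ m))
      (R := fun m => pullMat (Rcoef F θ m)) (S := constMat S)
      (fun a b => Matrix.trace_mul_comm a b)
      (by simp only [hθ.1.1, pullMat_one]) (by simp only [thetaInv_zero hθ.1, pullMat_one])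
      (mk_pull_Rcoef_mul hθ.1) (mk_pull_theta_mul hθ.1) (mk_pull_thetaInv_mul hθ.1)
      (fun j => by
        rw [← pullMat_constMat, ← pullMat_mul, ← pullMat_mul, ← pullMat_smul, ← pullMat_neg,
          ← hS j]
        exact (map_sub pullHom _ _).symm) κ
    -- For k > 0 the common factor k in `trace_bezout` can be cancelled.
    have h' := smul_right_injective (Jet A) (Nat.cast_ne_zero.mpr hκ.ne' : (κ : ℂ) ≠ 0) h
    rw [hM]
    refine (congrArg (fun x => (1 / 2 : ℂ) • x) h').trans ?_
    simp only [Matrix.traceLinearMap_apply]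
    rw [smul_neg, smul_smul]
    norm_num

end

end

end JetVirasoro

theorem mainTheorem8 {A : Type*} [Fintype A] [DecidableEq A] (F : FrobeniusGerm A)
    (θ : ℕ → Matrix A A (Base A)) (hθ : IsSymmetricFundamental F θ)
    (Fg : ℕ → Jet A) (k : ℤ) (hk : -1 ≤ k) :
    ((∀ j : ℤ, j ≤ 0 → sVec F θ j = 0) ∧
      (∀ n : ℕ, sVec F θ ((n : ℤ) + 1) = intrinsicSucc F n)) ∧
    (∀ g : ℕ, 1 < g →
      (constraint F θ Fg k g = 0 ↔
        virField F θ k (Fg g) + F.Delta k (Fg (g - 1)) +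
          (1 / 2 : ℂ) • ∑ i ∈ Finset.Icc 1 (g - 1),
            F.resPair (F.sigmaSeries (Fg i))
              (F.delta^[(k + 1).toNat] (F.sigmaSeries (Fg (g - i)))) = 0)) ∧
    (constraint F θ Fg k 1 = 0 ↔
      virField F θ k (Fg 1) =
        (1 / 4 : ℂ) • ∑ l ∈ Finset.range (k + 1).toNat,
          (constMat (F.μ - (1 / 2 : ℂ) • (1 : Matrix A A ℂ)) * pullMat F.𝒰 ^ l *
            constMat (F.μ + (1 / 2 : ℂ) • (1 : Matrix A A ℂ)) *
            pullMat F.𝒰 ^ (k.toNat - l)).trace) := by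
  refine ⟨⟨fun j hj => ?_, fun n => ?_⟩, fun g hg => ?_, ?_⟩
  · rw [sVec_eq hθ.1]
    exact F.sInt_of_nonpos hj
  · rw [sVec_eq hθ.1]
    rfl
  · obtain ⟨g, rfl⟩ := Nat.exists_eq_add_of_lt hg
    -- Writing the genus as g + 2 makes the potential in the second-order term F_{g+1} of positive
    -- genus, so it is the given function and no constant appears.
    rw [show 1 + g + 1 = g + 1 + 1 by ring, constraint_succ_eq hθ, Nat.add_sub_cancel,
      secondOrder_eq_Delta hθ, if_neg (by omega), sub_zero, potential, if_neg (Nat.succ_ne_zero g)]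
  · have h := constraint_succ_eq hθ Fg k 0
    have ht := secondOrder_genusZero_eq_trace hθ k hk
    rw [Finset.Icc_eq_empty (by norm_num), Finset.sum_empty, smul_zero, add_zero, zero_add,
      potential, if_pos rfl, add_sub_assoc] at h
    simp only [and_true] at h
    rw [ht] at h
    rw [h, ← sub_eq_add_neg, sub_eq_zero]
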